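/- Let $\mathbb{M}$ be a Riemannian symmetric space, that is, a connected Riemannian manifold such that for each $p\in\mathbb{M}$ there is an isometry $\sigma_p$ of $\mathbb{M}$ that fixes $p$ and whose differential at $p$ is $-\mathrm{id}$. Let $o\in\mathbb{M}$, $\lambda>0$, and let $\mathcal P$ be the Poisson point process on $\mathbb{M}$ with intensity measure $\lambda\operatorname{Vol}_{\mathbb{M}}$: a random locally finite subset of $\mathbb{M}$ such that for disjoint compact sets $A_1,\dots,A_n$ the numbers $|\mathcal P\cap A_i|$ are independent and Poisson distributed with means $\lambda\operatorname{Vol}_{\mathbb{M}}(A_i)$. Put $\Pi=\mathcal P\cup\{o\}$. Let \[ V(o)=\{y\in\mathbb{M} : d(o,y)=\min_{s\in\Pi}d(s,y)\} \] be the Voronoi cell of $o$, and let $\deg(o)\in\{0,1,2,\dots,\infty\}$ be the degree of $o$ in the Delaunay graph of $\Pi$, in which two distinct points $x,y\in\Pi$ are adjacent if there are $z\in\mathbb{M}$ and $r>0$ with $d(x,z)=d(y,z)=r$ such that the open ball $B(z,r)$ contains no point of $\Pi$. Then for every real $k\ge 0$ \[ \mathbb{E}\big[\operatorname{Vol}_{\mathbb{M}}(V(o))^k\big]<\infty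 \qquad\text{and}\qquad \mathbb{E}\big[\deg(o)^k\big]<\infty . \] Moreover, $\mathcal P$ is stationary (its law is invariant under all isometries of $\mathbb{M}$, and its intensity measure is finite on compact sets), and $\Pi$ is its Palm process at $o$: with $\Pi_o=\Pi$, there is a measurable family of point processes $(\Pi_x)_{x\in\mathbb{M}}$ such that $g(\Pi_x)$ has the law of $\Pi_{g(x)}$ for every isometry $g$ and every $x$, and \[ \mathbb{E}\Big[\sum_{x\in\mathcal P}f(x,\mathcal P)\Big]=\int_{\mathbb{M}}\mathbb{E}[f(x,\Pi_x)]\,\Lambda(dx) \] for all measurable $f\ge0$, where $\Lambda(A)=\mathbb{E}|\mathcal P\cap A|$. In particular $\Pi$ is a distributional lattice: it is the Palm process at $o$ of a stationary point process with nonzero intensity, and $\mathbb{E}[\operatorname{Vol}_{\mathbb{M}}(V(o))]<\infty$ and $\mathbb{E}[\deg(o)]<\infty$. -/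

import Mathlib

open MeasureTheory ProbabilityTheory Bundle Set
open scoped Manifold ContDiff ENNReal NNReal

noncomputable section

namespace PoissonVoronoi

/-! ### Riemannian symmetric spaces and the Riemannian volume -/

section Riemannian

variable (d : ℕ) {M : Type*} [TopologicalSpace M] [ChartedSpace (EuclideanSpace ℝ (Fin d)) M]
  [RiemannianBundle (fun x : M => TangentSpace (𝓡 d) x)]

/-- A smooth diffeomorphism of `M` is a Riemannian isometry if its differential preserves the
inner product of tangent vectors. -/
def IsRiemannianIsometry (g : M ≃ₘ^∞⟮𝓡 d, 𝓡 d⟯ M) : Prop :=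
  ∀ (x : M) (v w : TangentSpace (𝓡 d) x),
    inner ℝ (mfderiv (𝓡 d) (𝓡 d) g x v) (mfderiv (𝓡 d) (𝓡 d) g x w) = inner ℝ v w

/-- At each point `p` there is an isometry that fixes `p` and whose differential at `p` is
multiplication by `-1`. (All tangent spaces of `M` are copies of the model space, and the copies
at `p` and at `σ p = p` agree.) -/
def IsRiemannianSymmetric (M : Type*) [TopologicalSpace M]
    [ChartedSpace (EuclideanSpace ℝ (Fin d)) M]
    [RiemannianBundle (fun x : M => TangentSpace (𝓡 d) x)] : Prop :=
  ∀ p : M, ∃ σ : M ≃ₘ^∞⟮𝓡 d, 𝓡 d⟯ M, IsRiemannianIsometry d σ ∧ σ p = p ∧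
    ∀ v : EuclideanSpace ℝ (Fin d),
      (mfderiv (𝓡 d) (𝓡 d) σ p v : EuclideanSpace ℝ (Fin d)) = -v

/-- The matrix `g_{ij}` of the Riemannian metric in the chart at `x`, as a function of the
coordinates `y`: the Gram matrix of the coordinate vector fields. -/
def metricMatrix (x : M) (y : EuclideanSpace ℝ (Fin d)) : Matrix (Fin d) (Fin d) ℝ :=
  Matrix.of fun i j =>
    inner ℝ
      (mfderiv (𝓡 d) (𝓡 d) (chartAt (EuclideanSpace ℝ (Fin d)) x).symm y
        (EuclideanSpace.single i (1 : ℝ) : EuclideanSpace ℝ (Fin d)))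
      (mfderiv (𝓡 d) (𝓡 d) (chartAt (EuclideanSpace ℝ (Fin d)) x).symm y
        (EuclideanSpace.single j (1 : ℝ) : EuclideanSpace ℝ (Fin d)))

/-- The Riemannian volume on the domain of the chart at `x` (zero outside it): the measure with
density `√ det (g_{ij})` with respect to Lebesgue measure in the coordinates. -/
def chartVolume [MeasurableSpace M] (x : M) : Measure M :=
  ((volume.restrict (chartAt (EuclideanSpace ℝ (Fin d)) x).target).withDensity
    (fun y => ENNReal.ofReal (Real.sqrt (metricMatrix d x y).det))).map
    (chartAt (EuclideanSpace ℝ (Fin d)) x).symm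

/-- The Riemannian volume measure, glued from the charts: the measures on the chart domains agree
on overlaps, and the volume is the least measure that dominates them all. On a (second countable)
Riemannian manifold it is the unique Borel measure that restricts to `chartVolume d x` on the
domain of the chart at `x`, for each `x`. -/
def riemannianVolume (M : Type*) [TopologicalSpace M]
    [ChartedSpace (EuclideanSpace ℝ (Fin d)) M]
    [RiemannianBundle (fun x : M => TangentSpace (𝓡 d) x)] [MeasurableSpace M] : Measure M :=
  ⨆ x : M, chartVolume d x

end Riemannian

/-! ### Voronoi cells and the Delaunay graph -/

section Voronoi

variable {M : Type*} [MetricSpace M]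

/-- The Voronoi cell of `x` with respect to the nuclei `S`: the points `y` for which `dist x y` is
the minimum of `dist s y` over `s ∈ S`. -/
def voronoiCell (S : Set M) (x : M) : Set M :=
  {y | IsLeast ((fun s => dist s y) '' S) (dist x y)}

/-- The Delaunay graph with nuclei `S`: two distinct points of `S` are adjacent if they lie on the
boundary sphere of an open ball that contains no point of `S`. (Points outside `S` are
isolated.) -/
def delaunayGraph (S : Set M) : SimpleGraph M where
  Adj x y := x ≠ y ∧ x ∈ S ∧ y ∈ S ∧
    ∃ (z : M) (r : ℝ), x ∈ Metric.sphere z r ∧ y ∈ Metric.sphere z r ∧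
      Disjoint (Metric.ball z r) S
  symm := ⟨fun _ _ ⟨h, hx, hy, z, r, hzx, hzy, hd⟩ => ⟨h.symm, hy, hx, z, r, hzy, hzx, hd⟩⟩
  loopless := ⟨fun _ h => h.1 rfl⟩

/-- The degree (possibly infinite) of `x` in the Delaunay graph with nuclei `S`. -/
def delaunayDegree (S : Set M) (x : M) : ℕ∞ :=
  ((delaunayGraph S).neighborSet x).encard

end Voronoi

/-! ### Point processes -/

/-- Locally finite point configurations: the sets of points that have finite intersection with
each compact set. -/
def Config (M : Type*) [TopologicalSpace M] : Type _ :=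
  {S : Set M // ∀ K : Set M, IsCompact K → (S ∩ K).Finite}

namespace Config

section

variable {M : Type*} [TopologicalSpace M]

/-- The configurations carry the σ-algebra generated by the numbers of points in Borel sets. A
(simple) point process on `M` is a probability measure on `Config M`. -/
instance [MeasurableSpace M] : MeasurableSpace (Config M) :=
  ⨆ (B : Set M) (_ : MeasurableSet B),
    MeasurableSpace.comap (fun Ξ : Config M => (Ξ.1 ∩ B).encard) ⊤

/-- The image of a configuration under a homeomorphism. -/
def map (g : M ≃ₜ M) (Ξ : Config M) : Config M :=
  ⟨g '' Ξ.1, fun K hK => by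
    have h := (Ξ.2 (g ⁻¹' K) (g.isCompact_preimage.2 hK)).image g
    rwa [image_inter_preimage] at h⟩

/-- The configuration with the point `o` added. -/
def addPoint (o : M) (Ξ : Config M) : Config M :=
  ⟨insert o Ξ.1, fun K hK => by
    refine ((Ξ.2 K hK).insert o).subset ?_
    rintro x ⟨rfl | hx, hxK⟩
    · exact mem_insert _ _
    · exact mem_insert_of_mem _ ⟨hx, hxK⟩⟩

/-- The configuration as the measure `∑ δ_x` over its points `x`. -/
def toMeasure [MeasurableSpace M] (Ξ : Config M) : Measure M :=
  Measure.sum fun x : Ξ.1 => Measure.dirac (x : M)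

theorem measurable_encard [MeasurableSpace M] {B : Set M} (hB : MeasurableSet B) :
    Measurable (fun Ξ : Config M => (Ξ.1 ∩ B).encard) := by
  intro s _
  exact le_iSup₂ (f := fun (B : Set M) (_ : MeasurableSet B) =>
    MeasurableSpace.comap (fun Ξ : Config M => (Ξ.1 ∩ B).encard) ⊤) B hB _ ⟨s, trivial, rfl⟩

theorem measurable_of_encard [MeasurableSpace M] {α : Type*} [MeasurableSpace α]
    {F : α → Config M}
    (h : ∀ B : Set M, MeasurableSet B → Measurable fun a => ((F a).1 ∩ B).encard) :
    Measurable F := by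
  refine measurable_iff_comap_le.2 ?_
  simp only [instMeasurableSpace, MeasurableSpace.comap_iSup, MeasurableSpace.comap_comp,
    iSup_le_iff]
  rintro B hB _ ⟨s, -, rfl⟩
  exact h B hB (MeasurableSet.of_discrete)

theorem measurable_map [MeasurableSpace M] [BorelSpace M] (g : M ≃ₜ M) :
    Measurable (map g) := by
  refine measurable_of_encard fun B hB => ?_
  have h : (fun Ξ : Config M => ((map g Ξ).1 ∩ B).encard)
      = fun Ξ : Config M => (Ξ.1 ∩ g ⁻¹' B).encard := by
    funext Ξ
    rw [← g.injective.encard_image (Ξ.1 ∩ g ⁻¹' B), image_inter_preimage]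
    rfl
  rw [h]
  exact measurable_encard (g.continuous.measurable hB)

theorem measurable_addPoint [MeasurableSpace M] [MeasurableSingletonClass M] (o : M) :
    Measurable (addPoint o) := by
  refine measurable_of_encard fun B hB => ?_
  by_cases ho : o ∈ B
  · have h : (fun Ξ : Config M => ((addPoint o Ξ).1 ∩ B).encard)
        = fun Ξ : Config M => (Ξ.1 ∩ (B \ {o})).encard + 1 := by
      funext Ξ
      have e : (addPoint o Ξ).1 ∩ B = insert o (Ξ.1 ∩ (B \ {o})) := by
        ext x
        by_cases hx : x = o
        · subst hx; simp [addPoint, ho]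
        · simp [addPoint, hx]
      rw [e, encard_insert_of_notMem (by simp)]
    rw [h]
    exact (measurable_encard (hB.diff (measurableSet_singleton o))).add_const 1
  · have h : (fun Ξ : Config M => ((addPoint o Ξ).1 ∩ B).encard)
        = fun Ξ : Config M => (Ξ.1 ∩ B).encard := by
      funext Ξ
      congr 1
      ext x
      by_cases hx : x = o
      · subst hx; simp [addPoint, ho]
      · simp [addPoint, hx]
    rw [h]
    exact measurable_encard hB

theorem measurable_toMeasure [MeasurableSpace M] :
    Measurable (toMeasure : Config M → Measure M) := by
  refine Measure.measurable_of_measurable_coe _ fun B hB => ?_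
  have h : (fun Ξ : Config M => toMeasure Ξ B)
      = fun Ξ : Config M => (((Ξ.1 ∩ B).encard : ℕ∞) : ℝ≥0∞) := by
    funext Ξ
    rw [toMeasure, Measure.sum_apply _ hB, ← ENNReal.tsum_set_one, tsum_subtype Ξ.1
      (fun x => Measure.dirac x B), tsum_subtype (Ξ.1 ∩ B) (fun _ => (1 : ℝ≥0∞))]
    refine tsum_congr fun x => ?_
    rw [← indicator_indicator]
    simp only [Measure.dirac_apply' _ hB]
    rfl
  rw [h]
  exact (Measurable.of_discrete (f := fun n : ℕ∞ => (n : ℝ≥0∞))).comp (measurable_encard hB)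

end

end Config

section PointProcess

variable {M : Type*} [TopologicalSpace M] [MeasurableSpace M]

/-- The intensity measure `Λ(A) = 𝔼 |A ∩ 𝒫|` of a point process. -/
def intensity (P : Measure (Config M)) : Measure M := P.bind Config.toMeasure

/-- `P` is a Poisson point process with intensity measure `μ`: the numbers of points in compact
sets are Poisson distributed with mean `μ A`, and they are independent for disjoint compact
sets. -/
structure IsPoissonProcess (μ : Measure M) (P : Measure (Config M)) : Prop where
  isProbabilityMeasure : IsProbabilityMeasure P
  map_ncard : ∀ A : Set M, IsCompact A →
    P.map (fun Ξ => (Ξ.1 ∩ A).ncard) = poissonMeasure (μ A).toNNReal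
  iIndepFun_ncard : ∀ (n : ℕ) (A : Fin n → Set M), (∀ i, IsCompact (A i)) →
    Pairwise (fun i j => Disjoint (A i) (A j)) →
      iIndepFun (fun (i : Fin n) (Ξ : Config M) => (Ξ.1 ∩ A i).ncard) P

variable (d : ℕ) [ChartedSpace (EuclideanSpace ℝ (Fin d)) M]
  [RiemannianBundle (fun x : M => TangentSpace (𝓡 d) x)]

/-- A stationary point process (of finite intensity) on a Riemannian manifold: its law is invariant
under all isometries, and the expected number of points in each compact set is finite. -/
structure IsStationaryProcess (P : Measure (Config M)) : Prop where
  isProbabilityMeasure : IsProbabilityMeasure P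
  map_eq : ∀ g : M ≃ₘ^∞⟮𝓡 d, 𝓡 d⟯ M, IsRiemannianIsometry d g →
    P.map (Config.map g.toHomeomorph) = P
  intensity_lt_top : ∀ K : Set M, IsCompact K → intensity P K < ⊤

/-- `Q` is the Palm process at `o` of the stationary point process `P`: it is the member at `o` of
a (measurable) family `x ↦ κ x` of point processes which satisfies the defining identity of Palm
processes
`𝔼[∫ f(x, Ξ) Ξ(dx)] = ∫ 𝔼[f(x, Ξ_x)] Λ(dx)` and in which isometries that map `x` to `y` map the
process at `x` to the process at `y`. The intensity of `P` must not vanish, as otherwise the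
identity says nothing. -/
def IsPalmProcess (P : Measure (Config M)) (o : M) (Q : Measure (Config M)) : Prop :=
  intensity P ≠ 0 ∧
  ∃ κ : Kernel M (Config M), IsMarkovKernel κ ∧
    (∀ f : M × Config M → ℝ≥0∞, Measurable f →
      ∫⁻ Ξ, ∫⁻ x, f (x, Ξ) ∂Ξ.toMeasure ∂P = ∫⁻ x, ∫⁻ Ξ, f (x, Ξ) ∂(κ x) ∂(intensity P)) ∧
    (∀ g : M ≃ₘ^∞⟮𝓡 d, 𝓡 d⟯ M, IsRiemannianIsometry d g →
      ∀ x : M, (κ x).map (Config.map g.toHomeomorph) = κ (g x)) ∧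
    κ o = Q

end PointProcess

/-- The random variable `X ≥ 0` has a finite moment of order `k`. Measurability is part of the
claim. -/
def HasFiniteMoment {Ω : Type*} [MeasurableSpace Ω] (Q : Measure Ω) (X : Ω → ℝ≥0∞) (k : ℝ) :
    Prop :=
  AEMeasurable X Q ∧ ∫⁻ a, X a ^ k ∂Q < ⊤

section Lattice

variable (d : ℕ) {M : Type*} [MetricSpace M] [ChartedSpace (EuclideanSpace ℝ (Fin d)) M]
  [RiemannianBundle (fun x : M => TangentSpace (𝓡 d) x)] [MeasurableSpace M]

/-- The Riemannian volume of the Voronoi cell of `o`. -/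
def cellVolume (o : M) (Ξ : Config M) : ℝ≥0∞ := riemannianVolume d M (voronoiCell Ξ.1 o)

/-- A distributional lattice: the Palm process at `o` of a stationary point process, for which the
volume of the Voronoi cell of `o` and the Delaunay degree of `o` have finite expectation. -/
def IsDistributionalLattice (o : M) (Q : Measure (Config M)) : Prop :=
  (∃ P : Measure (Config M), IsStationaryProcess d P ∧ IsPalmProcess d P o Q) ∧
    HasFiniteMoment Q (cellVolume d o) 1 ∧
    HasFiniteMoment Q (fun Ξ => (delaunayDegree Ξ.1 o : ℝ≥0∞)) 1

end Lattice

end PoissonVoronoi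

end

/-!
The Voronoi cell of `o` contains a point at distance at least `R` from `o` only if a ball of radius
nearly `R`, with centre near the sphere of radius `R` around `o`, contains no point of the process.
Let `V R` be the volume of a ball of radius `R`. The number of centres that have to be considered, a
net of the ball of radius `R`, is at most a constant times `V R`, and each of these balls is empty
with probability at most `exp (- V (R - 2))`. If the cell lies in the ball of radius `R`, then the
volume of the cell and the number of Delaunay neighbours are at most the volume and the number of
points in the ball of radius `2 R`. The moments of these are bounded by powers of `V (2 R)`, so all
that is needed is that `V (2 R)` is bounded by a power of `V R`, that `V (R - 2)` is at least a
constant times `V R`, and that `V R` grows at least linearly. This is true in every connected length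
space in which balls of equal radius have equal volume, because a covering argument shows that `V`
is submultiplicative up to constants (`HasHomogeneousBalls.exists_growth_const`). If the space is
bounded, the cell lies in a fixed ball and there is nothing to sum. These estimates are combined in
`IsPoissonProcess.lintegral_pow_lt_top`.

Symmetric spaces are homogeneous, but here it suffices that the orbits of the isometry group are
dense (`exists_isometry_dist_lt`), and this needs neither completeness nor geodesics. In the
coordinates of a chart, the second derivatives of the symmetries are bounded, since differentiation
of the isometry equation determines them in terms of the first derivatives of the metric, by
Koszul's trick (`norm_fderiv_fderiv_le`). So the symmetry at a point with coordinates `m` is the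
reflection `u ↦ 2 m - u` up to an error that is quadratic in `u - m`, uniformly in `m`. The
symmetry at the midpoint of `u` and `v` thus maps `u` much closer to `v` if `u` and `v` are close,
and an iteration shows that orbits come arbitrarily close to all nearby points.

The law of a point process is determined by the probabilities that compact sets are empty
(`Config.measure_ext_of_voidEvent`). As isometries preserve the Riemannian volume
(`riemannianVolume_image`, the change of variables formula in charts), the Poisson process is
stationary. Mecke's formula (`IsPoissonProcess.lintegral_lintegral_toMeasure`) says that adding the
point `x` to the process gives the Palm process at `x`.
-/

namespace PoissonVoronoi

/-! ### The Riemannian metric in charts -/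

section Chart

variable {d : ℕ} {M : Type*} [TopologicalSpace M] [ChartedSpace (EuclideanSpace ℝ (Fin d)) M]
  [RiemannianBundle (fun x : M => TangentSpace (𝓡 d) x)]

/-- The Riemannian metric in the chart at `x`: the inner product, at the point with coordinates
`u`, of the tangent vectors with coordinates `v` and `w`. -/
noncomputable def metricForm (x : M) (u v w : EuclideanSpace ℝ (Fin d)) : ℝ :=
  inner ℝ
    (mfderiv (𝓡 d) (𝓡 d) (chartAt (EuclideanSpace ℝ (Fin d)) x).symm u v)
    (mfderiv (𝓡 d) (𝓡 d) (chartAt (EuclideanSpace ℝ (Fin d)) x).symm u w)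

/-- The inner product of the tangent space at `p`, as a function on the model space. -/
noncomputable def tangentInner (p : M) (v w : EuclideanSpace ℝ (Fin d)) : ℝ :=
  inner (E := TangentSpace (𝓡 d) p) ℝ v w

theorem metricMatrix_apply (x : M) (u : EuclideanSpace ℝ (Fin d)) (i j : Fin d) :
    metricMatrix d x u i j
      = metricForm x u (EuclideanSpace.single i 1) (EuclideanSpace.single j 1) := rfl

theorem metricForm_comm (x : M) (u v w : EuclideanSpace ℝ (Fin d)) :
    metricForm x u v w = metricForm x u w v := real_inner_comm _ _

theorem metricForm_add_left (x : M) (u v v' w : EuclideanSpace ℝ (Fin d)) :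
    metricForm x u (v + v') w = metricForm x u v w + metricForm x u v' w := by
  unfold metricForm
  rw [← inner_add_left]
  congr 1
  exact map_add _ _ _

theorem metricForm_smul_left (x : M) (u v w : EuclideanSpace ℝ (Fin d)) (c : ℝ) :
    metricForm x u (c • v) w = c * metricForm x u v w := by
  unfold metricForm
  rw [← real_inner_smul_left]
  congr 1
  exact map_smul _ _ _

variable [IsManifold (𝓡 d) ∞ M]

theorem metricForm_self_pos (x : M) {u v : EuclideanSpace ℝ (Fin d)}
    (hu : u ∈ (chartAt (EuclideanSpace ℝ (Fin d)) x).target) (hv : v ≠ 0) :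
    0 < metricForm x u v v := by
  unfold metricForm
  refine real_inner_self_pos.2 fun h => hv ?_
  have hinj : Function.Injective
      (mfderiv (𝓡 d) (𝓡 d) (chartAt (EuclideanSpace ℝ (Fin d)) x).symm u) :=
    (mdifferentiable_chart (I := 𝓡 d) x).symm.mfderiv_injective hu
  exact hinj (h.trans (map_zero _).symm)

theorem contDiffOn_metricForm [IsContMDiffRiemannianBundle (𝓡 d) ∞ (EuclideanSpace ℝ (Fin d))
      (fun x : M => TangentSpace (𝓡 d) x)] (x : M) (v w : EuclideanSpace ℝ (Fin d)) :
    ContDiffOn ℝ ∞ (fun u => metricForm x u v w)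
      (chartAt (EuclideanSpace ℝ (Fin d)) x).target := by
  have key : ∀ v : EuclideanSpace ℝ (Fin d), ContMDiffOn (𝓡 d) ((𝓡 d).tangent) ∞
      (fun u => (TotalSpace.mk' (EuclideanSpace ℝ (Fin d))
        ((chartAt (EuclideanSpace ℝ (Fin d)) x).symm u)
        (mfderiv (𝓡 d) (𝓡 d) (chartAt (EuclideanSpace ℝ (Fin d)) x).symm u v) :
          TangentBundle (𝓡 d) M))
      (chartAt (EuclideanSpace ℝ (Fin d)) x).target := by
    intro v
    have h := (contMDiffOn_chart_symm (I := 𝓡 d) (n := ∞) (x := x)).contMDiffOn_tangentMapWithin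
      (m := ∞) (by simp) (chartAt (EuclideanSpace ℝ (Fin d)) x).open_target.uniqueMDiffOn
    have h2 : ContMDiffOn (𝓡 d) ((𝓡 d).tangent) ∞
        (fun u : EuclideanSpace ℝ (Fin d) => (TotalSpace.mk' (EuclideanSpace ℝ (Fin d)) u v :
          TangentBundle (𝓡 d) (EuclideanSpace ℝ (Fin d))))
        (chartAt (EuclideanSpace ℝ (Fin d)) x).target := by
      have := contMDiffOn_vectorSpace_iff_contDiffOn (n := ∞)
        (s := (chartAt (EuclideanSpace ℝ (Fin d)) x).target)
        (𝕜 := ℝ) (V := fun _ : EuclideanSpace ℝ (Fin d) => v)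
      exact this.2 contDiffOn_const
    refine (h.comp h2 fun u hu => hu).congr fun u hu => ?_
    simp only [Function.comp_apply, tangentMapWithin]
    rw [mfderivWithin_of_isOpen (chartAt (EuclideanSpace ℝ (Fin d)) x).open_target hu]
  rw [← contMDiffOn_iff_contDiffOn]
  exact ContMDiffOn.inner_bundle (key v) (key w)

/-- In charts, a Riemannian isometry pulls the metric back to the metric. -/
theorem metricForm_isometry {g : M ≃ₘ^∞⟮𝓡 d, 𝓡 d⟯ M} (hg : IsRiemannianIsometry d g) (x y : M)
    {u : EuclideanSpace ℝ (Fin d)} (hu : u ∈ (chartAt (EuclideanSpace ℝ (Fin d)) x).target)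
    (hgu : g ((chartAt (EuclideanSpace ℝ (Fin d)) x).symm u)
      ∈ (chartAt (EuclideanSpace ℝ (Fin d)) y).source) (v w : EuclideanSpace ℝ (Fin d)) :
    let f := fun u => chartAt (EuclideanSpace ℝ (Fin d)) y
      (g ((chartAt (EuclideanSpace ℝ (Fin d)) x).symm u))
    metricForm y (f u) (fderiv ℝ f u v) (fderiv ℝ f u w) = metricForm x u v w := by
  intro f
  set φ := chartAt (EuclideanSpace ℝ (Fin d)) x
  set ψ := chartAt (EuclideanSpace ℝ (Fin d)) y
  have hφ : MDifferentiableAt (𝓡 d) (𝓡 d) φ.symm u :=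
    (mdifferentiable_chart (I := 𝓡 d) x).mdifferentiableAt_symm hu
  have hg' : MDifferentiableAt (𝓡 d) (𝓡 d) g (φ.symm u) :=
    g.contMDiff.mdifferentiableAt (by simp)
  have hf : MDifferentiableAt (𝓡 d) (𝓡 d) f u :=
    ((mdifferentiable_chart (I := 𝓡 d) y).mdifferentiableAt hgu).comp u (hg'.comp u hφ)
  have hψ : MDifferentiableAt (𝓡 d) (𝓡 d) ψ.symm (f u) :=
    (mdifferentiable_chart (I := 𝓡 d) y).mdifferentiableAt_symm (ψ.map_source hgu)
  have hev : ψ.symm ∘ f =ᶠ[nhds u] g ∘ φ.symm := by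
    have hc : ContinuousAt (fun u => g (φ.symm u)) u := (hg'.comp u hφ).continuousAt
    filter_upwards [hc.preimage_mem_nhds (ψ.open_source.mem_nhds hgu)] with u' hu'
    exact ψ.left_inv hu'
  have hder : ∀ v : EuclideanSpace ℝ (Fin d),
      (mfderiv (𝓡 d) (𝓡 d) ψ.symm (f u) (fderiv ℝ f u v) : EuclideanSpace ℝ (Fin d))
        = mfderiv (𝓡 d) (𝓡 d) g (φ.symm u) (mfderiv (𝓡 d) (𝓡 d) φ.symm u v) := by
    intro v
    have e1 := mfderiv_comp u hψ hf
    have e2 := mfderiv_comp u hg' hφ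
    have e3 := hev.mfderiv_eq (I := 𝓡 d) (I' := 𝓡 d)
    rw [← mfderiv_eq_fderiv]
    exact (congrArg (fun L => L v) e1).symm.trans
      ((congrArg (fun L => L v) e3).trans (congrArg (fun L => L v) e2))
  have h1 : metricForm y (f u) (fderiv ℝ f u v) (fderiv ℝ f u w)
      = tangentInner (ψ.symm (f u))
        (mfderiv (𝓡 d) (𝓡 d) ψ.symm (f u) (fderiv ℝ f u v))
        (mfderiv (𝓡 d) (𝓡 d) ψ.symm (f u) (fderiv ℝ f u w)) := rfl
  rw [h1, hder, hder, show ψ.symm (f u) = g (φ.symm u) from ψ.left_inv hgu]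
  exact hg _ _ _
end Chart

/-! ### The Riemannian volume in charts -/

section Volume

variable {d : ℕ} {M : Type*} [TopologicalSpace M] [ChartedSpace (EuclideanSpace ℝ (Fin d)) M]
  [RiemannianBundle (fun x : M => TangentSpace (𝓡 d) x)]

/-- The density of the Riemannian volume in the chart at `x`. -/
noncomputable def chartDensity (x : M) (u : EuclideanSpace ℝ (Fin d)) : ℝ≥0∞ :=
  ENNReal.ofReal (Real.sqrt (metricMatrix d x u).det)

theorem chartVolume_apply [MeasurableSpace M] [BorelSpace M] (x : M) {A : Set M}
    (hA : MeasurableSet A) :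
    chartVolume d x A
      = ∫⁻ u in (chartAt (EuclideanSpace ℝ (Fin d)) x).symm ⁻¹' A ∩
          (chartAt (EuclideanSpace ℝ (Fin d)) x).target, chartDensity x u := by
  set φ := chartAt (EuclideanSpace ℝ (Fin d)) x
  have hm : AEMeasurable φ.symm (volume.restrict φ.target) :=
    φ.continuousOn_symm.aemeasurable φ.open_target.measurableSet
  rw [chartVolume, Measure.map_apply_of_aemeasurable
    (hm.mono_ac (withDensity_absolutelyContinuous _ _)) hA, withDensity_apply',
    Measure.restrict_restrict' φ.open_target.measurableSet]
  rfl

theorem chartVolume_inter_source [MeasurableSpace M] [BorelSpace M] (x : M) {A : Set M}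
    (hA : MeasurableSet A) :
    chartVolume d x (A ∩ (chartAt (EuclideanSpace ℝ (Fin d)) x).source) = chartVolume d x A := by
  set φ := chartAt (EuclideanSpace ℝ (Fin d)) x with hφ
  rw [chartVolume_apply x (hA.inter φ.open_source.measurableSet), chartVolume_apply x hA]
  congr 2
  ext u
  simp only [mem_inter_iff, mem_preimage, ← hφ]
  exact ⟨fun h => ⟨h.1.1, h.2⟩, fun h => ⟨⟨h.1, φ.map_target h.2⟩, h.2⟩⟩

theorem metricForm_eq_sum (x : M) (u v w : EuclideanSpace ℝ (Fin d)) :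
    metricForm x u v w = ∑ i, ∑ j, v i * metricMatrix d x u i j * w j := by
  have hadd : ∀ (w : EuclideanSpace ℝ (Fin d)) (s : Finset (Fin d))
      (V : Fin d → EuclideanSpace ℝ (Fin d)),
      metricForm x u (∑ i ∈ s, V i) w = ∑ i ∈ s, metricForm x u (V i) w := by
    intro w s V
    classical
    induction s using Finset.induction_on with
    | empty => simpa using metricForm_smul_left x u 0 w 0
    | insert a s ha ih => rw [Finset.sum_insert ha, Finset.sum_insert ha, metricForm_add_left, ih]
  have hb : ∀ v : EuclideanSpace ℝ (Fin d),
      v = ∑ i, v i • EuclideanSpace.single i (1 : ℝ) := by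
    intro v
    simpa using ((EuclideanSpace.basisFun (Fin d) ℝ).sum_repr v).symm
  conv_lhs => rw [hb v, hadd]
  refine Finset.sum_congr rfl fun i _ => ?_
  rw [metricForm_smul_left, metricForm_comm]
  conv_lhs => rw [hb w, hadd]
  rw [Finset.mul_sum]
  refine Finset.sum_congr rfl fun j _ => ?_
  rw [metricForm_smul_left, metricForm_comm, metricMatrix_apply]
  ring

variable [IsManifold (𝓡 d) ∞ M]

/-- The determinant of the identity `g_x = Jᵀ g_y J` between Gram matrices, where `J` is the
Jacobian matrix of the isometry in coordinates. -/
theorem chartDensity_isometry {g : M ≃ₘ^∞⟮𝓡 d, 𝓡 d⟯ M} (hg : IsRiemannianIsometry d g) (x y : M)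
    {u : EuclideanSpace ℝ (Fin d)} (hu : u ∈ (chartAt (EuclideanSpace ℝ (Fin d)) x).target)
    (hgu : g ((chartAt (EuclideanSpace ℝ (Fin d)) x).symm u)
      ∈ (chartAt (EuclideanSpace ℝ (Fin d)) y).source) :
    let f := fun u => chartAt (EuclideanSpace ℝ (Fin d)) y
      (g ((chartAt (EuclideanSpace ℝ (Fin d)) x).symm u))
    chartDensity x u = ENNReal.ofReal |(fderiv ℝ f u).det| * chartDensity y (f u) := by
  intro f
  let b := (EuclideanSpace.basisFun (Fin d) ℝ).toBasis
  let J := LinearMap.toMatrix b b (fderiv ℝ f u : EuclideanSpace ℝ (Fin d) →ₗ[ℝ] _)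
  have hJ : ∀ i j, J i j = (fderiv ℝ f u (EuclideanSpace.single j 1)) i := by
    intro i j
    simp [J, b, LinearMap.toMatrix_apply]
  have hmat : metricMatrix d x u = J.transpose * metricMatrix d y (f u) * J := by
    ext i j
    rw [metricMatrix_apply, ← metricForm_isometry hg x y hu hgu, metricForm_eq_sum]
    simp only [Matrix.mul_apply, Matrix.transpose_apply, hJ, Finset.sum_mul]
    rw [Finset.sum_comm]
  have hdet : J.det = (fderiv ℝ f u).det := LinearMap.det_toMatrix b _
  rw [chartDensity, chartDensity, hmat, Matrix.det_mul, Matrix.det_mul, Matrix.det_transpose, hdet,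
    ← ENNReal.ofReal_mul (abs_nonneg _), ← Real.sqrt_sq_eq_abs, ← Real.sqrt_mul (sq_nonneg _)]
  congr 2
  ring

/-- The change of variables formula: a Riemannian isometry maps the volume in one chart to the
volume in another. -/
theorem chartVolume_isometry [MeasurableSpace M] [BorelSpace M]
    {g : M ≃ₘ^∞⟮𝓡 d, 𝓡 d⟯ M} (hg : IsRiemannianIsometry d g) (x y : M) {A : Set M}
    (hA : MeasurableSet A) (hx : A ⊆ (chartAt (EuclideanSpace ℝ (Fin d)) x).source)
    (hy : A ⊆ g ⁻¹' (chartAt (EuclideanSpace ℝ (Fin d)) y).source) :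
    chartVolume d x A = chartVolume d y (g '' A) := by
  have hgA : MeasurableSet (g '' A) := by
    have := g.toHomeomorph.measurableEmbedding.measurableSet_image.2 hA
    exact this
  rw [chartVolume_apply x hA, chartVolume_apply y hgA]
  set φ := chartAt (EuclideanSpace ℝ (Fin d)) x with hφ
  set ψ := chartAt (EuclideanSpace ℝ (Fin d)) y with hψ
  let f := fun u => ψ (g (φ.symm u))
  have hBm : MeasurableSet (φ.symm ⁻¹' A ∩ φ.target) := by
    have h : φ.symm ⁻¹' A ∩ φ.target
        = Subtype.val '' ((φ.target.domRestrict φ.symm) ⁻¹' A) := by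
      rw [domRestrict_eq, preimage_comp, Subtype.image_preimage_coe, inter_comm]
    rw [h]
    exact φ.open_target.measurableSet.subtype_image
      ((continuousOn_iff_continuous_domRestrict.1 φ.continuousOn_symm).measurable hA)
  have himg : ψ.symm ⁻¹' (g '' A) ∩ ψ.target = f '' (φ.symm ⁻¹' A ∩ φ.target) := by
    ext w
    constructor
    · rintro ⟨⟨a, ha, hga⟩, hw⟩
      refine ⟨φ a, ⟨?_, φ.map_source (hx ha)⟩, ?_⟩
      · simpa [φ.left_inv (hx ha)] using ha
      · simp only [f, φ.left_inv (hx ha), hga, ψ.right_inv hw]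
    · rintro ⟨u, ⟨hu, hut⟩, rfl⟩
      refine ⟨⟨φ.symm u, hu, ?_⟩, ψ.map_source (hy hu)⟩
      exact (ψ.left_inv (hy hu)).symm
  have hinj : InjOn f (φ.symm ⁻¹' A ∩ φ.target) := by
    rintro u ⟨hu, hut⟩ u' ⟨hu', hut'⟩ h
    exact φ.symm.injOn hut hut' (g.injective (ψ.injOn (hy hu) (hy hu') h))
  have hder : ∀ u ∈ φ.symm ⁻¹' A ∩ φ.target,
      HasFDerivWithinAt f (fderiv ℝ f u) (φ.symm ⁻¹' A ∩ φ.target) u := by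
    rintro u ⟨hu, hut⟩
    have hd : MDifferentiableAt (𝓡 d) (𝓡 d) f u :=
      ((mdifferentiable_chart (I := 𝓡 d) y).mdifferentiableAt (hy hu)).comp u
        ((g.contMDiff.mdifferentiableAt (by simp)).comp u
          ((mdifferentiable_chart (I := 𝓡 d) x).mdifferentiableAt_symm hut))
    exact hd.differentiableAt.hasFDerivAt.hasFDerivWithinAt
  rw [himg, lintegral_image_eq_lintegral_abs_det_fderiv_mul volume hBm hder hinj]
  refine setLIntegral_congr_fun hBm fun u hu => ?_
  exact chartDensity_isometry hg x y hu.2 (hy hu.1)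

end Volume

/-! ### The Riemannian volume: invariance, positivity and local finiteness -/

/-- A measure is the sum of its parts on a countable measurable partition. -/
theorem measure_eq_tsum_inter {α : Type*} [MeasurableSpace α] {μ : Measure α} {B : ℕ → Set α}
    (hB : ∀ n, MeasurableSet (B n)) (hd : Pairwise (fun i j => Disjoint (B i) (B j)))
    (hu : ⋃ n, B n = univ) {A : Set α} (hA : MeasurableSet A) : μ A = ∑' n, μ (A ∩ B n) := by
  rw [← measure_iUnion (fun i j h => (hd h).mono inter_subset_right inter_subset_right)
    (fun n => hA.inter (hB n)), ← inter_iUnion, hu, inter_univ]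

section GluedVolume

variable {d : ℕ} {M : Type*} [TopologicalSpace M] [ChartedSpace (EuclideanSpace ℝ (Fin d)) M]
  [RiemannianBundle (fun x : M => TangentSpace (𝓡 d) x)]

theorem isRiemannianIsometry_refl :
    IsRiemannianIsometry d (Diffeomorph.refl (𝓡 d) M ∞) := by
  intro x v w
  have h : mfderiv (𝓡 d) (𝓡 d) (Diffeomorph.refl (𝓡 d) M ∞) x
      = ContinuousLinearMap.id ℝ (TangentSpace (𝓡 d) x) := mfderiv_id
  rw [h]
  rfl

theorem IsRiemannianIsometry.symm {g : M ≃ₘ^∞⟮𝓡 d, 𝓡 d⟯ M} (hg : IsRiemannianIsometry d g) :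
    IsRiemannianIsometry d g.symm := by
  intro x v w
  have h := hg (g.symm x) (mfderiv (𝓡 d) (𝓡 d) g.symm x v) (mfderiv (𝓡 d) (𝓡 d) g.symm x w)
  -- the tangent spaces at `g (g.symm x)` and `x` are the same copy of the model space
  have hc : ∀ v : EuclideanSpace ℝ (Fin d),
      (mfderiv (𝓡 d) (𝓡 d) g (g.symm x) (mfderiv (𝓡 d) (𝓡 d) g.symm x v) :
        EuclideanSpace ℝ (Fin d)) = v := by
    intro v
    have e1 := mfderiv_comp x (g.contMDiff.mdifferentiableAt (by simp) :
      MDifferentiableAt (𝓡 d) (𝓡 d) g (g.symm x))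
      (g.symm.contMDiff.mdifferentiableAt (by simp))
    have e2 : g ∘ g.symm = id := by ext y; simp
    have e3 : mfderiv (𝓡 d) (𝓡 d) (g ∘ g.symm) x v = v := by
      rw [e2, mfderiv_id]; rfl
    rw [e1] at e3
    exact e3
  have h' : tangentInner (g (g.symm x))
      (mfderiv (𝓡 d) (𝓡 d) g (g.symm x) (mfderiv (𝓡 d) (𝓡 d) g.symm x v))
      (mfderiv (𝓡 d) (𝓡 d) g (g.symm x) (mfderiv (𝓡 d) (𝓡 d) g.symm x w))
      = inner ℝ (mfderiv (𝓡 d) (𝓡 d) g.symm x v) (mfderiv (𝓡 d) (𝓡 d) g.symm x w) := h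
  refine h'.symm.trans ((congrArg₂ (tangentInner _) (hc v) (hc w)).trans ?_)
  exact congrArg (fun p => tangentInner p v w) (g.apply_symm_apply x)

variable (M) in
/-- Countably many charts cover the manifold; their domains can be cut down to a measurable
partition. -/
theorem exists_chart_partition (d : ℕ) [Nonempty M] [ChartedSpace (EuclideanSpace ℝ (Fin d)) M]
    [SecondCountableTopology M] [MeasurableSpace M] [BorelSpace M] :
    ∃ (e : ℕ → M) (B : ℕ → Set M), (∀ n, MeasurableSet (B n)) ∧
      (∀ n, B n ⊆ (chartAt (EuclideanSpace ℝ (Fin d)) (e n)).source) ∧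
      Pairwise (fun i j => Disjoint (B i) (B j)) ∧ ⋃ n, B n = univ := by
  obtain ⟨s, hs, hcov⟩ := TopologicalSpace.countable_cover_nhds
    (f := fun x : M => (chartAt (EuclideanSpace ℝ (Fin d)) x).source)
    (fun x => chart_source_mem_nhds _ x)
  have hne : s.Nonempty := by
    by_contra h
    rw [not_nonempty_iff_eq_empty] at h
    subst h
    simp at hcov
    exact empty_ne_univ hcov
  obtain ⟨e, rfl⟩ := hs.exists_eq_range hne
  refine ⟨e, disjointed fun n => (chartAt (EuclideanSpace ℝ (Fin d)) (e n)).source,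
    MeasurableSet.disjointed fun n => (chartAt _ (e n)).open_source.measurableSet,
    fun n => disjointed_le _ n, disjoint_disjointed _, ?_⟩
  rw [iUnion_disjointed, ← hcov, biUnion_range]

variable [IsManifold (𝓡 d) ∞ M] [SecondCountableTopology M] [MeasurableSpace M] [BorelSpace M]

omit [SecondCountableTopology M] in
theorem chartVolume_congr (x y : M) {A : Set M} (hA : MeasurableSet A)
    (hx : A ⊆ (chartAt (EuclideanSpace ℝ (Fin d)) x).source)
    (hy : A ⊆ (chartAt (EuclideanSpace ℝ (Fin d)) y).source) :
    chartVolume d x A = chartVolume d y A := by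
  simpa using chartVolume_isometry isRiemannianIsometry_refl x y hA hx hy

omit [IsManifold (𝓡 d) ∞ M] [SecondCountableTopology M] [BorelSpace M] in
theorem chartVolume_le_riemannianVolume (x : M) :
    chartVolume d x ≤ riemannianVolume d M := le_iSup (fun x : M => chartVolume d x) x

/-- On the domain of a chart the Riemannian volume is the volume of that chart. -/
theorem riemannianVolume_eq_chartVolume (x : M) {A : Set M} (hA : MeasurableSet A)
    (hx : A ⊆ (chartAt (EuclideanSpace ℝ (Fin d)) x).source) :
    riemannianVolume d M A = chartVolume d x A := by
  refine le_antisymm ?_ (chartVolume_le_riemannianVolume x A)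
  have : Nonempty M := ⟨x⟩
  obtain ⟨e, B, hBm, hBs, hBd, hBu⟩ := exists_chart_partition M d
  -- `ν` is the volume glued along the partition; it dominates every chart volume
  let ν : Measure M := Measure.sum fun n => (chartVolume d (e n)).restrict (B n)
  have hν : ∀ {C : Set M}, MeasurableSet C → ν C = ∑' n, chartVolume d (e n) (C ∩ B n) := by
    intro C hC
    rw [Measure.sum_apply _ hC]
    simp only [Measure.restrict_apply hC]
  have hle : riemannianVolume d M ≤ ν := by
    refine iSup_le fun y => Measure.le_intro fun C hC _ => ?_
    have hS := (chartAt (EuclideanSpace ℝ (Fin d)) y).open_source.measurableSet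
    rw [← chartVolume_inter_source y hC, measure_eq_tsum_inter hBm hBd hBu (hC.inter hS), hν hC]
    refine ENNReal.tsum_le_tsum fun n => ?_
    rw [chartVolume_congr y (e n) ((hC.inter hS).inter (hBm n))
      (inter_subset_left.trans inter_subset_right) (inter_subset_right.trans (hBs n))]
    exact measure_mono (inter_subset_inter_left _ inter_subset_left)
  refine (hle A).trans ?_
  rw [hν hA, measure_eq_tsum_inter hBm hBd hBu hA]
  refine ENNReal.tsum_le_tsum fun n => ?_
  rw [chartVolume_congr x (e n) (hA.inter (hBm n)) (inter_subset_left.trans hx)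
    (inter_subset_right.trans (hBs n))]

theorem riemannianVolume_le_image {g : M ≃ₘ^∞⟮𝓡 d, 𝓡 d⟯ M} (hg : IsRiemannianIsometry d g)
    {A : Set M} (hA : MeasurableSet A) :
    riemannianVolume d M A ≤ riemannianVolume d M (g '' A) := by
  rcases isEmpty_or_nonempty M with hM | hM
  · rw [Set.eq_empty_of_isEmpty A]; simp
  obtain ⟨e, B, hBm, hBs, hBd, hBu⟩ := exists_chart_partition M d
  have him : ∀ {C : Set M}, MeasurableSet C → MeasurableSet (g '' C) := fun hC =>
    g.toHomeomorph.measurableEmbedding.measurableSet_image.2 hC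
  -- the volume is a least upper bound, so each chart volume is compared with the image measure
  have hle : riemannianVolume d M ≤ (riemannianVolume d M).map g.symm := by
    refine iSup_le fun x => Measure.le_intro fun C hC _ => ?_
    have hgC : g.symm ⁻¹' C = g '' C := (g.toEquiv.image_eq_preimage_symm C).symm
    rw [Measure.map_apply g.symm.continuous.measurable hC, hgC]
    have hS := (chartAt (EuclideanSpace ℝ (Fin d)) x).open_source.measurableSet
    rw [← chartVolume_inter_source x hC]
    refine le_trans ?_ (measure_mono (image_mono (inter_subset_left :
      C ∩ (chartAt (EuclideanSpace ℝ (Fin d)) x).source ⊆ C)))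
    set C' := C ∩ (chartAt (EuclideanSpace ℝ (Fin d)) x).source
    have hC' : MeasurableSet C' := hC.inter hS
    have hgB : ∀ n, MeasurableSet (g ⁻¹' B n) := fun n => g.continuous.measurable (hBm n)
    rw [measure_eq_tsum_inter hBm hBd hBu (him hC'),
      measure_eq_tsum_inter hgB (fun i j h => (hBd h).preimage g)
        (by rw [← preimage_iUnion, hBu, preimage_univ]) hC']
    refine ENNReal.tsum_le_tsum fun n => ?_
    rw [chartVolume_isometry hg x (e n) (hC'.inter (hgB n))
      (inter_subset_left.trans inter_subset_right)
      (inter_subset_right.trans (preimage_mono (hBs n))), image_inter_preimage]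
    exact chartVolume_le_riemannianVolume _ _
  refine (hle A).trans_eq ?_
  rw [Measure.map_apply g.symm.continuous.measurable hA]
  exact congrArg _ (g.toEquiv.image_eq_preimage_symm A).symm

/-- Isometries preserve the Riemannian volume. -/
theorem riemannianVolume_image {g : M ≃ₘ^∞⟮𝓡 d, 𝓡 d⟯ M} (hg : IsRiemannianIsometry d g)
    {A : Set M} (hA : MeasurableSet A) :
    riemannianVolume d M (g '' A) = riemannianVolume d M A := by
  refine le_antisymm ?_ (riemannianVolume_le_image hg hA)
  have h := riemannianVolume_le_image hg.symm (A := g '' A)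
    (g.toHomeomorph.measurableEmbedding.measurableSet_image.2 hA)
  rwa [← image_comp, show (g.symm ∘ g : M → M) = id by ext; simp, image_id] at h

variable [IsContMDiffRiemannianBundle (𝓡 d) ∞ (EuclideanSpace ℝ (Fin d))
      (fun x : M => TangentSpace (𝓡 d) x)]

omit [SecondCountableTopology M] [MeasurableSpace M] [BorelSpace M] in
theorem continuousOn_chartDensity (x : M) :
    ContinuousOn (chartDensity x) (chartAt (EuclideanSpace ℝ (Fin d)) x).target := by
  refine ENNReal.continuous_ofReal.comp_continuousOn
    (Real.continuous_sqrt.comp_continuousOn ?_)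
  have h : ∀ i j, ContinuousOn (fun u => metricMatrix d x u i j)
      (chartAt (EuclideanSpace ℝ (Fin d)) x).target := fun i j =>
    (contDiffOn_metricForm x (EuclideanSpace.single i 1) (EuclideanSpace.single j 1)).continuousOn
  have hm : ContinuousOn (fun u => metricMatrix d x u)
      (chartAt (EuclideanSpace ℝ (Fin d)) x).target :=
    continuousOn_pi.2 fun i => continuousOn_pi.2 fun j => h i j
  exact (continuous_id.matrix_det).comp_continuousOn hm

omit [SecondCountableTopology M] [MeasurableSpace M] [BorelSpace M]
  [IsContMDiffRiemannianBundle (𝓡 d) ∞ (EuclideanSpace ℝ (Fin d))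
    (fun x : M => TangentSpace (𝓡 d) x)] in
theorem chartDensity_pos (x : M) {u : EuclideanSpace ℝ (Fin d)}
    (hu : u ∈ (chartAt (EuclideanSpace ℝ (Fin d)) x).target) : 0 < chartDensity x u := by
  refine ENNReal.ofReal_pos.2 (Real.sqrt_pos.2 ?_)
  refine Matrix.PosDef.det_pos ?_
  refine Matrix.PosDef.of_dotProduct_mulVec_pos ?_ fun v hv => ?_
  · ext i j
    simp only [Matrix.conjTranspose_apply, star_trivial, metricMatrix_apply]
    exact metricForm_comm _ _ _ _
  · have := metricForm_self_pos x hu (v := WithLp.toLp 2 v) (by simpa using hv)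
    rw [metricForm_eq_sum] at this
    simpa [dotProduct, Matrix.mulVec, Finset.mul_sum, mul_assoc] using this

omit [SecondCountableTopology M] in
theorem riemannianVolume_pos {U : Set M} (hU : IsOpen U) (hne : U.Nonempty) :
    0 < riemannianVolume d M U := by
  obtain ⟨x, hx⟩ := hne
  refine lt_of_lt_of_le ?_ (chartVolume_le_riemannianVolume x U)
  rw [chartVolume_apply x hU.measurableSet]
  set φ := chartAt (EuclideanSpace ℝ (Fin d)) x with hφ
  have ho : IsOpen (φ.target ∩ φ.symm ⁻¹' U) := φ.isOpen_inter_preimage_symm hU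
  rw [inter_comm]
  have hsub : φ.target ∩ φ.symm ⁻¹' U ⊆ φ.target := inter_subset_left
  have hae : AEMeasurable (chartDensity x) (volume.restrict (φ.target ∩ φ.symm ⁻¹' U)) :=
    ((continuousOn_chartDensity x).mono hsub).aemeasurable ho.measurableSet
  rw [pos_iff_ne_zero, Ne, lintegral_eq_zero_iff' hae, Filter.EventuallyEq,
    ae_restrict_iff' ho.measurableSet]
  intro h
  have h0 : volume (φ.target ∩ φ.symm ⁻¹' U) = 0 := by
    refine measure_mono_null (fun u hu => ?_) (ae_iff.1 h)
    simp only [mem_ofPred_eq, not_forall]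
    exact ⟨hu, (chartDensity_pos x hu.1).ne'⟩
  refine (ho.measure_pos volume ⟨φ x, mem_chart_target _ x, ?_⟩).ne' h0
  simpa [hφ] using hx

theorem isLocallyFiniteMeasure_riemannianVolume :
    IsLocallyFiniteMeasure (riemannianVolume d M) := by
  refine ⟨fun x => ?_⟩
  set φ := chartAt (EuclideanSpace ℝ (Fin d)) x with hφ
  obtain ⟨r, hr, hsub⟩ := Metric.nhds_basis_closedBall.mem_iff.1
    (φ.open_target.mem_nhds (mem_chart_target _ x))
  have hU : IsOpen (φ.source ∩ φ ⁻¹' Metric.ball (φ x) r) :=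
    φ.isOpen_inter_preimage Metric.isOpen_ball
  refine ⟨φ.source ∩ φ ⁻¹' Metric.ball (φ x) r, hU.mem_nhds ⟨mem_chart_source _ x, ?_⟩, ?_⟩
  · simpa using hr
  rw [riemannianVolume_eq_chartVolume x hU.measurableSet inter_subset_left,
    chartVolume_apply x hU.measurableSet, ← hφ]
  have hs : φ.symm ⁻¹' (φ.source ∩ φ ⁻¹' Metric.ball (φ x) r) ∩ φ.target
      ⊆ Metric.closedBall (φ x) r := by
    rintro u ⟨⟨-, hu⟩, hut⟩
    rw [mem_preimage, φ.right_inv hut] at hu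
    exact Metric.ball_subset_closedBall hu
  refine (lintegral_mono_set hs).trans_lt ?_
  have hK := isCompact_closedBall (φ x) r
  obtain ⟨u₀, -, hmax⟩ := hK.exists_isMaxOn ⟨φ x, by simp [hr.le]⟩
    ((continuousOn_chartDensity x).mono hsub)
  calc ∫⁻ u in Metric.closedBall (φ x) r, chartDensity x u
      ≤ ∫⁻ _ in Metric.closedBall (φ x) r, chartDensity x u₀ :=
        setLIntegral_mono' hK.measurableSet fun u hu => hmax hu
    _ = chartDensity x u₀ * volume (Metric.closedBall (φ x) r) := by
        rw [setLIntegral_const]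
    _ < ⊤ := ENNReal.mul_lt_top ENNReal.ofReal_lt_top hK.measure_lt_top

end GluedVolume

/-! ### The Riemannian distance -/

section RiemannianDistance

variable {d : ℕ} {M : Type*} [MetricSpace M] [ChartedSpace (EuclideanSpace ℝ (Fin d)) M]
  [RiemannianBundle (fun x : M => TangentSpace (𝓡 d) x)] [IsRiemannianManifold (𝓡 d) M]

/-- A Riemannian isometry maps curves to curves of the same length, so it does not increase the
distance. -/
theorem IsRiemannianIsometry.edist_le {g : M ≃ₘ^∞⟮𝓡 d, 𝓡 d⟯ M} (hg : IsRiemannianIsometry d g)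
    (x y : M) : edist (g x) (g y) ≤ edist x y := by
  rw [IsRiemannianManifold.out (I := 𝓡 d) x y, IsRiemannianManifold.out (I := 𝓡 d) (g x) (g y)]
  refine le_of_forall_gt fun r hr => ?_
  obtain ⟨γ, h0, h1, hγ, hlen⟩ := Manifold.exists_lt_of_riemannianEDist_lt hr
  have hgγ : ContMDiffOn 𝓘(ℝ, ℝ) (𝓡 d) 1 (g ∘ γ) (Icc 0 1) :=
    (g.contMDiff.of_le (by simp)).comp_contMDiffOn hγ
  refine (Manifold.riemannianEDist_le_pathELength hgγ (by simp [h0]) (by simp [h1])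
    zero_le_one).trans_lt (lt_of_le_of_lt (le_of_eq ?_) hlen)
  rw [Manifold.pathELength_eq_lintegral_mfderiv_Ioo, Manifold.pathELength_eq_lintegral_mfderiv_Ioo]
  refine setLIntegral_congr_fun measurableSet_Ioo fun t ht => ?_
  have hγt : MDifferentiableAt 𝓘(ℝ, ℝ) (𝓡 d) γ t :=
    (hγ.contMDiffAt (Icc_mem_nhds ht.1 ht.2)).mdifferentiableAt (by simp)
  have e := mfderiv_comp t (g.contMDiff.mdifferentiableAt (by simp) :
    MDifferentiableAt (𝓡 d) (𝓡 d) g (γ t)) hγt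
  have hn : ∀ v : TangentSpace (𝓡 d) (γ t), ‖mfderiv (𝓡 d) (𝓡 d) g (γ t) v‖ₑ = ‖v‖ₑ := by
    intro v
    have h := hg (γ t) v v
    rw [real_inner_self_eq_norm_sq, real_inner_self_eq_norm_sq] at h
    have h2 := (sq_eq_sq₀ (norm_nonneg _) (norm_nonneg _)).1 h
    rw [← ofReal_norm, ← ofReal_norm, h2]
  rw [e]
  exact hn _

theorem IsRiemannianIsometry.isometry {g : M ≃ₘ^∞⟮𝓡 d, 𝓡 d⟯ M}
    (hg : IsRiemannianIsometry d g) : Isometry g := by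
  refine fun x y => le_antisymm (hg.edist_le x y) ?_
  simpa using hg.symm.edist_le (g x) (g y)

/-- A Riemannian manifold is a length space: there are almost-between points at prescribed
distances. -/
theorem exists_dist_lt_dist_lt (d : ℕ) [ChartedSpace (EuclideanSpace ℝ (Fin d)) M]
    [RiemannianBundle (fun x : M => TangentSpace (𝓡 d) x)]
    [IsManifold (𝓡 d) ∞ M] [IsRiemannianManifold (𝓡 d) M] {x y : M} {a b : ℝ} (ha : 0 < a)
    (hb : 0 < b) (h : dist x y < a + b) :
    ∃ z, dist x z < a ∧ dist z y < b := by
  rcases lt_or_ge (dist x y) a with hlt | hge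
  · exact ⟨y, hlt, by simpa using hb⟩
  have hr : Manifold.riemannianEDist (𝓡 d) x y < ENNReal.ofReal (a + b) := by
    rw [← IsRiemannianManifold.out (I := 𝓡 d) x y, edist_dist]
    exact (ENNReal.ofReal_lt_ofReal_iff (by linarith)).2 h
  obtain ⟨γ, h0, h1, hγ, hlen⟩ := Manifold.exists_lt_of_riemannianEDist_lt hr
  obtain ⟨L, hL0, hL, hLab⟩ := ENNReal.lt_iff_exists_real_btwn.1 hlen
  have hLlt : L < a + b := (ENNReal.ofReal_lt_ofReal_iff (by linarith)).1 hLab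
  obtain ⟨a', ha', ha'a⟩ := exists_between (show max 0 (L - b) < a from max_lt ha (by linarith))
  have ha'0 : 0 < a' := (le_max_left _ _).trans_lt ha'
  have ha'L : L < a' + b := by linarith [(le_max_right 0 (L - b)).trans_lt ha']
  have hcont : ContinuousOn (fun t => dist x (γ t)) (Icc 0 1) :=
    (continuous_const.dist continuous_id).comp_continuousOn hγ.continuousOn
  obtain ⟨t, ht, hta⟩ := intermediate_value_Icc zero_le_one hcont
    (show a' ∈ Icc (dist x (γ 0)) (dist x (γ 1)) by
      rw [h0, h1, dist_self]; exact ⟨ha'0.le, ha'a.le.trans hge⟩)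
  refine ⟨γ t, hta.trans_lt ha'a, ?_⟩
  have l1 : ENNReal.ofReal a' ≤ Manifold.pathELength (𝓡 d) γ 0 t := by
    rw [← hta]
    change ENNReal.ofReal (dist x (γ t)) ≤ _
    rw [← edist_dist, IsRiemannianManifold.out (I := 𝓡 d)]
    exact Manifold.riemannianEDist_le_pathELength (hγ.mono (Icc_subset_Icc le_rfl ht.2)) h0 rfl
      ht.1
  have l2 : edist (γ t) y ≤ Manifold.pathELength (𝓡 d) γ t 1 := by
    rw [IsRiemannianManifold.out (I := 𝓡 d)]
    exact Manifold.riemannianEDist_le_pathELength (hγ.mono (Icc_subset_Icc ht.1 le_rfl)) rfl h1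
      ht.2
  have l3 := Manifold.pathELength_add (I := 𝓡 d) (γ := γ) ht.1 ht.2
  have l4 : ENNReal.ofReal a' + edist (γ t) y < ENNReal.ofReal a' + ENNReal.ofReal b := by
    rw [← ENNReal.ofReal_add ha'0.le hb.le]
    calc _ ≤ Manifold.pathELength (𝓡 d) γ 0 t + Manifold.pathELength (𝓡 d) γ t 1 :=
          add_le_add l1 l2
      _ < ENNReal.ofReal L := by rw [l3]; exact hL
      _ ≤ _ := ENNReal.ofReal_le_ofReal ha'L.le
  rw [ENNReal.add_lt_add_iff_left ENNReal.ofReal_ne_top, edist_dist] at l4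
  exact (ENNReal.ofReal_lt_ofReal_iff hb).1 l4

end RiemannianDistance

/-! ### Second derivatives of isometries -/

section Koszul

variable {E : Type*} [NormedAddCommGroup E] [NormedSpace ℝ E] [FiniteDimensional ℝ E]

/-- The Koszul trick: if the trilinear form `T u v w = g (B u v) (A w)`, with `B` symmetric, has
bounded symmetrization in the last two variables, then `B` is bounded. -/
theorem norm_le_of_koszul {g : E → E → ℝ} (hg : ∀ v w, g v w = g w v) {c a S : ℝ} (hc : 0 < c)
    (hpos : ∀ v, c * ‖v‖ ^ 2 ≤ g v v) {A : E →L[ℝ] E} (hA : ∀ v, ‖v‖ ≤ a * ‖A v‖)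
    {B : E →L[ℝ] E →L[ℝ] E} (hB : ∀ u v, B u v = B v u) (hS : 0 ≤ S)
    (hT : ∀ u v w, |g (B u v) (A w) + g (A v) (B u w)| ≤ S * ‖u‖ * ‖v‖ * ‖w‖) (ha : 0 ≤ a) :
    ‖B‖ ≤ 3 / 2 * S * a / c := by
  have hK : 0 ≤ 3 / 2 * S * a / c := by positivity
  have hinj : Function.Injective A := by
    refine (injective_iff_map_eq_zero A).2 fun v hv => ?_
    have := hA v
    rw [hv, norm_zero, mul_zero] at this
    exact norm_le_zero_iff.1 this
  have hsurj : Function.Surjective A :=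
    (LinearMap.injective_iff_surjective (f := (A : E →ₗ[ℝ] E))).1 hinj
  refine ContinuousLinearMap.opNorm_le_bound₂ _ hK fun u v => ?_
  obtain ⟨w, hw⟩ := hsurj (B u v)
  have h1 := abs_le.1 (hT u v w)
  have h2 := abs_le.1 (hT v u w)
  have h3 := abs_le.1 (hT w u v)
  have e : g (B u v) (B u v) ≤ 3 / 2 * S * ‖u‖ * ‖v‖ * ‖w‖ := by
    -- the alternating sum over the cyclic permutations isolates `B u v`
    have e1 : g (B u v) (A w) + g (A v) (B u w) + (g (B v u) (A w) + g (A u) (B v w))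
        - (g (B w u) (A v) + g (A u) (B w v)) = 2 * g (B u v) (B u v) := by
      rw [hB v u, hB w u, hB w v, hg (A v) (B u w), hw]
      ring
    nlinarith
  have h4 : ‖w‖ ≤ a * ‖B u v‖ := hw ▸ hA w
  rcases eq_or_lt_of_le (norm_nonneg (B u v)) with h0 | h0
  · rw [← h0]; positivity
  have h5 : c * ‖B u v‖ ^ 2 ≤ 3 / 2 * S * ‖u‖ * ‖v‖ * (a * ‖B u v‖) :=
    (hpos _).trans (e.trans (by gcongr))
  have h6 : c * ‖B u v‖ ≤ 3 / 2 * S * ‖u‖ * ‖v‖ * a := by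
    refine le_of_mul_le_mul_right ?_ h0
    linarith
  calc ‖B u v‖ = c * ‖B u v‖ / c := by field_simp
    _ ≤ 3 / 2 * S * ‖u‖ * ‖v‖ * a / c := by gcongr
    _ = _ := by ring

set_option maxSynthPendingDepth 3 in
/-- Second derivatives of isometries of a metric `G` are bounded in terms of bounds for `G` and its
first derivatives. -/
theorem norm_fderiv_fderiv_le {G : E → E →L[ℝ] E →L[ℝ] ℝ} {U W : Set E} (hW : IsOpen W)
    (hWU : W ⊆ U) (hsymm : ∀ y v w, G y v w = G y w v) {c C L : ℝ} (hc : 0 < c) (hC : 0 ≤ C)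
    (hlow : ∀ y ∈ U, ∀ v, c * ‖v‖ ^ 2 ≤ G y v v) (hup : ∀ y ∈ U, ∀ v, G y v v ≤ C * ‖v‖ ^ 2)
    (hdiff : ∀ y ∈ U, DifferentiableAt ℝ G y) (hL : ∀ y ∈ U, ‖fderiv ℝ G y‖ ≤ L) {f : E → E}
    (hf : ContDiffOn ℝ 2 f W) (hfU : MapsTo f W U)
    (hiso : ∀ y ∈ W, ∀ v w, G (f y) (fderiv ℝ f y v) (fderiv ℝ f y w) = G y v w) {y : E}
    (hy : y ∈ W) :
    ‖fderiv ℝ (fderiv ℝ f) y‖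
      ≤ 3 / 2 * (L * (1 + √(C / c) ^ 3)) * √(C / c) / c := by
  -- the isometry distorts Euclidean lengths by a factor of at most `a`
  set a := √(C / c) with ha
  have ha0 : 0 ≤ a := Real.sqrt_nonneg _
  have ha2 : a ^ 2 = C / c := Real.sq_sqrt (by positivity)
  have hL0 : 0 ≤ L := (norm_nonneg _).trans (hL y (hWU hy))
  have hcomp : ∀ p q : ℝ, 0 ≤ p → 0 ≤ q → c * p ^ 2 ≤ C * q ^ 2 → p ≤ a * q := by
    intro p q hp hq h
    refine le_of_sq_le_sq ?_ (by positivity)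
    rw [mul_pow, ha2, div_mul_eq_mul_div, le_div_iff₀ hc]
    linarith
  have hfy : ContDiffAt ℝ 2 f y := hf.contDiffAt (hW.mem_nhds hy)
  have hdf : DifferentiableAt ℝ f y := hfy.differentiableAt (by simp)
  have hddf : DifferentiableAt ℝ (fderiv ℝ f) y :=
    (hfy.fderiv_right (m := 1) (by norm_num)).differentiableAt (by simp)
  have hup' : ∀ v, ‖fderiv ℝ f y v‖ ≤ a * ‖v‖ := fun v =>
    hcomp _ _ (norm_nonneg _) (norm_nonneg _)
      ((hlow _ (hfU hy) _).trans ((hiso y hy v v).trans_le (hup y (hWU hy) v)))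
  have hlow' : ∀ v, ‖v‖ ≤ a * ‖fderiv ℝ f y v‖ := fun v =>
    hcomp _ _ (norm_nonneg _) (norm_nonneg _)
      ((hlow _ (hWU hy) _).trans ((hiso y hy v v).symm.trans_le (hup _ (hfU hy) _)))
  refine norm_le_of_koszul (g := fun v w => G (f y) v w) (hsymm _) hc (hlow _ (hfU hy)) hlow'
    (fun u v => ?_) (by positivity) (fun u v w => ?_) ha0
  · exact (hfy.isSymmSndFDerivAt (by simp)) u v
  · -- differentiate the isometry identity in the direction `u`
    have hG : HasFDerivAt (fun z => G (f z)) ((fderiv ℝ G (f y)).comp (fderiv ℝ f y)) y :=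
      (hdiff _ (hfU hy)).hasFDerivAt.comp y hdf.hasFDerivAt
    have hv : ∀ v, HasFDerivAt (fun z => fderiv ℝ f z v)
        ((fderiv ℝ (fderiv ℝ f) y).flip v) y := fun v =>
      (ContinuousLinearMap.apply ℝ E v).hasFDerivAt.comp y hddf.hasFDerivAt
    have h2 := (hG.clm_apply (hv v)).clm_apply (hv w)
    have h3 : HasFDerivAt (fun z => G z v w)
        (((fderiv ℝ G y).flip v).flip w) y := by
      have := ((hdiff _ (hWU hy)).hasFDerivAt.clm_apply (hasFDerivAt_const v y)).clm_apply
        (hasFDerivAt_const w y)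
      have e : ((fderiv ℝ G y).flip v).flip w = (G y v).comp (0 : E →L[ℝ] E)
          + ((G y).comp (0 : E →L[ℝ] E) + (fderiv ℝ G y).flip v).flip w := by
        ext u
        simp
      rw [e]
      exact this
    have h4 := h2.unique (h3.congr_of_eventuallyEq
      (by filter_upwards [hW.mem_nhds hy] with z hz using hiso z hz v w))
    have h5 : G (f y) (fderiv ℝ f y v) (fderiv ℝ (fderiv ℝ f) y u w)
        + (G (f y) (fderiv ℝ (fderiv ℝ f) y u v) (fderiv ℝ f y w)
        + fderiv ℝ G (f y) (fderiv ℝ f y u) (fderiv ℝ f y v) (fderiv ℝ f y w))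
        = fderiv ℝ G y u v w := congrArg (fun l : E →L[ℝ] ℝ => l u) h4
    have htri : ∀ {z : E}, z ∈ U → ∀ p q r : E,
        |fderiv ℝ G z p q r| ≤ L * ‖p‖ * ‖q‖ * ‖r‖ := fun {z} hz p q r =>
      ((fderiv ℝ G z p).le_opNorm₂ q r).trans (by
        gcongr
        exact ((fderiv ℝ G z).le_opNorm p).trans (by gcongr; exact hL z hz))
    have h6 := htri (hWU hy) u v w
    have h7 : |fderiv ℝ G (f y) (fderiv ℝ f y u) (fderiv ℝ f y v) (fderiv ℝ f y w)|
        ≤ L * a ^ 3 * ‖u‖ * ‖v‖ * ‖w‖ :=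
      calc _ ≤ L * ‖fderiv ℝ f y u‖ * ‖fderiv ℝ f y v‖ * ‖fderiv ℝ f y w‖ := htri (hfU hy) _ _ _
        _ ≤ L * (a * ‖u‖) * (a * ‖v‖) * (a * ‖w‖) := by
          gcongr
          exacts [hup' u, hup' v, hup' w]
        _ = _ := by ring
    rw [show G (f y) (fderiv ℝ (fderiv ℝ f) y u v) (fderiv ℝ f y w)
        + G (f y) (fderiv ℝ f y v) (fderiv ℝ (fderiv ℝ f) y u w)
        = fderiv ℝ G y u v w
          - fderiv ℝ G (f y) (fderiv ℝ f y u) (fderiv ℝ f y v) (fderiv ℝ f y w) by linarith]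
    calc _ ≤ _ := abs_sub _ _
      _ ≤ L * ‖u‖ * ‖v‖ * ‖w‖ + L * a ^ 3 * ‖u‖ * ‖v‖ * ‖w‖ := add_le_add h6 h7
      _ = _ := by ring

omit [FiniteDimensional ℝ E] in
/-- A map with `f m = m`, `Df(m) = -1` and bounded second derivative is close to the point
reflection at `m`. -/
theorem norm_add_sub_two_smul_le {f : E → E} {W : Set E} (hW : IsOpen W) (hconv : Convex ℝ W)
    (hf : ContDiffOn ℝ 2 f W) {K : ℝ} (hK : ∀ y ∈ W, ‖fderiv ℝ (fderiv ℝ f) y‖ ≤ K) {m : E}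
    (hm : m ∈ W) (hfm : f m = m) (hdf : fderiv ℝ f m = -ContinuousLinearMap.id ℝ E) {y : E}
    (hy : y ∈ W) : ‖f y + y - (2 : ℝ) • m‖ ≤ K * ‖y - m‖ ^ 2 := by
  have hK0 : 0 ≤ K := (norm_nonneg _).trans (hK m hm)
  have hd : ∀ z ∈ W, DifferentiableAt ℝ f z := fun z hz =>
    (hf.contDiffAt (hW.mem_nhds hz)).differentiableAt (by simp)
  have hdd : ∀ z ∈ W, DifferentiableAt ℝ (fderiv ℝ f) z := fun z hz =>
    ((hf.contDiffAt (hW.mem_nhds hz)).fderiv_right (m := 1) (by norm_num)).differentiableAt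
      (by simp)
  have h1 : ∀ z ∈ W, ‖fderiv ℝ f z + ContinuousLinearMap.id ℝ E‖ ≤ K * ‖z - m‖ := by
    intro z hz
    have := hconv.norm_image_sub_le_of_norm_fderiv_le hdd hK hm hz
    rwa [hdf, sub_neg_eq_add] at this
  have hconv' : Convex ℝ (W ∩ Metric.closedBall m ‖y - m‖) := hconv.inter (convex_closedBall _ _)
  have h2 : ‖(f y + y) - (f m + m)‖ ≤ K * ‖y - m‖ * ‖y - m‖ := by
    refine hconv'.norm_image_sub_le_of_norm_hasFDerivWithin_le (f := fun z => f z + z)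
      (f' := fun z => fderiv ℝ f z + ContinuousLinearMap.id ℝ E) (fun z hz => ?_) (fun z hz => ?_)
      ⟨hm, by simp⟩ ⟨hy, by simp [dist_eq_norm]⟩
    · exact ((hd z hz.1).hasFDerivAt.add (hasFDerivAt_id z)).hasFDerivWithinAt
    · refine (h1 z hz.1).trans ?_
      have := hz.2
      rw [Metric.mem_closedBall, dist_eq_norm] at this
      gcongr
  calc ‖f y + y - (2 : ℝ) • m‖ = ‖(f y + y) - (f m + m)‖ := by rw [hfm, two_smul]
    _ ≤ _ := h2
    _ = _ := by ring

end Koszul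

/-! ### Symmetries of a symmetric space, and the volume of balls -/

section Orbits

set_option maxSynthPendingDepth 3

variable {d : ℕ} {M : Type*} [TopologicalSpace M] [ChartedSpace (EuclideanSpace ℝ (Fin d)) M]
  [RiemannianBundle (fun x : M => TangentSpace (𝓡 d) x)]

/-- `metricForm` as a continuous bilinear map. -/
noncomputable def metricCLM (x : M) (u : EuclideanSpace ℝ (Fin d)) :
    EuclideanSpace ℝ (Fin d) →L[ℝ] EuclideanSpace ℝ (Fin d) →L[ℝ] ℝ :=
  ∑ i, ∑ j, metricMatrix d x u i j •
    (EuclideanSpace.proj i : EuclideanSpace ℝ (Fin d) →L[ℝ] ℝ).smulRight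
      (EuclideanSpace.proj j : EuclideanSpace ℝ (Fin d) →L[ℝ] ℝ)

theorem metricCLM_apply (x : M) (u v w : EuclideanSpace ℝ (Fin d)) :
    metricCLM x u v w = metricForm x u v w := by
  rw [metricForm_eq_sum]
  simp only [metricCLM, sum_apply, smul_apply, ContinuousLinearMap.smulRight_apply, smul_eq_mul]
  refine Finset.sum_congr rfl fun i _ => Finset.sum_congr rfl fun j _ => ?_
  change metricMatrix d x u i j * (v i * w j) = v i * metricMatrix d x u i j * w j
  ring

variable [IsManifold (𝓡 d) ∞ M] [IsContMDiffRiemannianBundle (𝓡 d) ∞ (EuclideanSpace ℝ (Fin d))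
      (fun x : M => TangentSpace (𝓡 d) x)]

theorem contDiffOn_metricCLM (x : M) :
    ContDiffOn ℝ ∞ (metricCLM (d := d) x) (chartAt (EuclideanSpace ℝ (Fin d)) x).target := by
  unfold metricCLM
  refine ContDiffOn.sum fun i _ => ContDiffOn.sum fun j _ => ?_
  exact (contDiffOn_metricForm x (EuclideanSpace.single i 1)
    (EuclideanSpace.single j 1)).smul contDiffOn_const

/-- On compact sets of coordinates the metric is comparable with the Euclidean one and has bounded
first derivatives. -/
theorem exists_metricCLM_bounds (x : M) {K : Set (EuclideanSpace ℝ (Fin d))} (hK : IsCompact K)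
    (hKt : K ⊆ (chartAt (EuclideanSpace ℝ (Fin d)) x).target) :
    ∃ c C L : ℝ, 0 < c ∧ 0 ≤ C ∧
      (∀ y ∈ K, ∀ v, c * ‖v‖ ^ 2 ≤ metricCLM x y v v) ∧
      (∀ y ∈ K, ∀ v, metricCLM x y v v ≤ C * ‖v‖ ^ 2) ∧
      ∀ y ∈ K, ‖fderiv ℝ (metricCLM x) y‖ ≤ L := by
  have hopen := (chartAt (EuclideanSpace ℝ (Fin d)) x).open_target
  have hcont : ContinuousOn (metricCLM x) K := (contDiffOn_metricCLM x).continuousOn.mono hKt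
  have hcontD : ContinuousOn (fderiv ℝ (metricCLM x)) K :=
    ((contDiffOn_metricCLM x).continuousOn_fderiv_of_isOpen hopen (by simp)).mono hKt
  obtain ⟨L, hL⟩ := hK.exists_bound_of_continuousOn hcontD
  obtain ⟨C, hC⟩ := hK.exists_bound_of_continuousOn hcont
  have hS : IsCompact (K ×ˢ Metric.sphere (0 : EuclideanSpace ℝ (Fin d)) 1) :=
    hK.prod (isCompact_sphere _ _)
  have hcont2 : ContinuousOn (fun p : EuclideanSpace ℝ (Fin d) × EuclideanSpace ℝ (Fin d) =>
      metricCLM x p.1 p.2 p.2) (K ×ˢ Metric.sphere (0 : EuclideanSpace ℝ (Fin d)) 1) := by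
    have h1 : ContinuousOn (fun p : EuclideanSpace ℝ (Fin d) × EuclideanSpace ℝ (Fin d) =>
      metricCLM x p.1) (K ×ˢ Metric.sphere (0 : EuclideanSpace ℝ (Fin d)) 1) :=
      hcont.comp continuousOn_fst fun p hp => hp.1
    exact (h1.clm_apply continuousOn_snd).clm_apply continuousOn_snd
  obtain ⟨c, hc, hc'⟩ : ∃ c : ℝ, 0 < c ∧ ∀ p ∈ K ×ˢ Metric.sphere (0 : EuclideanSpace ℝ (Fin d)) 1,
      c ≤ metricCLM x p.1 p.2 p.2 := by
    rcases (K ×ˢ Metric.sphere (0 : EuclideanSpace ℝ (Fin d)) 1).eq_empty_or_nonempty with he | hne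
    · exact ⟨1, one_pos, by simp [he]⟩
    · obtain ⟨p, hp, hmin⟩ := hS.exists_isMinOn hne hcont2
      refine ⟨_, ?_, fun q hq => hmin hq⟩
      simp only [metricCLM_apply]
      refine metricForm_self_pos x (hKt hp.1) fun h => ?_
      have := hp.2
      rw [h] at this
      simp at this
  refine ⟨c, max C 0, L, hc, le_max_right _ _, fun y hy v => ?_, fun y hy v => ?_, hL⟩
  · rcases eq_or_ne v 0 with rfl | hv
    · simp
    have hv' : ‖v‖ ≠ 0 := norm_ne_zero_iff.2 hv
    have h := hc' (y, ‖v‖⁻¹ • v) ⟨hy, by simp [norm_smul, hv']⟩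
    simp only [map_smul, smul_apply, smul_eq_mul] at h
    calc c * ‖v‖ ^ 2 ≤ ‖v‖⁻¹ * (‖v‖⁻¹ * metricCLM x y v v) * ‖v‖ ^ 2 := by gcongr
      _ = metricCLM x y v v := by field_simp
  · calc metricCLM x y v v ≤ ‖metricCLM x y v v‖ := le_abs_self _
      _ ≤ ‖metricCLM x y‖ * ‖v‖ * ‖v‖ := (metricCLM x y).le_opNorm₂ v v
      _ ≤ max C 0 * ‖v‖ * ‖v‖ := by gcongr; exact (hC y hy).trans (le_max_left _ _)
      _ = _ := by ring

end Orbits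

section Orbits

set_option maxSynthPendingDepth 3

variable {d : ℕ} {M : Type*} [MetricSpace M] [ChartedSpace (EuclideanSpace ℝ (Fin d)) M]
  [RiemannianBundle (fun x : M => TangentSpace (𝓡 d) x)] [IsManifold (𝓡 d) ∞ M]
  [IsContMDiffRiemannianBundle (𝓡 d) ∞ (EuclideanSpace ℝ (Fin d))
    (fun x : M => TangentSpace (𝓡 d) x)] [IsRiemannianManifold (𝓡 d) M]

/-- In the coordinates around a point, the symmetries agree with the point reflections of the
model space up to a quadratic error, uniformly in the centre of the symmetry. -/
theorem exists_symmetry_quadratic (hM : IsRiemannianSymmetric d M) (p : M) :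
    ∃ ρ > 0, ∃ K : ℝ, Metric.ball (chartAt (EuclideanSpace ℝ (Fin d)) p p) ρ
        ⊆ (chartAt (EuclideanSpace ℝ (Fin d)) p).target ∧
      ∀ m ∈ Metric.ball (chartAt (EuclideanSpace ℝ (Fin d)) p p) ρ,
      ∃ σ : M ≃ₘ^∞⟮𝓡 d, 𝓡 d⟯ M, IsRiemannianIsometry d σ ∧
        ∀ u ∈ Metric.ball (chartAt (EuclideanSpace ℝ (Fin d)) p p) ρ,
          σ ((chartAt (EuclideanSpace ℝ (Fin d)) p).symm u)
            ∈ (chartAt (EuclideanSpace ℝ (Fin d)) p).source ∧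
          ‖chartAt (EuclideanSpace ℝ (Fin d)) p
            (σ ((chartAt (EuclideanSpace ℝ (Fin d)) p).symm u)) + u - (2 : ℝ) • m‖
              ≤ K * ‖u - m‖ ^ 2 := by
  set φ := chartAt (EuclideanSpace ℝ (Fin d)) p with hφ
  obtain ⟨R, hR, hRt⟩ := Metric.nhds_basis_closedBall.mem_iff.1
    (φ.open_target.mem_nhds (mem_chart_target _ p))
  obtain ⟨c, C, L, hc, hC, hlow, hup, hL⟩ :=
    exists_metricCLM_bounds p (isCompact_closedBall (φ p) R) hRt
  -- metric balls that fit into the coordinate ball of radius `R`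
  have hnb : φ.source ∩ φ ⁻¹' Metric.ball (φ p) R ∈ nhds p :=
    (φ.isOpen_inter_preimage Metric.isOpen_ball).mem_nhds
      ⟨mem_chart_source _ p, Metric.mem_ball_self hR⟩
  obtain ⟨r, hr, hrb⟩ := Metric.mem_nhds_iff.1 hnb
  have hnb2 : φ.symm ⁻¹' Metric.ball p (r / 3) ∈ nhds (φ p) := by
    have h := φ.symm.continuousAt (mem_chart_target _ p : φ p ∈ φ.symm.source)
    refine h.preimage_mem_nhds ?_
    rw [φ.left_inv (mem_chart_source _ p)]
    exact Metric.ball_mem_nhds _ (by positivity)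
  obtain ⟨ρ', hρ', hρb⟩ := Metric.mem_nhds_iff.1 hnb2
  set ρ := min ρ' R with hρdef
  have hρ : 0 < ρ := lt_min hρ' hR
  set W := Metric.ball (φ p) ρ with hWdef
  have hWR : W ⊆ Metric.closedBall (φ p) R :=
    (Metric.ball_subset_ball (min_le_right _ _)).trans Metric.ball_subset_closedBall
  have hWt : W ⊆ φ.target := hWR.trans hRt
  have hWr : ∀ u ∈ W, dist (φ.symm u) p < r / 3 := fun u hu =>
    hρb (Metric.ball_subset_ball (min_le_left _ _) hu)
  refine ⟨ρ, hρ, 3 / 2 * (L * (1 + √(C / c) ^ 3)) * √(C / c) / c, hWt, fun m hm => ?_⟩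
  obtain ⟨σ, hσ, hσm, hσd⟩ := hM (φ.symm m)
  -- `σ` fixes the point with coordinates `m`, so it moves no point of `W` out of the `r`-ball
  have hmap : ∀ u ∈ W, σ (φ.symm u) ∈ φ.source ∩ φ ⁻¹' Metric.ball (φ p) R := by
    intro u hu
    refine hrb ?_
    have h1 := hWr u hu
    have h2 := hWr m hm
    have h3 : dist (σ (φ.symm u)) (φ.symm m) = dist (φ.symm u) (φ.symm m) := by
      conv_lhs => rw [← hσm]
      exact hσ.isometry.dist_eq _ _
    have h4 := dist_triangle (σ (φ.symm u)) (φ.symm m) p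
    have h5 := dist_triangle_right (φ.symm u) (φ.symm m) p
    rw [Metric.mem_ball]
    linarith
  refine ⟨σ, hσ, fun u hu => ⟨(hmap u hu).1, ?_⟩⟩
  set f : EuclideanSpace ℝ (Fin d) → EuclideanSpace ℝ (Fin d) := fun u => φ (σ (φ.symm u))
    with hf
  have hfs : ContDiffOn ℝ 2 f W := by
    rw [← contMDiffOn_iff_contDiffOn]
    have h2 : (2 : ℕ∞ω) ≤ ((⊤ : ℕ∞) : ℕ∞ω) := ENat.LEInfty.out
    have h1 : ContMDiffOn (𝓡 d) (𝓡 d) 2 (σ ∘ φ.symm) W :=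
      (σ.contMDiff.of_le h2).comp_contMDiffOn
        (((contMDiffOn_chart_symm (I := 𝓡 d) (n := ∞) (x := p)).of_le h2).mono hWt)
    exact ((contMDiffOn_chart (I := 𝓡 d) (n := ∞) (x := p)).of_le h2).comp h1
      fun u hu => (hmap u hu).1
  have hfm : f m = m := by simp only [hf, hσm]; exact φ.right_inv (hWt hm)
  -- the conjugate of `-1` by the derivative of the chart is `-1`
  have hdf : fderiv ℝ f m = -ContinuousLinearMap.id ℝ (EuclideanSpace ℝ (Fin d)) := by
    have hφs : MDifferentiableAt (𝓡 d) (𝓡 d) φ.symm m :=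
      (mdifferentiable_chart (I := 𝓡 d) p).mdifferentiableAt_symm (hWt hm)
    have hσ' : MDifferentiableAt (𝓡 d) (𝓡 d) σ (φ.symm m) :=
      σ.contMDiff.mdifferentiableAt (by simp)
    have hφ' : MDifferentiableAt (𝓡 d) (𝓡 d) φ (σ (φ.symm m)) :=
      (mdifferentiable_chart (I := 𝓡 d) p).mdifferentiableAt (hmap m hm).1
    have e1 := mfderiv_comp m (g := φ) (f := σ ∘ φ.symm) hφ' (hσ'.comp m hφs)
    have e2 := mfderiv_comp m hσ' hφs
    have e3 := (mdifferentiable_chart (I := 𝓡 d) p).comp_symm_deriv (hWt hm)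
    ext1 v
    have e4 : fderiv ℝ f m v = (mfderiv (𝓡 d) (𝓡 d) φ (σ (φ.symm m))
        (-(mfderiv (𝓡 d) (𝓡 d) φ.symm m v : EuclideanSpace ℝ (Fin d))) :
          EuclideanSpace ℝ (Fin d)) := by
      rw [← mfderiv_eq_fderiv]
      refine (congrArg (fun l => l v) e1).trans (congrArg
        (fun w : EuclideanSpace ℝ (Fin d) => (mfderiv (𝓡 d) (𝓡 d) φ (σ (φ.symm m)) w :
          EuclideanSpace ℝ (Fin d))) ?_)
      exact (congrArg (fun l => l v) e2).trans (hσd _)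
    rw [e4]
    have e5 : (mfderiv (𝓡 d) (𝓡 d) φ (σ (φ.symm m))
        (-(mfderiv (𝓡 d) (𝓡 d) φ.symm m v : EuclideanSpace ℝ (Fin d))) :
          EuclideanSpace ℝ (Fin d)) = mfderiv (𝓡 d) (𝓡 d) φ (φ.symm m)
        (-(mfderiv (𝓡 d) (𝓡 d) φ.symm m v : EuclideanSpace ℝ (Fin d))) :=
      congrArg (fun q : M => (mfderiv (𝓡 d) (𝓡 d) φ q
        (-(mfderiv (𝓡 d) (𝓡 d) φ.symm m v : EuclideanSpace ℝ (Fin d))) :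
          EuclideanSpace ℝ (Fin d))) hσm
    rw [e5]
    exact (map_neg (mfderiv (𝓡 d) (𝓡 d) φ (φ.symm m)) _).trans
      (congrArg Neg.neg (congrArg (fun l => l v) e3))
  refine norm_add_sub_two_smul_le Metric.isOpen_ball (convex_ball _ _) hfs (fun y hy => ?_) hm hfm
    hdf hu
  refine norm_fderiv_fderiv_le (G := metricCLM p) (U := Metric.closedBall (φ p) R)
    Metric.isOpen_ball hWR (fun y v w => ?_) hc hC hlow hup (fun y hy => ?_) hL hfs
    (fun y hy => Metric.ball_subset_closedBall (hmap y hy).2) (fun y hy v w => ?_) hy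
  · rw [metricCLM_apply, metricCLM_apply, metricForm_comm]
  · exact ((contDiffOn_metricCLM p).contDiffAt (φ.open_target.mem_nhds (hRt hy))).differentiableAt
      (by simp)
  · rw [metricCLM_apply, metricCLM_apply]
    exact metricForm_isometry hσ p p (hWt hy) (hmap y hy).1 v w

omit [IsManifold (𝓡 d) ∞ M] [IsRiemannianManifold (𝓡 d) M]
  [IsContMDiffRiemannianBundle (𝓡 d) ∞ (EuclideanSpace ℝ (Fin d))
    (fun x : M => TangentSpace (𝓡 d) x)] in
theorem IsRiemannianIsometry.trans {g h : M ≃ₘ^∞⟮𝓡 d, 𝓡 d⟯ M} (hg : IsRiemannianIsometry d g)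
    (hh : IsRiemannianIsometry d h) : IsRiemannianIsometry d (g.trans h) := by
  intro x v w
  have e : mfderiv (𝓡 d) (𝓡 d) (g.trans h) x
      = (mfderiv (𝓡 d) (𝓡 d) h (g x)).comp (mfderiv (𝓡 d) (𝓡 d) g x) :=
    mfderiv_comp x (h.contMDiff.mdifferentiableAt (by simp))
      (g.contMDiff.mdifferentiableAt (by simp))
  rw [e]
  exact (hh (g x) _ _).trans (hg x v w)

/-- The orbit of `p` under the isometry group comes arbitrarily close to all points near `p`. -/
theorem eventually_exists_isometry_dist_lt (hM : IsRiemannianSymmetric d M) (p : M) :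
    ∀ᶠ q in nhds p, ∀ ε > 0, ∃ g : M ≃ₘ^∞⟮𝓡 d, 𝓡 d⟯ M, IsRiemannianIsometry d g ∧
      dist (g p) q < ε := by
  obtain ⟨ρ, hρ, K, hρt, hσ⟩ := exists_symmetry_quadratic hM p
  set φ := chartAt (EuclideanSpace ℝ (Fin d)) p with hφ
  -- each symmetry at the midpoint halves the distance to the target if that is at most `δ`
  obtain ⟨δ, hδ, hδρ, hδK⟩ : ∃ δ > 0, 2 * δ ≤ ρ ∧ K * δ ≤ 2 := by
    refine ⟨min (ρ / 2) (2 / max K 1), by positivity, ?_, ?_⟩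
    · linarith [min_le_left (ρ / 2) (2 / max K 1)]
    · calc K * min (ρ / 2) (2 / max K 1) ≤ max K 1 * (2 / max K 1) := by
            gcongr
            · exact le_max_left _ _
            · exact min_le_right _ _
        _ = 2 := by field_simp
  have hnb : φ.source ∩ φ ⁻¹' Metric.ball (φ p) δ ∈ nhds p :=
    (φ.isOpen_inter_preimage Metric.isOpen_ball).mem_nhds
      ⟨mem_chart_source _ p, Metric.mem_ball_self hδ⟩
  filter_upwards [hnb] with q hq ε hε
  have hstep : ∀ n : ℕ, ∃ g : M ≃ₘ^∞⟮𝓡 d, 𝓡 d⟯ M, IsRiemannianIsometry d g ∧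
      g p ∈ φ.source ∧ ‖φ (g p) - φ q‖ ≤ δ * (1 / 2) ^ n := by
    intro n
    induction n with
    | zero =>
      refine ⟨Diffeomorph.refl (𝓡 d) M ∞, isRiemannianIsometry_refl, mem_chart_source _ p, ?_⟩
      have := hq.2
      rw [mem_preimage, Metric.mem_ball, dist_eq_norm_sub'] at this
      simpa using this.le
    | succ n ih =>
      obtain ⟨g, hg, hgs, hgn⟩ := ih
      have hle : ‖φ (g p) - φ q‖ ≤ δ := hgn.trans
        (mul_le_of_le_one_right hδ.le (pow_le_one₀ (by norm_num) (by norm_num)))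
      have hqn : ‖φ q - φ p‖ < δ := by
        have := hq.2
        rwa [mem_preimage, Metric.mem_ball, dist_eq_norm] at this
      set u := φ (g p) with hu
      set m := (1 / 2 : ℝ) • (u + φ q) with hm
      have hmW : m ∈ Metric.ball (φ p) ρ := by
        rw [Metric.mem_ball, dist_eq_norm,
          show m - φ p = (1 / 2 : ℝ) • (u - φ q) + (φ q - φ p) by rw [hm]; module]
        calc _ ≤ ‖(1 / 2 : ℝ) • (u - φ q)‖ + ‖φ q - φ p‖ := norm_add_le _ _
          _ = 1 / 2 * ‖u - φ q‖ + ‖φ q - φ p‖ := by rw [norm_smul]; norm_num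
          _ < ρ := by linarith
      have huW : u ∈ Metric.ball (φ p) ρ := by
        rw [Metric.mem_ball, dist_eq_norm, ← sub_add_sub_cancel u (φ q) (φ p)]
        linarith [norm_add_le (u - φ q) (φ q - φ p)]
      obtain ⟨σ, hσi, hσ'⟩ := hσ m hmW
      obtain ⟨h1, h2⟩ := hσ' u huW
      have hgp : φ.symm u = g p := φ.left_inv hgs
      rw [hgp] at h1 h2
      refine ⟨g.trans σ, hg.trans hσi, h1, ?_⟩
      have e1 : φ (σ (g p)) + u - (2 : ℝ) • m = φ (σ (g p)) - φ q := by rw [hm]; module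
      have e2 : u - m = (1 / 2 : ℝ) • (u - φ q) := by rw [hm]; module
      rw [e1, e2, norm_smul] at h2
      change ‖φ (σ (g p)) - φ q‖ ≤ _
      refine h2.trans ?_
      have e3 : K * ‖u - φ q‖ ≤ 2 := by
        rcases le_or_gt K 0 with h | h
        · nlinarith [norm_nonneg (u - φ q)]
        · exact (mul_le_mul_of_nonneg_left hle h.le).trans hδK
      calc K * (‖(1 / 2 : ℝ)‖ * ‖u - φ q‖) ^ 2
          = 1 / 4 * (K * ‖u - φ q‖) * ‖u - φ q‖ := by norm_num; ring
        _ ≤ 1 / 4 * 2 * (δ * (1 / 2) ^ n) := by gcongr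
        _ = _ := by ring
  choose g hg hgs hgn using hstep
  have hlim : Filter.Tendsto (fun n => φ (g n p)) Filter.atTop (nhds (φ q)) := by
    rw [tendsto_iff_norm_sub_tendsto_zero]
    refine squeeze_zero (fun n => norm_nonneg _) hgn ?_
    simpa using (tendsto_pow_atTop_nhds_zero_of_lt_one (r := (1 / 2 : ℝ)) (by norm_num)
      (by norm_num)).const_mul δ
  have hlim2 : Filter.Tendsto (fun n => g n p) Filter.atTop (nhds q) := by
    have := (φ.symm.continuousAt (φ.map_source hq.1 : φ q ∈ φ.symm.source)).tendsto.comp hlim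
    rw [φ.left_inv hq.1] at this
    exact this.congr fun n => φ.left_inv (hgs n)
  obtain ⟨n, hn⟩ := (hlim2.eventually (Metric.ball_mem_nhds q hε)).exists
  exact ⟨g n, hg n, hn⟩

/-- The orbits of the isometry group of a symmetric space are dense. -/
theorem exists_isometry_dist_lt [PreconnectedSpace M] (hM : IsRiemannianSymmetric d M) (p q : M)
    {ε : ℝ} (hε : 0 < ε) :
    ∃ g : M ≃ₘ^∞⟮𝓡 d, 𝓡 d⟯ M, IsRiemannianIsometry d g ∧ dist (g p) q < ε := by
  let S : Set M := {q | ∀ ε > 0, ∃ g : M ≃ₘ^∞⟮𝓡 d, 𝓡 d⟯ M, IsRiemannianIsometry d g ∧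
    dist (g p) q < ε}
  -- `S` is the closure of the orbit of `p`; to lie in the orbit closure is an equivalence relation,
  -- and its classes are open
  have htrans : ∀ {a b c : M}, (∀ ε > 0, ∃ g : M ≃ₘ^∞⟮𝓡 d, 𝓡 d⟯ M, IsRiemannianIsometry d g ∧
      dist (g a) b < ε) → (∀ ε > 0, ∃ g : M ≃ₘ^∞⟮𝓡 d, 𝓡 d⟯ M, IsRiemannianIsometry d g ∧
      dist (g b) c < ε) → ∀ ε > 0, ∃ g : M ≃ₘ^∞⟮𝓡 d, 𝓡 d⟯ M, IsRiemannianIsometry d g ∧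
      dist (g a) c < ε := by
    intro a b c hab hbc ε hε
    obtain ⟨g, hg, hg'⟩ := hab (ε / 2) (by positivity)
    obtain ⟨h, hh, hh'⟩ := hbc (ε / 2) (by positivity)
    refine ⟨g.trans h, hg.trans hh, ?_⟩
    calc dist (h (g a)) c ≤ dist (h (g a)) (h b) + dist (h b) c := dist_triangle _ _ _
      _ < ε / 2 + ε / 2 := add_lt_add (by rwa [hh.isometry.dist_eq]) hh'
      _ = ε := by ring
  have hsymm : ∀ {a b : M}, (∀ ε > 0, ∃ g : M ≃ₘ^∞⟮𝓡 d, 𝓡 d⟯ M, IsRiemannianIsometry d g ∧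
      dist (g a) b < ε) → ∀ ε > 0, ∃ g : M ≃ₘ^∞⟮𝓡 d, 𝓡 d⟯ M, IsRiemannianIsometry d g ∧
      dist (g b) a < ε := by
    intro a b hab ε hε
    obtain ⟨g, hg, hg'⟩ := hab ε hε
    refine ⟨g.symm, hg.symm, ?_⟩
    rw [← hg.isometry.dist_eq, g.apply_symm_apply, dist_comm]
    exact hg'
  have hopen : IsOpen S := by
    refine isOpen_iff_mem_nhds.2 fun a ha => ?_
    filter_upwards [eventually_exists_isometry_dist_lt hM a] with b hb
    exact htrans ha hb
  have hclosed : IsClosed S := by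
    refine ⟨isOpen_iff_mem_nhds.2 fun a ha => ?_⟩
    filter_upwards [eventually_exists_isometry_dist_lt hM a] with b hb hbS
    exact ha (htrans hbS (hsymm hb))
  have huniv : S = univ := IsClopen.eq_univ ⟨hclosed, hopen⟩
    ⟨p, fun ε hε => ⟨Diffeomorph.refl (𝓡 d) M ∞, isRiemannianIsometry_refl, by simpa using hε⟩⟩
  exact (huniv ▸ mem_univ q : q ∈ S) ε hε

/-- Balls of equal radius in a symmetric space have equal volume. -/
theorem riemannianVolume_ball_eq [PreconnectedSpace M] [SecondCountableTopology M]
    [MeasurableSpace M] [BorelSpace M] (hM : IsRiemannianSymmetric d M) (p q : M) (r : ℝ) :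
    riemannianVolume d M (Metric.ball p r) = riemannianVolume d M (Metric.ball q r) := by
  -- only dense orbits are available, so the ball is exhausted by balls of smaller radius
  have key : ∀ p q : M, riemannianVolume d M (Metric.ball p r)
      ≤ riemannianVolume d M (Metric.ball q r) := by
    intro p q
    have hU : Metric.ball p r = ⋃ n : ℕ, Metric.ball p (r - 1 / (n + 1)) := by
      ext x
      simp only [Metric.mem_ball, mem_iUnion]
      constructor
      · intro h
        obtain ⟨n, hn⟩ := exists_nat_one_div_lt (sub_pos.2 h)
        exact ⟨n, by linarith⟩
      · rintro ⟨n, hn⟩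
        have : (0 : ℝ) < 1 / (n + 1) := by positivity
        linarith
    have hmono : Monotone fun n : ℕ => Metric.ball p (r - 1 / ((n : ℝ) + 1)) := by
      intro m n hmn
      refine Metric.ball_subset_ball ?_
      have : 1 / ((n : ℝ) + 1) ≤ 1 / ((m : ℝ) + 1) := by gcongr
      linarith
    rw [hU, hmono.measure_iUnion]
    refine iSup_le fun n => ?_
    obtain ⟨g, hg, hgq⟩ := exists_isometry_dist_lt hM p q (ε := 1 / ((n : ℝ) + 1)) (by positivity)
    rw [← riemannianVolume_image hg measurableSet_ball]
    refine measure_mono ?_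
    rintro _ ⟨x, hx, rfl⟩
    rw [Metric.mem_ball] at hx ⊢
    calc dist (g x) q ≤ dist (g x) (g p) + dist (g p) q := dist_triangle _ _ _
      _ < (r - 1 / (n + 1)) + 1 / (n + 1) := by
        rw [hg.isometry.dist_eq]; exact add_lt_add hx hgq
      _ = r := by ring
  exact le_antisymm (key p q) (key q p)

end Orbits

/-! ### The configuration space and void events -/

/-- Open sets are exhausted by compact sets. -/
theorem exists_monotone_isCompact_iUnion {M : Type*} [MetricSpace M] [SecondCountableTopology M]
    [LocallyCompactSpace M] {U : Set M} (hU : IsOpen U) :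
    ∃ K : ℕ → Set M, Monotone K ∧ (∀ n, IsCompact (K n)) ∧ ⋃ n, K n = U := by
  obtain ⟨F, hFc, -, hFU, hFm⟩ := hU.exists_iUnion_isClosed
  let E := CompactExhaustion.choice M
  refine ⟨fun n => F n ∩ E n, fun m n hmn => inter_subset_inter (hFm hmn) (E.subset hmn),
    fun n => (E.isCompact n).inter_left (hFc n), ?_⟩
  rw [iUnion_inter_of_monotone hFm (fun m n hmn => E.subset hmn), hFU, E.iUnion_eq, inter_univ]

namespace Config

variable {M : Type*}

/-- The event that a configuration has no point in `K`. -/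
def voidEvent [TopologicalSpace M] (K : Set M) : Set (Config M) := {Ξ | Ξ.1 ∩ K = ∅}

theorem voidEvent_union [TopologicalSpace M] (K L : Set M) :
    voidEvent (K ∪ L) = voidEvent K ∩ voidEvent L := by
  ext Ξ
  simp [voidEvent, inter_union_distrib_left, union_empty_iff]

theorem voidEvent_iUnion [TopologicalSpace M] {ι : Sort*} (K : ι → Set M) :
    voidEvent (⋃ i, K i) = ⋂ i, voidEvent (K i) := by
  ext Ξ
  simp [voidEvent, inter_iUnion]

theorem toMeasure_apply [TopologicalSpace M] [MeasurableSpace M] (Ξ : Config M) {B : Set M}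
    (hB : MeasurableSet B) : Ξ.toMeasure B = (((Ξ.1 ∩ B).encard : ℕ∞) : ℝ≥0∞) := by
  rw [toMeasure, Measure.sum_apply _ hB, ← ENNReal.tsum_set_one, tsum_subtype Ξ.1
    (fun x => Measure.dirac x B), tsum_subtype (Ξ.1 ∩ B) (fun _ => (1 : ℝ≥0∞))]
  refine tsum_congr fun x => ?_
  rw [← indicator_indicator]
  simp only [Measure.dirac_apply' _ hB]
  rfl

theorem measurableSet_voidEvent [TopologicalSpace M] [MeasurableSpace M] {B : Set M}
    (hB : MeasurableSet B) : MeasurableSet (voidEvent B) := by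
  have h : voidEvent B = (fun Ξ : Config M => (Ξ.1 ∩ B).encard) ⁻¹' {0} := by
    ext Ξ
    simp [voidEvent]
  rw [h]
  exact measurable_encard hB (MeasurableSet.of_discrete)

/-- The sets of configurations that have no point in a given compact set. -/
def compactVoidEvents (M : Type*) [TopologicalSpace M] : Set (Set (Config M)) :=
  {V | ∃ K : Set M, IsCompact K ∧ V = voidEvent K}

theorem isPiSystem_compactVoidEvents [TopologicalSpace M] : IsPiSystem (compactVoidEvents M) := by
  rintro _ ⟨K, hK, rfl⟩ _ ⟨L, hL, rfl⟩ -
  exact ⟨K ∪ L, hK.union hL, (voidEvent_union K L).symm⟩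

variable [MetricSpace M] [SecondCountableTopology M] [LocallyCompactSpace M] [MeasurableSpace M]
  [BorelSpace M]

omit [MeasurableSpace M] [BorelSpace M] in
/-- The number of points in a compact set is at least `n` iff `n` disjoint basic open sets are
hit inside it; so the void events of compact sets determine the numbers of points. -/
theorem measurableSet_generateFrom_le_encard {K : Set M} (hK : IsCompact K) (n : ℕ) :
    MeasurableSet[MeasurableSpace.generateFrom (compactVoidEvents M)]
      {Ξ : Config M | (n : ℕ∞) ≤ (Ξ.1 ∩ K).encard} := by
  let B := TopologicalSpace.countableBasis M
  have hB : Countable B := (TopologicalSpace.countable_countableBasis M).to_subtype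
  have h : {Ξ : Config M | (n : ℕ∞) ≤ (Ξ.1 ∩ K).encard}
      = ⋃ s ∈ {s : Finset B | s.card = n ∧ (s : Set B).PairwiseDisjoint (fun b => b.1)},
        ⋂ b ∈ s, (voidEvent (K ∩ b.1))ᶜ := by
    ext Ξ
    simp only [mem_ofPred_eq, mem_iUnion, mem_iInter, exists_prop]
    constructor
    · intro hn
      obtain ⟨T, hT, hTn⟩ := exists_subset_encard_eq hn
      have hTf : T.Finite := finite_of_encard_eq_coe hTn
      obtain ⟨U, hU, hUd⟩ := hTf.t2_separation
      have hb : ∀ x, ∃ b : B, x ∈ b.1 ∧ b.1 ⊆ U x := fun x => by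
        obtain ⟨v, hv, hxv, hvU⟩ :=
          (TopologicalSpace.isBasis_countableBasis M).exists_subset_of_mem_open (hU x).1 (hU x).2
        exact ⟨⟨v, hv⟩, hxv, hvU⟩
      choose b hbx hbU using hb
      have hinj : InjOn b T := by
        intro x hx y hy hxy
        by_contra hne
        exact disjoint_left.1 (hUd hx hy hne) (hbU x (hbx x)) (hbU y (hxy ▸ hbx x))
      classical
      refine ⟨hTf.toFinset.image b, ⟨?_, ?_⟩, ?_⟩
      · rw [Finset.card_image_of_injOn (by simpa using hinj)]
        have := hTf.encard_eq_coe_toFinset_card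
        rw [hTn] at this
        exact_mod_cast this.symm
      · rintro _ h1 _ h2 hne
        simp only [Finset.coe_image, Finite.coe_toFinset] at h1 h2
        obtain ⟨x, hx, rfl⟩ := h1
        obtain ⟨y, hy, rfl⟩ := h2
        exact (hUd hx hy fun e => hne (e ▸ rfl)).mono (hbU x) (hbU y)
      · intro c hc
        simp only [Finset.mem_image, Finite.mem_toFinset] at hc
        obtain ⟨x, hx, rfl⟩ := hc
        refine fun hv => eq_empty_iff_forall_notMem.1 hv x ⟨(hT hx).1, (hT hx).2, hbx x⟩
    · rintro ⟨s, ⟨rfl, hd⟩, hs⟩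
      rcases s.eq_empty_or_nonempty with rfl | ⟨b₀, hb₀⟩
      · simp
      have hx : ∀ b ∈ s, ∃ x, x ∈ Ξ.1 ∩ (K ∩ b.1) := fun b hb =>
        nonempty_iff_ne_empty.2 (hs b hb)
      have : Nonempty M := ⟨(hx b₀ hb₀).choose⟩
      choose! x hx using hx
      have hinj : InjOn x (s : Set B) := by
        intro a ha c hc hac
        by_contra hne
        exact disjoint_left.1 (hd ha hc hne) (hx a ha).2.2 (hac ▸ (hx c hc).2.2)
      rw [← encard_coe_eq_coe_finsetCard, ← hinj.encard_image]
      refine encard_le_encard ?_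
      rintro _ ⟨b, hb, rfl⟩
      exact ⟨(hx b hb).1, (hx b hb).2.1⟩
  rw [h]
  refine @MeasurableSet.biUnion _ _ (MeasurableSpace.generateFrom (compactVoidEvents M)) _ _
    (to_countable _) fun s _ => ?_
  refine @MeasurableSet.biInter _ _ (MeasurableSpace.generateFrom (compactVoidEvents M)) _ _
    s.countable_toSet fun b _ => ?_
  refine @MeasurableSet.compl _ _ (MeasurableSpace.generateFrom (compactVoidEvents M)) ?_
  obtain ⟨L, -, hL, hLb⟩ := exists_monotone_isCompact_iUnion
    (TopologicalSpace.isOpen_of_mem_countableBasis b.2)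
  rw [← hLb, inter_iUnion, voidEvent_iUnion]
  exact @MeasurableSet.iInter _ _ (MeasurableSpace.generateFrom (compactVoidEvents M)) _ _
    fun n => MeasurableSpace.measurableSet_generateFrom ⟨_, hK.inter_right (hL n).isClosed, rfl⟩

/-- The counts in compact sets determine the counts in Borel sets, by a π-λ argument inside each
compact set of an exhaustion. -/
theorem measurable_generateFrom_encard {B : Set M} (hB : MeasurableSet B) :
    Measurable[MeasurableSpace.generateFrom (compactVoidEvents M)]
      (fun Ξ : Config M => (Ξ.1 ∩ B).encard) := by
  let m : MeasurableSpace (Config M) := MeasurableSpace.generateFrom (compactVoidEvents M)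
  have h1 : ∀ K : Set M, IsCompact K →
      Measurable[m] (fun Ξ : Config M => (((Ξ.1 ∩ K).encard : ℕ∞) : ℝ≥0∞)) := by
    intro K hK
    refine (Measurable.of_discrete (f := fun n : ℕ∞ => (n : ℝ≥0∞))).comp ?_
    refine @measurable_to_countable' _ _ _ _ m _ fun y => ?_
    rcases eq_or_ne y ⊤ with rfl | hy
    · have : (fun Ξ : Config M => (Ξ.1 ∩ K).encard) ⁻¹' {⊤} = ∅ := by
        ext Ξ
        simpa using Ξ.2 K hK
      rw [this]
      exact @MeasurableSet.empty _ m
    · lift y to ℕ using hy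
      have : (fun Ξ : Config M => (Ξ.1 ∩ K).encard) ⁻¹' {(y : ℕ∞)}
          = {Ξ : Config M | (y : ℕ∞) ≤ (Ξ.1 ∩ K).encard}
            \ {Ξ : Config M | ((y + 1 : ℕ) : ℕ∞) ≤ (Ξ.1 ∩ K).encard} := by
        ext Ξ
        simp only [mem_preimage, mem_singleton_iff, mem_sdiff, mem_ofPred_eq, not_le]
        rw [Nat.cast_add, Nat.cast_one, ENat.lt_add_one_iff (ENat.natCast_ne_top y),
          le_antisymm_iff, and_comm]
      rw [this]
      exact @MeasurableSet.diff _ m _ _ (measurableSet_generateFrom_le_encard hK y)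
        (measurableSet_generateFrom_le_encard hK (y + 1))
  have h2 : ∀ K : Set M, IsCompact K →
      Measurable[m] (fun Ξ : Config M => Ξ.toMeasure.restrict K) := by
    intro K hK
    have hfin : ∀ Ξ : Config M, IsFiniteMeasure (Ξ.toMeasure.restrict K) := fun Ξ => ⟨by
      rw [Measure.restrict_apply_univ, toMeasure_apply _ hK.measurableSet]
      simpa using Ξ.2 K hK⟩
    refine @Measurable.measure_of_isPiSystem _ _ m _ _ hfin {F : Set M | IsClosed F}
      (BorelSpace.measurable_eq.trans borel_eq_generateFrom_isClosed) isPiSystem_isClosed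
      (fun F hF => ?_) ?_
    · simp only [Measure.restrict_apply hF.measurableSet,
        toMeasure_apply _ (hF.measurableSet.inter hK.measurableSet)]
      exact h1 _ (hK.inter_left hF)
    · simp only [Measure.restrict_apply_univ, toMeasure_apply _ hK.measurableSet]
      exact h1 _ hK
  have h3 : Measurable[m] (fun Ξ : Config M => (((Ξ.1 ∩ B).encard : ℕ∞) : ℝ≥0∞)) := by
    let E := CompactExhaustion.choice M
    have : (fun Ξ : Config M => (((Ξ.1 ∩ B).encard : ℕ∞) : ℝ≥0∞))
        = fun Ξ : Config M => ⨆ n, Ξ.toMeasure.restrict (E n) B := by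
      funext Ξ
      have hm : Monotone fun n => B ∩ E n := fun m n hmn =>
        inter_subset_inter_right _ (E.subset hmn)
      simp only [Measure.restrict_apply hB]
      rw [← hm.measure_iUnion, ← inter_iUnion, E.iUnion_eq, inter_univ, toMeasure_apply _ hB]
    rw [this]
    refine @Measurable.iSup _ _ _ _ _ m _ _ _ _ _ _ fun n => ?_
    exact (Measure.measurable_coe hB).comp (h2 _ (E.isCompact n))
  refine @measurable_to_countable' _ _ _ _ m _ fun y => ?_
  have : (fun Ξ : Config M => (Ξ.1 ∩ B).encard) ⁻¹' {y}
      = (fun Ξ : Config M => (((Ξ.1 ∩ B).encard : ℕ∞) : ℝ≥0∞)) ⁻¹' {(y : ℝ≥0∞)} := by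
    ext Ξ
    simp
  rw [this]
  exact h3 (measurableSet_singleton _)

/-- The void events of compact sets generate the σ-algebra of the configuration space. -/
theorem measurableSpace_eq_generateFrom :
    (inferInstance : MeasurableSpace (Config M))
      = MeasurableSpace.generateFrom (compactVoidEvents M) := by
  refine le_antisymm (iSup₂_le fun B hB => ?_) (MeasurableSpace.generateFrom_le ?_)
  · exact measurable_iff_comap_le.1 (measurable_generateFrom_encard hB)
  · rintro _ ⟨K, hK, rfl⟩
    exact measurableSet_voidEvent hK.measurableSet

theorem measurable_of_voidEvent {α : Type*} [MeasurableSpace α] {F : α → Config M}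
    (h : ∀ K : Set M, IsCompact K → MeasurableSet (F ⁻¹' voidEvent K)) : Measurable F := by
  have := measurable_generateFrom (f := F) (s := compactVoidEvents M)
    (by rintro _ ⟨K, hK, rfl⟩; exact h K hK)
  rwa [← measurableSpace_eq_generateFrom] at this

/-- Rényi's theorem: the law of a point process is determined by the void probabilities of compact
sets. -/
theorem measure_ext_of_voidEvent {P Q : Measure (Config M)} [IsProbabilityMeasure P]
    [IsProbabilityMeasure Q] (h : ∀ K : Set M, IsCompact K → P (voidEvent K) = Q (voidEvent K)) :
    P = Q := by
  refine ext_of_generate_finite _ measurableSpace_eq_generateFrom isPiSystem_compactVoidEvents ?_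
    (by simp)
  rintro _ ⟨K, hK, rfl⟩
  exact h K hK

theorem measurable_addPoint_prod :
    Measurable fun p : M × Config M => addPoint p.1 p.2 := by
  refine measurable_of_voidEvent fun K hK => ?_
  have h : (fun p : M × Config M => addPoint p.1 p.2) ⁻¹' voidEvent K = Kᶜ ×ˢ voidEvent K := by
    ext ⟨x, Ξ⟩
    change insert x Ξ.1 ∩ K = ∅ ↔ x ∉ K ∧ Ξ.1 ∩ K = ∅
    by_cases hx : x ∈ K
    · simp only [insert_inter_of_mem hx, hx, not_true_eq_false, false_and, iff_false]
      exact (insert_nonempty _ _).ne_empty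
    · simp [insert_inter_of_notMem hx, hx]
  rw [h]
  exact hK.measurableSet.compl.prod (measurableSet_voidEvent hK.measurableSet)

/-- The kernel that maps a configuration to the sum of the point masses at its points. -/
noncomputable def countingKernel (M : Type*) [TopologicalSpace M] [MeasurableSpace M] :
    Kernel (Config M) M := ⟨toMeasure, measurable_toMeasure⟩

/-- The kernel is cut into countably many pieces: the points in one of countably many relatively
compact sets, on the event that their number has a given value. -/
instance isSFiniteKernel_countingKernel : IsSFiniteKernel (countingKernel M) := by
  classical
  let E := CompactExhaustion.choice M
  let C : ℕ → Set M := disjointed fun n => E n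
  have hCm : ∀ n, MeasurableSet (C n) :=
    MeasurableSet.disjointed fun n => (E.isCompact n).measurableSet
  have hCE : ∀ n, C n ⊆ E n := fun n => disjointed_le _ n
  have hfin : ∀ (n : ℕ) (Ξ : Config M), (Ξ.1 ∩ C n).encard ≠ ⊤ := fun n Ξ =>
    encard_ne_top_iff.2 ((Ξ.2 _ (E.isCompact n)).subset (inter_subset_inter_right _ (hCE n)))
  have hS : ∀ n m : ℕ, MeasurableSet {Ξ : Config M | (Ξ.1 ∩ C n).encard = m} := fun n m =>
    measurable_encard (hCm n) (measurableSet_singleton _)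
  let κ : ℕ × ℕ → Kernel (Config M) M := fun p =>
    Kernel.piecewise (hS p.1 p.2) ((countingKernel M).restrict (hCm p.1)) 0
  have hκ : ∀ p, IsFiniteKernel (κ p) := by
    intro p
    refine ⟨(p.2 : ℝ≥0∞), by simp, fun Ξ => ?_⟩
    simp only [κ, Kernel.piecewise_apply]
    split_ifs with h
    · rw [Kernel.restrict_apply, Measure.restrict_apply_univ]
      change Ξ.toMeasure (C p.1) ≤ _
      rw [toMeasure_apply _ (hCm _), h]
      simp
    · simp
  have hsum : countingKernel M = Kernel.sum κ := by
    refine Kernel.ext_iff.2 fun Ξ => Measure.ext fun B hB => ?_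
    rw [Kernel.sum_apply' _ _ hB]
    change _ = ∑' p : ℕ × ℕ, (fun n m => κ (n, m) Ξ B) p.1 p.2
    rw [ENNReal.tsum_prod (f := fun n m => κ (n, m) Ξ B)]
    have h1 : ∀ n, ∑' m, κ (n, m) Ξ B = Ξ.toMeasure (B ∩ C n) := by
      intro n
      rw [tsum_eq_single (Ξ.1 ∩ C n).encard.toNat]
      · simp only [κ, Kernel.piecewise_apply, mem_ofPred_eq]
        rw [if_pos (ENat.natCast_toNat (hfin n Ξ)).symm, Kernel.restrict_apply,
          Measure.restrict_apply hB]
        rfl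
      · intro m hm
        simp only [κ, Kernel.piecewise_apply, mem_ofPred_eq]
        rw [if_neg]
        · simp
        · intro h
          exact hm (by rw [h]; simp)
    simp only [h1]
    rw [← measure_iUnion (fun i j h => ((disjoint_disjointed _) h).mono inter_subset_right
      inter_subset_right) (fun n => hB.inter (hCm n)), ← inter_iUnion, iUnion_disjointed,
      E.iUnion_eq, inter_univ]
    rfl
  rw [hsum]
  exact Kernel.isSFiniteKernel_sum

end Config

/-! ### Measurability of the Voronoi cell and of the Delaunay degree -/

namespace Config

variable {M : Type*} [MetricSpace M]

/-- The pairs `(x, Ξ)` for which some `z` is equidistant from `o` and `x` and has no point of `Ξ`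
nearer than `o`: the condition for `x` to be a Delaunay neighbour of `o`. -/
def delaunaySet (o : M) : Set (M × Config M) :=
  {p | ∃ z, dist o z = dist p.1 z ∧ p.2 ∈ voidEvent (Metric.ball z (dist o z))}

theorem mem_voidEvent_ball {Ξ : Config M} {y : M} {r : ℝ} :
    Ξ ∈ voidEvent (Metric.ball y r) ↔ ∀ s ∈ Ξ.1, r ≤ dist s y := by
  simp only [voidEvent, mem_ofPred_eq, eq_empty_iff_forall_notMem, mem_inter_iff, Metric.mem_ball,
    not_and, not_lt]

theorem voronoiCell_eq {Ξ : Config M} {o : M} (ho : o ∈ Ξ.1) :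
    voronoiCell Ξ.1 o = {y | Ξ ∈ voidEvent (Metric.ball y (dist o y))} := by
  ext y
  simp only [voronoiCell, mem_ofPred_eq, mem_voidEvent_ball]
  exact ⟨fun h s hs => h.2 ⟨s, hs, rfl⟩,
    fun h => ⟨⟨o, ho, rfl⟩, by rintro _ ⟨s, hs, rfl⟩; exact h s hs⟩⟩

theorem delaunayDegree_eq {Ξ : Config M} {o : M} (ho : o ∈ Ξ.1) :
    delaunayDegree Ξ.1 o = (Ξ.1 ∩ {x | x ≠ o ∧ (x, Ξ) ∈ delaunaySet o}).encard := by
  unfold delaunayDegree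
  congr 1
  ext x
  simp only [SimpleGraph.mem_neighborSet, delaunayGraph, mem_inter_iff, mem_ofPred_eq, delaunaySet,
    voidEvent, Metric.mem_sphere]
  constructor
  · rintro ⟨hne, -, hx, z, r, h1, h2, h3⟩
    refine ⟨hx, hne.symm, z, h1.trans h2.symm, ?_⟩
    rw [inter_comm, h1]
    exact h3.inter_eq
  · rintro ⟨hx, hne, z, h1, h2⟩
    refine ⟨hne.symm, ho, hx, z, dist o z, rfl, h1.symm, ?_⟩
    rwa [disjoint_iff_inter_eq_empty, inter_comm]

variable [SecondCountableTopology M] [MeasurableSpace M] [BorelSpace M]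

theorem measurableSet_setOf_mem_voidEvent_ball (o : M) :
    MeasurableSet {p : M × Config M | p.2 ∈ voidEvent (Metric.ball p.1 (dist o p.1))} := by
  have : Nonempty M := ⟨o⟩
  let q := TopologicalSpace.denseSeq M
  -- a point of `Ξ` nearer to `y` than `o` is detected by a small ball around a point of a countable
  -- dense set
  have h : {p : M × Config M | p.2 ∈ voidEvent (Metric.ball p.1 (dist o p.1))}ᶜ
      = ⋃ (i : ℕ) (j : ℕ), {y | dist (q i) y + 1 / ((j : ℝ) + 1) < dist o y} ×ˢ
        (voidEvent (Metric.ball (q i) (1 / ((j : ℝ) + 1))))ᶜ := by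
    ext ⟨y, Ξ⟩
    simp only [mem_compl_iff, mem_ofPred_eq, mem_iUnion, mem_prod, mem_voidEvent_ball, not_forall,
      not_le, exists_prop]
    constructor
    · rintro ⟨s, hs, hsy⟩
      obtain ⟨j, hj⟩ := exists_nat_one_div_lt (show 0 < (dist o y - dist s y) / 2 by linarith)
      obtain ⟨i, hi⟩ := (TopologicalSpace.denseRange_denseSeq M).exists_dist_lt s
        (show (0 : ℝ) < 1 / ((j : ℝ) + 1) by positivity)
      refine ⟨i, j, ?_, s, hs, hi⟩
      have := dist_triangle_left (q i) y s
      change dist (q i) y + _ < _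
      change dist s (q i) < _ at hi
      linarith
    · rintro ⟨i, j, h1, s, hs, h2⟩
      exact ⟨s, hs, by linarith [dist_triangle s (q i) y]⟩
  rw [← MeasurableSet.compl_iff, h]
  refine MeasurableSet.iUnion fun i => MeasurableSet.iUnion fun j => MeasurableSet.prod ?_ ?_
  · exact measurableSet_lt (by fun_prop) (by fun_prop)
  · exact (measurableSet_voidEvent measurableSet_ball).compl

variable [LocallyCompactSpace M]

theorem measurableSet_delaunaySet (o : M) : MeasurableSet (delaunaySet o) := by
  have : Nonempty M := ⟨o⟩
  let q := TopologicalSpace.denseSeq M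
  let E := CompactExhaustion.choice M
  -- the centre is found as a limit of approximate centres in a countable dense set
  have h : delaunaySet o = ⋃ n : ℕ, ⋂ k : ℕ, ⋃ i ∈ {i : ℕ | q i ∈ E (n + 1)},
      {x | |dist o (q i) - dist x (q i)| < 1 / ((k : ℝ) + 1)} ×ˢ
        voidEvent (Metric.ball (q i) (dist o (q i) - 1 / ((k : ℝ) + 1))) := by
    ext ⟨x, Ξ⟩
    simp only [delaunaySet, mem_ofPred_eq, mem_iUnion, mem_iInter, mem_prod, exists_prop,
      mem_voidEvent_ball]
    constructor
    · rintro ⟨z, hz, hΞ⟩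
      obtain ⟨n, hn⟩ := E.exists_mem z
      refine ⟨n, fun k => ?_⟩
      have hk : (0 : ℝ) < 1 / ((k : ℝ) + 1) := by positivity
      obtain ⟨y, hy, hyq⟩ := (TopologicalSpace.denseRange_denseSeq M).inter_open_nonempty
        (interior (E (n + 1)) ∩ Metric.ball z (1 / ((k : ℝ) + 1) / 2))
        (isOpen_interior.inter Metric.isOpen_ball)
        ⟨z, E.subset_interior_succ n hn, Metric.mem_ball_self (by positivity)⟩
      obtain ⟨i, rfl⟩ := hyq
      have hd : dist (q i) z < 1 / ((k : ℝ) + 1) / 2 := hy.2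
      refine ⟨i, interior_subset hy.1, ?_, fun s hs => ?_⟩
      · have h1 := abs_dist_sub_le (α := M) (q i) z o
        have h2 := abs_dist_sub_le (α := M) (q i) z x
        rw [dist_comm _ o, dist_comm _ o] at h1
        rw [dist_comm _ x, dist_comm _ x] at h2
        rw [abs_le] at h1 h2
        rw [abs_lt]
        constructor <;> linarith
      · have h1 := hΞ s hs
        have h2 := dist_triangle_right s z (q i)
        have h3 := dist_triangle o z (q i)
        have h4 := dist_triangle s (q i) z
        rw [dist_comm z (q i)] at h3
        linarith
    · rintro ⟨n, hn⟩
      choose i hiE hi1 hi2 using hn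
      obtain ⟨z, -, φ, hφ, hlim⟩ := (E.isCompact (n + 1)).tendsto_subseq hiE
      have h0 : Filter.Tendsto (fun k => 1 / ((φ k : ℝ) + 1)) Filter.atTop (nhds 0) :=
        tendsto_one_div_add_atTop_nhds_zero_nat.comp hφ.tendsto_atTop
      have hd : ∀ s : M, Filter.Tendsto (fun k => dist s (q (i (φ k)))) Filter.atTop
          (nhds (dist s z)) := fun s => tendsto_const_nhds.dist hlim
      refine ⟨z, ?_, fun s hs => ?_⟩
      · have h1 := ((hd o).sub (hd x)).abs
        have h2 := le_of_tendsto_of_tendsto' h1 h0 fun k => (hi1 (φ k)).le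
        exact sub_eq_zero.1 (abs_nonpos_iff.1 h2)
      · have h1 := (hd o).sub h0
        rw [sub_zero] at h1
        exact le_of_tendsto_of_tendsto' h1 (hd s) fun k => hi2 (φ k) s hs
  rw [h]
  refine MeasurableSet.iUnion fun n => MeasurableSet.iInter fun k =>
    MeasurableSet.biUnion (to_countable _) fun i _ => MeasurableSet.prod ?_ ?_
  · exact measurableSet_lt (by fun_prop) (by fun_prop)
  · exact measurableSet_voidEvent measurableSet_ball

theorem measurableSet_delaunayNeighbors (o : M) (Ξ : Config M) :
    MeasurableSet {x | x ≠ o ∧ (x, Ξ) ∈ delaunaySet o} :=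
  (measurableSet_singleton o).compl.inter (measurable_prodMk_right (measurableSet_delaunaySet o))

theorem measurable_encard_delaunayNeighbors (o : M) :
    Measurable fun Ξ : Config M =>
      (((Ξ.1 ∩ {x | x ≠ o ∧ (x, Ξ) ∈ delaunaySet o}).encard : ℕ∞) : ℝ≥0∞) := by
  have h := Kernel.measurable_kernel_prodMk_left (κ := countingKernel M)
    (t := {p : Config M × M | p.2 ≠ o ∧ (p.2, p.1) ∈ delaunaySet o})
    ((measurable_snd (measurableSet_singleton o).compl).inter
      (measurable_swap (measurableSet_delaunaySet o)))
  have e : (fun Ξ : Config M =>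
      (((Ξ.1 ∩ {x | x ≠ o ∧ (x, Ξ) ∈ delaunaySet o}).encard : ℕ∞) : ℝ≥0∞))
      = fun Ξ : Config M => Ξ.toMeasure {x | x ≠ o ∧ (x, Ξ) ∈ delaunaySet o} :=
    funext fun Ξ => (toMeasure_apply Ξ (measurableSet_delaunayNeighbors o Ξ)).symm
  rw [e]
  exact h

omit [LocallyCompactSpace M] in
theorem measurable_measure_voronoi (μ : Measure M) [SFinite μ] (o : M) :
    Measurable fun Ξ : Config M => μ {y | Ξ ∈ voidEvent (Metric.ball y (dist o y))} :=
  measurable_measure_prodMk_left (ν := μ) (s := {p : Config M × M |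
    p.1 ∈ voidEvent (Metric.ball p.2 (dist o p.2))})
    (measurable_swap (measurableSet_setOf_mem_voidEvent_ball o))

end Config

/-! ### Poisson processes: moments, invariance, and Mecke's formula -/

theorem lintegral_poissonMeasure (r : ℝ≥0) (f : ℕ → ℝ≥0∞) :
    ∫⁻ n, f n ∂(poissonMeasure r)
      = ∑' n, f n * ENNReal.ofReal (Real.exp (-r) * r ^ n / n.factorial) := by
  rw [lintegral_countable']
  simp only [poissonMeasure_singleton]

theorem lintegral_natCast_poissonMeasure (r : ℝ≥0) :
    ∫⁻ n, (n : ℝ≥0∞) ∂(poissonMeasure r) = r := by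
  rw [lintegral_poissonMeasure, tsum_eq_zero_add' ENNReal.summable]
  have h : ∀ n : ℕ, ((n + 1 : ℕ) : ℝ≥0∞)
      * ENNReal.ofReal (Real.exp (-r) * r ^ (n + 1) / (n + 1).factorial)
      = r * poissonMeasure r {n} := by
    intro n
    rw [poissonMeasure_singleton, ← ENNReal.ofReal_coe_nnreal, ← ENNReal.ofReal_natCast,
      ← ENNReal.ofReal_mul (by positivity), ← ENNReal.ofReal_mul (by positivity)]
    congr 1
    rw [Nat.factorial_succ]
    push_cast
    field_simp
    ring
  simp only [h, ENNReal.tsum_mul_left, Nat.cast_zero, zero_mul, zero_add]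
  have h1 := lintegral_countable' (μ := poissonMeasure r) (fun _ => 1)
  simp only [lintegral_one, measure_univ, one_mul] at h1
  rw [← h1, mul_one]

/-- The moment of order `m` of a Poisson variable grows at most like the `m`-th power of the
mean: `x ^ m ≤ m! exp x` is applied to `x = (1 + n) / (1 + r)`. -/
theorem lintegral_one_add_pow_poissonMeasure_le (r : ℝ≥0) (m : ℕ) :
    ∫⁻ n, (1 + (n : ℝ≥0∞)) ^ m ∂(poissonMeasure r)
      ≤ ENNReal.ofReal (m.factorial * Real.exp 3) * (1 + (r : ℝ≥0∞)) ^ m := by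
  set t : ℝ := 1 / (1 + r) with ht
  have hr : (0 : ℝ) ≤ r := r.2
  have ht0 : 0 < t := by positivity
  have ht1 : t ≤ 1 := by rw [ht, div_le_one (by positivity)]; linarith
  have htr : r * t ≤ 1 := by rw [ht, mul_one_div, div_le_one (by positivity)]; linarith
  have hpt : ∀ n : ℕ, (1 + (n : ℝ)) ^ m
      ≤ m.factorial * (1 + (r : ℝ)) ^ m * (Real.exp t * Real.exp t ^ n) := by
    intro n
    have h := Real.pow_div_factorial_le_exp (t * (1 + n)) (by positivity) m
    rw [div_le_iff₀ (by positivity)] at h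
    calc (1 + (n : ℝ)) ^ m = (1 + (r : ℝ)) ^ m * (t * (1 + n)) ^ m := by
          rw [← mul_pow]; congr 1; rw [ht]; field_simp
      _ ≤ (1 + (r : ℝ)) ^ m * (Real.exp (t * (1 + n)) * m.factorial) := by gcongr
      _ = _ := by
          rw [mul_add, mul_one, Real.exp_add, mul_comm t (n : ℝ), Real.exp_nat_mul]; ring
  have hsum : HasSum (fun n : ℕ => m.factorial * (1 + (r : ℝ)) ^ m * (Real.exp t * Real.exp t ^ n)
      * (Real.exp (-r) * r ^ n / n.factorial))
      (m.factorial * (1 + (r : ℝ)) ^ m * Real.exp t * Real.exp (-r)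
        * Real.exp (r * Real.exp t)) := by
    have h := (NormedSpace.expSeries_div_hasSum_exp (r * Real.exp t : ℝ)).mul_left
      (m.factorial * (1 + (r : ℝ)) ^ m * Real.exp t * Real.exp (-r))
    rw [← Real.exp_eq_exp_ℝ] at h
    have e : ∀ n : ℕ, m.factorial * (1 + (r : ℝ)) ^ m * (Real.exp t * Real.exp t ^ n)
        * (Real.exp (-r) * r ^ n / n.factorial) = m.factorial * (1 + (r : ℝ)) ^ m * Real.exp t
          * Real.exp (-r) * ((r * Real.exp t) ^ n / n.factorial) := by
      intro n
      rw [mul_pow]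
      ring
    simp only [e]
    exact h
  rw [lintegral_poissonMeasure]
  calc ∑' n : ℕ, (1 + (n : ℝ≥0∞)) ^ m * ENNReal.ofReal (Real.exp (-r) * r ^ n / n.factorial)
      ≤ ∑' n : ℕ, ENNReal.ofReal (m.factorial * (1 + (r : ℝ)) ^ m * (Real.exp t * Real.exp t ^ n)
          * (Real.exp (-r) * r ^ n / n.factorial)) := by
        refine ENNReal.tsum_le_tsum fun n => ?_
        rw [ENNReal.ofReal_mul (by positivity)]
        gcongr
        refine le_trans (le_of_eq ?_) (ENNReal.ofReal_le_ofReal (hpt n))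
        rw [ENNReal.ofReal_pow (by positivity), ENNReal.ofReal_add zero_le_one (by positivity)]
        simp
    _ = ENNReal.ofReal (m.factorial * (1 + (r : ℝ)) ^ m * Real.exp t * Real.exp (-r)
        * Real.exp (r * Real.exp t)) := by
        rw [← hsum.tsum_eq, ENNReal.ofReal_tsum_of_nonneg (fun n => by positivity) hsum.summable]
    _ ≤ ENNReal.ofReal (m.factorial * Real.exp 3 * (1 + (r : ℝ)) ^ m) := by
        refine ENNReal.ofReal_le_ofReal ?_
        -- as `exp t ≤ 1 + 2 t`, the left side is at most `t + 2 r t ≤ 1 + 2`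
        have h1 : t + -r + r * Real.exp t ≤ 3 := by
          have h2 : Real.exp t ≤ 1 + 2 * t := by
            have := Real.abs_exp_sub_one_le (x := t) (by rw [abs_of_pos ht0]; exact ht1)
            rw [abs_of_pos ht0] at this
            linarith [(abs_le.1 this).2]
          nlinarith
        calc _ = m.factorial * (1 + (r : ℝ)) ^ m * Real.exp (t + -r + r * Real.exp t) := by
              rw [Real.exp_add, Real.exp_add]; ring
          _ ≤ m.factorial * (1 + (r : ℝ)) ^ m * Real.exp 3 := by gcongr
          _ = _ := by ring
    _ = _ := by
        rw [ENNReal.ofReal_mul (by positivity), ENNReal.ofReal_pow (by positivity),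
          ENNReal.ofReal_add zero_le_one hr]
        simp

theorem borel_eq_generateFrom_isCompact (M : Type*) [MetricSpace M] [SecondCountableTopology M]
    [LocallyCompactSpace M] [MeasurableSpace M] [BorelSpace M] :
    (inferInstance : MeasurableSpace M)
      = MeasurableSpace.generateFrom {K : Set M | IsCompact K} := by
  refine le_antisymm ?_ (MeasurableSpace.generateFrom_le fun K hK => hK.measurableSet)
  change (_ : MeasurableSpace M) ≤ _
  rw [BorelSpace.measurable_eq (α := M), borel_eq_generateFrom_isClosed]
  refine MeasurableSpace.generateFrom_le fun F hF => ?_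
  let E := CompactExhaustion.choice M
  have : F = ⋃ n, F ∩ E n := by rw [← inter_iUnion, E.iUnion_eq, inter_univ]
  rw [this]
  exact @MeasurableSet.iUnion _ _ (_) _ _ fun n =>
    MeasurableSpace.measurableSet_generateFrom ((E.isCompact n).inter_left hF)

theorem isPiSystem_isCompact (M : Type*) [TopologicalSpace M] [T2Space M] :
    IsPiSystem {K : Set M | IsCompact K} := fun _ hK _ hL _ => hK.inter hL

namespace IsPoissonProcess
open Config

variable {M : Type*} [MetricSpace M] [SecondCountableTopology M] [LocallyCompactSpace M]
  [MeasurableSpace M] [BorelSpace M] {μ : Measure M} {P : Measure (Config M)}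

omit [SecondCountableTopology M] [LocallyCompactSpace M] [BorelSpace M] in
theorem measurable_ncard {B : Set M} (hB : MeasurableSet B) :
    Measurable fun Ξ : Config M => (Ξ.1 ∩ B).ncard :=
  (Measurable.of_discrete (f := ENat.toNat)).comp (measurable_encard hB)

omit [SecondCountableTopology M] [LocallyCompactSpace M] in
theorem toMeasure_eq_ncard {K : Set M} (hK : IsCompact K) (Ξ : Config M) :
    Ξ.toMeasure K = ((Ξ.1 ∩ K).ncard : ℝ≥0∞) := by
  rw [toMeasure_apply _ hK.measurableSet, ← (Ξ.2 K hK).cast_ncard_eq]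
  simp

omit [SecondCountableTopology M] [LocallyCompactSpace M] in
theorem lintegral_ncard (hP : IsPoissonProcess μ P) {K : Set M} (hK : IsCompact K)
    (f : ℕ → ℝ≥0∞) :
    ∫⁻ Ξ, f (Ξ.1 ∩ K).ncard ∂P = ∫⁻ n, f n ∂(poissonMeasure (μ K).toNNReal) := by
  rw [← hP.map_ncard K hK, lintegral_map Measurable.of_discrete (measurable_ncard hK.measurableSet)]

omit [SecondCountableTopology M] [LocallyCompactSpace M] in
theorem measure_voidEvent_of_isCompact (hP : IsPoissonProcess μ P) {K : Set M} (hK : IsCompact K) :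
    P (voidEvent K) = ENNReal.ofReal (Real.exp (-(μ K).toReal)) := by
  have h : voidEvent K = (fun Ξ : Config M => (Ξ.1 ∩ K).ncard) ⁻¹' {0} := by
    ext Ξ
    simp [voidEvent, ncard_eq_zero (Ξ.2 K hK)]
  rw [h, ← Measure.map_apply (measurable_ncard hK.measurableSet) (measurableSet_singleton _),
    hP.map_ncard K hK, poissonMeasure_singleton]
  simp [ENNReal.toReal]

/-- The bound `exp (- μ U)` for the probability that the open set `U` is empty. If `μ U` is
infinite, then the right side is `1`. -/
theorem measure_voidEvent_le (hP : IsPoissonProcess μ P) {U : Set M} (hU : IsOpen U) :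
    P (voidEvent U) ≤ ENNReal.ofReal (Real.exp (-(μ U).toReal)) := by
  have := hP.isProbabilityMeasure
  rcases eq_or_ne (μ U) ⊤ with h | h
  · simpa [h] using prob_le_one
  obtain ⟨K, hKm, hK, hKU⟩ := exists_monotone_isCompact_iUnion hU
  have hlim : Filter.Tendsto (fun n => ENNReal.ofReal (Real.exp (-(μ (K n)).toReal)))
      Filter.atTop (nhds (ENNReal.ofReal (Real.exp (-(μ U).toReal)))) := by
    have h1 : Filter.Tendsto (fun n => μ (K n)) Filter.atTop (nhds (μ U)) := by
      rw [← hKU]; exact tendsto_measure_iUnion_atTop hKm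
    exact ENNReal.tendsto_ofReal ((Real.continuous_exp.tendsto _).comp
      ((ENNReal.tendsto_toReal h).comp h1).neg)
  refine ge_of_tendsto' hlim fun n => ?_
  rw [← hP.measure_voidEvent_of_isCompact (hK n)]
  exact measure_mono fun Ξ hΞ => by
    rw [← hKU, voidEvent_iUnion] at hΞ
    exact mem_iInter.1 hΞ n

theorem lintegral_one_add_toMeasure_pow_le [IsFiniteMeasureOnCompacts μ]
    (hP : IsPoissonProcess μ P) {U : Set M} (hU : IsOpen U) (m : ℕ) :
    ∫⁻ Ξ, (1 + Ξ.toMeasure U) ^ m ∂P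
      ≤ ENNReal.ofReal (m.factorial * Real.exp 3) * (1 + μ U) ^ m := by
  obtain ⟨K, hKm, hK, hKU⟩ := exists_monotone_isCompact_iUnion hU
  have hlim : Filter.Tendsto (fun n => ∫⁻ Ξ, (1 + Ξ.toMeasure (K n)) ^ m ∂P) Filter.atTop
      (nhds (∫⁻ Ξ, (1 + Ξ.toMeasure U) ^ m ∂P)) := by
    refine lintegral_tendsto_of_tendsto_of_monotone (fun n => ?_) ?_ ?_
    · exact (((Measure.measurable_coe (hK n).measurableSet).comp
        measurable_toMeasure).const_add 1).pow_const m |>.aemeasurable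
    · refine Filter.Eventually.of_forall fun Ξ i j hij => ?_
      dsimp only
      gcongr
      exact hKm hij
    · refine Filter.Eventually.of_forall fun Ξ => ?_
      have h1 : Filter.Tendsto (fun n => Ξ.toMeasure (K n)) Filter.atTop
          (nhds (Ξ.toMeasure U)) := by
        rw [← hKU]; exact tendsto_measure_iUnion_atTop hKm
      exact ENNReal.Tendsto.pow (tendsto_const_nhds.add h1)
  refine le_of_tendsto' hlim fun n => ?_
  calc ∫⁻ Ξ, (1 + Ξ.toMeasure (K n)) ^ m ∂P
      = ∫⁻ j, (1 + (j : ℝ≥0∞)) ^ m ∂(poissonMeasure (μ (K n)).toNNReal) := by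
        simp only [toMeasure_eq_ncard (hK n)]
        exact hP.lintegral_ncard (hK n) (fun j : ℕ => (1 + (j : ℝ≥0∞)) ^ m)
    _ ≤ ENNReal.ofReal (m.factorial * Real.exp 3) * (1 + ((μ (K n)).toNNReal : ℝ≥0∞)) ^ m :=
        lintegral_one_add_pow_poissonMeasure_le _ m
    _ ≤ _ := by
        rw [ENNReal.coe_toNNReal (hK n).measure_lt_top.ne]
        gcongr
        rw [← hKU]
        exact subset_iUnion K n

omit [SecondCountableTopology M] [LocallyCompactSpace M] in
theorem lintegral_toMeasure_of_isCompact [IsFiniteMeasureOnCompacts μ]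
    (hP : IsPoissonProcess μ P) {K : Set M} (hK : IsCompact K) :
    ∫⁻ Ξ, Ξ.toMeasure K ∂P = μ K := by
  simp only [toMeasure_eq_ncard hK]
  rw [hP.lintegral_ncard hK (fun n => (n : ℝ≥0∞)), lintegral_natCast_poissonMeasure,
    ENNReal.coe_toNNReal hK.measure_lt_top.ne]

/-- The intensity measure of a Poisson process is its parameter. -/
theorem intensity_eq [IsFiniteMeasureOnCompacts μ] (hP : IsPoissonProcess μ P) :
    intensity P = μ := by
  have hK : ∀ K : Set M, IsCompact K → intensity P K = μ K := by
    intro K hK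
    rw [intensity, Measure.bind_apply hK.measurableSet measurable_toMeasure.aemeasurable]
    exact hP.lintegral_toMeasure_of_isCompact hK
  let E := CompactExhaustion.choice M
  refine Measure.ext_of_generateFrom_of_iUnion {K : Set M | IsCompact K} E
    (borel_eq_generateFrom_isCompact M) (isPiSystem_isCompact M) E.iUnion_eq E.isCompact
    (fun n => ?_) hK
  rw [hK _ (E.isCompact n)]
  exact (E.isCompact n).measure_lt_top.ne

/-- The law of a Poisson process is invariant under the homeomorphisms that preserve its
intensity. -/
theorem map_config_map_eq (hP : IsPoissonProcess μ P) (g : M ≃ₜ M)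
    (hg : ∀ K : Set M, IsCompact K → μ (g ⁻¹' K) = μ K) : P.map (Config.map g) = P := by
  have := hP.isProbabilityMeasure
  have := Measure.isProbabilityMeasure_map (μ := P) (measurable_map g).aemeasurable
  refine measure_ext_of_voidEvent fun K hK => ?_
  have h : Config.map g ⁻¹' voidEvent K = voidEvent (g ⁻¹' K) := by
    ext Ξ
    change g '' Ξ.1 ∩ K = ∅ ↔ Ξ.1 ∩ g ⁻¹' K = ∅
    rw [← image_inter_preimage, image_eq_empty]
  rw [Measure.map_apply (measurable_map g) (measurableSet_voidEvent hK.measurableSet), h,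
    hP.measure_voidEvent_of_isCompact (g.isCompact_preimage.2 hK),
    hP.measure_voidEvent_of_isCompact hK, hg K hK]

/-- The points in `A` outside `K` are independent of the event that `K` is empty. The set `A \ K` is
exhausted by compact sets, for which this is part of the definition of a Poisson process. -/
theorem setLIntegral_voidEvent_toMeasure [IsFiniteMeasureOnCompacts μ] (hP : IsPoissonProcess μ P)
    {K A : Set M} (hK : IsCompact K) (hA : IsCompact A) :
    ∫⁻ Ξ in voidEvent K, Ξ.toMeasure A ∂P = P (voidEvent K) * μ (A \ K) := by
  have hvK : MeasurableSet (voidEvent K) := measurableSet_voidEvent hK.measurableSet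
  obtain ⟨L, hLm, hL, hLU⟩ := exists_monotone_isCompact_iUnion hK.isClosed.isOpen_compl
  have hLK : ∀ n, Disjoint (A ∩ L n) K := fun n =>
    disjoint_left.2 fun x hx hxK => (hLU ▸ subset_iUnion L n) hx.2 hxK
  have hmono : Monotone fun n => A ∩ L n := fun m n h => inter_subset_inter_right _ (hLm h)
  have hun : ⋃ n, A ∩ L n = A \ K := by rw [← inter_iUnion, hLU]; rfl
  have hcomp : ∀ n, IsCompact (A ∩ L n) := fun n => hA.inter (hL n)
  have hn : ∀ n, ∫⁻ Ξ in voidEvent K, Ξ.toMeasure (A ∩ L n) ∂P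
      = P (voidEvent K) * μ (A ∩ L n) := by
    intro n
    have hind := hP.iIndepFun_ncard 2 ![K, A ∩ L n] (by
      intro i; fin_cases i
      · exact hK
      · exact hcomp n) (by
      intro i j hij
      fin_cases i <;> fin_cases j
      · exact absurd rfl hij
      · exact (hLK n).symm
      · exact hLK n
      · exact absurd rfl hij)
    have hind2 := (hind.indepFun (i := 0) (j := 1) (by simp)).comp
      (φ := fun k : ℕ => if k = 0 then (1 : ℝ≥0∞) else 0) (ψ := fun k : ℕ => (k : ℝ≥0∞))
      Measurable.of_discrete Measurable.of_discrete
    have h := lintegral_mul_eq_lintegral_mul_lintegral_of_indepFun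
      (Measurable.of_discrete.comp (measurable_ncard hK.measurableSet))
      (Measurable.of_discrete.comp (measurable_ncard (hcomp n).measurableSet)) hind2
    have e1 : (fun Ξ : Config M => if (Ξ.1 ∩ K).ncard = 0 then (1 : ℝ≥0∞) else 0)
        = (voidEvent K).indicator 1 := by
      funext Ξ
      by_cases hΞ : Ξ.1 ∩ K = ∅ <;>
        simp [indicator, voidEvent, ncard_eq_zero (Ξ.2 K hK), hΞ]
    have e2 : (fun Ξ : Config M => ((Ξ.1 ∩ (A ∩ L n)).ncard : ℝ≥0∞))
        = fun Ξ => Ξ.toMeasure (A ∩ L n) := funext fun Ξ => (toMeasure_eq_ncard (hcomp n) Ξ).symm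
    change ∫⁻ Ξ, (fun Ξ : Config M => if (Ξ.1 ∩ K).ncard = 0 then (1 : ℝ≥0∞) else 0) Ξ
      * (fun Ξ : Config M => ((Ξ.1 ∩ (A ∩ L n)).ncard : ℝ≥0∞)) Ξ ∂P
      = (∫⁻ Ξ, (fun Ξ : Config M => if (Ξ.1 ∩ K).ncard = 0 then (1 : ℝ≥0∞) else 0) Ξ ∂P)
      * ∫⁻ Ξ, (fun Ξ : Config M => ((Ξ.1 ∩ (A ∩ L n)).ncard : ℝ≥0∞)) Ξ ∂P at h
    rw [e1, e2, lintegral_indicator_one hvK, hP.lintegral_toMeasure_of_isCompact (hcomp n)] at h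
    rw [← h, ← lintegral_indicator hvK]
    refine lintegral_congr fun Ξ => ?_
    by_cases hΞ : Ξ ∈ voidEvent K <;> simp [hΞ]
  have hlim : Filter.Tendsto (fun n => ∫⁻ Ξ in voidEvent K, Ξ.toMeasure (A ∩ L n) ∂P)
      Filter.atTop (nhds (∫⁻ Ξ in voidEvent K, Ξ.toMeasure (A \ K) ∂P)) := by
    refine lintegral_tendsto_of_tendsto_of_monotone (fun n => ?_) ?_ ?_
    · exact ((Measure.measurable_coe (hcomp n).measurableSet).comp
        measurable_toMeasure).aemeasurable
    · exact Filter.Eventually.of_forall fun Ξ i j hij => measure_mono (hmono hij)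
    · refine Filter.Eventually.of_forall fun Ξ => ?_
      rw [← hun]
      exact tendsto_measure_iUnion_atTop hmono
  have hlim2 : Filter.Tendsto (fun n => P (voidEvent K) * μ (A ∩ L n)) Filter.atTop
      (nhds (P (voidEvent K) * μ (A \ K))) := by
    rw [← hun]
    have := hP.isProbabilityMeasure
    exact ENNReal.Tendsto.const_mul (tendsto_measure_iUnion_atTop hmono)
      (Or.inr (measure_ne_top _ _))
  simp only [hn] at hlim
  rw [← tendsto_nhds_unique hlim hlim2]
  refine setLIntegral_congr_fun hvK fun Ξ hΞ => ?_
  have hm : MeasurableSet (A \ K) := hA.measurableSet.diff hK.measurableSet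
  rw [toMeasure_apply _ hA.measurableSet, toMeasure_apply _ hm]
  congr 2
  have : Ξ.1 ∩ K = ∅ := hΞ
  ext x
  constructor
  · exact fun hx => ⟨hx.1, hx.2, fun hxK => eq_empty_iff_forall_notMem.1 this x ⟨hx.1, hxK⟩⟩
  · exact fun hx => ⟨hx.1, hx.2.1⟩

/-- The law of the process with a point added at `x`, as a function of `x`. -/
noncomputable def addPointKernel (P : Measure (Config M)) [SFinite P] : Kernel M (Config M) :=
  ⟨fun x => P.map (addPoint x), by
    refine Measure.measurable_of_measurable_coe _ fun V hV => ?_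
    simp only [Measure.map_apply (measurable_addPoint _) hV]
    exact measurable_measure_prodMk_left (measurable_addPoint_prod hV)⟩

/-- Mecke's formula. Both sides integrate `f` against a measure on `M × Config M`; on the products
`A ×ˢ voidEvent K` with compact `A` and `K`, which form a generating π-system, both measures take
the value `P (voidEvent K) * μ (A \ K)`. -/
theorem lintegral_lintegral_toMeasure [IsFiniteMeasureOnCompacts μ] (hP : IsPoissonProcess μ P)
    {f : M × Config M → ℝ≥0∞} (hf : Measurable f) :
    ∫⁻ Ξ, ∫⁻ x, f (x, Ξ) ∂Ξ.toMeasure ∂P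
      = ∫⁻ x, ∫⁻ Ξ, f (x, Ξ) ∂(P.map (addPoint x)) ∂μ := by
  have hprob := hP.isProbabilityMeasure
  have hker : IsMarkovKernel (addPointKernel P) :=
    ⟨fun x => Measure.isProbabilityMeasure_map (measurable_addPoint x).aemeasurable⟩
  let E := CompactExhaustion.choice M
  have hrect : ∀ K A : Set M, IsCompact K → IsCompact A →
      ((P ⊗ₘ countingKernel M).map Prod.swap) (A ×ˢ voidEvent K)
        = P (voidEvent K) * μ (A \ K) := by
    intro K A hK hA
    have hvK : MeasurableSet (voidEvent K) := measurableSet_voidEvent hK.measurableSet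
    rw [Measure.map_apply measurable_swap (hA.measurableSet.prod hvK), preimage_swap_prod,
      Measure.compProd_apply_prod hvK hA.measurableSet]
    exact hP.setLIntegral_voidEvent_toMeasure hK hA
  have heq : (P ⊗ₘ countingKernel M).map Prod.swap = μ ⊗ₘ addPointKernel P := by
    refine Measure.ext_of_generateFrom_of_iUnion
      (image2 (· ×ˢ ·) {K : Set M | IsCompact K} (compactVoidEvents M))
      (fun n => E n ×ˢ voidEvent ∅) ?_
      ((isPiSystem_isCompact M).prod isPiSystem_compactVoidEvents) ?_
      (fun n => ⟨E n, E.isCompact n, voidEvent ∅, ⟨∅, isCompact_empty, rfl⟩, rfl⟩)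
      (fun n => ?_) ?_
    · refine (generateFrom_eq_prod (borel_eq_generateFrom_isCompact M).symm
        measurableSpace_eq_generateFrom.symm ⟨E, E.isCompact, E.iUnion_eq⟩
        ⟨fun _ => voidEvent ∅, fun _ => ⟨∅, isCompact_empty, rfl⟩, ?_⟩).symm
      simp [voidEvent, iUnion_const]
    · rw [← iUnion_prod_const, E.iUnion_eq]
      simp [voidEvent]
    · rw [hrect _ _ isCompact_empty (E.isCompact n)]
      refine ENNReal.mul_ne_top (measure_ne_top _ _) ?_
      rw [sdiff_empty]
      exact (E.isCompact n).measure_lt_top.ne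
    · rintro _ ⟨A, hA, _, ⟨K, hK, rfl⟩, rfl⟩
      have hA' : IsCompact A := hA
      have hvK : MeasurableSet (voidEvent K) := measurableSet_voidEvent hK.measurableSet
      rw [hrect K A hK hA, Measure.compProd_apply_prod hA'.measurableSet hvK]
      have h : ∀ x, addPointKernel P x (voidEvent K)
          = Kᶜ.indicator (fun _ => P (voidEvent K)) x := by
        intro x
        change P.map (addPoint x) (voidEvent K) = _
        rw [Measure.map_apply (measurable_addPoint x) hvK]
        by_cases hx : x ∈ K
        · rw [indicator_of_notMem (by simpa using hx)]
          convert measure_empty (μ := P)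
          refine eq_empty_iff_forall_notMem.2 fun Ξ hΞ => ?_
          exact eq_empty_iff_forall_notMem.1 hΞ x ⟨mem_insert _ _, hx⟩
        · rw [indicator_of_mem (by simpa using hx)]
          congr 1
          ext Ξ
          change insert x Ξ.1 ∩ K = ∅ ↔ Ξ.1 ∩ K = ∅
          rw [insert_inter_of_notMem hx]
      simp only [h]
      rw [lintegral_indicator hK.measurableSet.compl, setLIntegral_const,
        Measure.restrict_apply hK.measurableSet.compl, inter_comm]
      rfl
  have h1 : ∫⁻ p, f p ∂((P ⊗ₘ countingKernel M).map Prod.swap)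
      = ∫⁻ p, f p ∂(μ ⊗ₘ addPointKernel P) := by rw [heq]
  rw [lintegral_map hf measurable_swap, Measure.lintegral_compProd hf,
    Measure.lintegral_compProd (f := fun p => f p.swap) (hf.comp measurable_swap)] at h1
  exact h1

end IsPoissonProcess

/-! ### Volume growth of spaces with homogeneous balls -/

/-- The properties of a measure on a metric space that govern the volume growth: the space is a
length space, balls of equal radius have equal measure, and this measure is positive, and finite
for small radii. -/
structure HasHomogeneousBalls {M : Type*} [MetricSpace M] [MeasurableSpace M] (μ : Measure M) :
    Prop where
  exists_between : ∀ {x y : M} {a b : ℝ}, 0 < a → 0 < b → dist x y < a + b →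
    ∃ z, dist x z < a ∧ dist z y < b
  ball_eq : ∀ (x y : M) (r : ℝ), μ (Metric.ball x r) = μ (Metric.ball y r)
  ball_pos : ∀ (x : M) {r : ℝ}, 0 < r → 0 < μ (Metric.ball x r)
  exists_ball_lt_top : ∀ x : M, ∃ r > 0, μ (Metric.ball x r) < ⊤

namespace HasHomogeneousBalls

variable {M : Type*} [MetricSpace M] [MeasurableSpace M] [BorelSpace M] {μ : Measure M}

/-- A ball has a finite `ε`-net whose cardinality is controlled by the volume. -/
theorem exists_net (h : HasHomogeneousBalls μ) (o : M) {R ε : ℝ} (hε : 0 < ε)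
    (hfin : μ (Metric.ball o (R + ε / 2)) < ⊤) :
    ∃ N : Finset M, (∀ y ∈ Metric.ball o R, ∃ x ∈ N, dist y x < ε) ∧
      N.card * μ (Metric.ball o (ε / 2)) ≤ μ (Metric.ball o (R + ε / 2)) := by
  classical
  -- separated sets have bounded cardinality, as the balls of radius `ε / 2` are disjoint
  have hcard : ∀ N : Finset M, (∀ x ∈ N, dist o x < R) →
      (∀ x ∈ N, ∀ y ∈ N, x ≠ y → ε ≤ dist x y) →
      N.card * μ (Metric.ball o (ε / 2)) ≤ μ (Metric.ball o (R + ε / 2)) := by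
    intro N hN hsep
    have hd : (N : Set M).PairwiseDisjoint fun x => Metric.ball x (ε / 2) := by
      intro x hx y hy hxy
      refine Metric.ball_disjoint_ball ?_
      linarith [hsep x hx y hy hxy]
    calc N.card * μ (Metric.ball o (ε / 2)) = ∑ x ∈ N, μ (Metric.ball x (ε / 2)) := by
          rw [Finset.sum_congr rfl fun x _ => h.ball_eq x o (ε / 2), Finset.sum_const, nsmul_eq_mul]
      _ = μ (⋃ x ∈ N, Metric.ball x (ε / 2)) :=
          (measure_biUnion_finset hd fun x _ => measurableSet_ball).symm
      _ ≤ _ := by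
          refine measure_mono (iUnion₂_subset fun x hx => Metric.ball_subset_ball' ?_)
          rw [dist_comm]
          linarith [hN x hx]
  by_contra hcon
  push Not at hcon
  have hall : ∀ n : ℕ, ∃ N : Finset M, N.card = n ∧ (∀ x ∈ N, dist o x < R) ∧
      ∀ x ∈ N, ∀ y ∈ N, x ≠ y → ε ≤ dist x y := by
    intro n
    induction n with
    | zero => exact ⟨∅, by simp⟩
    | succ n ih =>
      obtain ⟨N, hNn, hN, hsep⟩ := ih
      have : ∃ y ∈ Metric.ball o R, ∀ x ∈ N, ε ≤ dist y x := by
        by_contra hc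
        push Not at hc
        exact absurd (hcard N hN hsep) (not_le.2 (hcon N hc))
      obtain ⟨y, hy, hyN⟩ := this
      have hyn : y ∉ N := fun hmem => by
        have := hyN y hmem
        rw [dist_self] at this
        linarith
      refine ⟨insert y N, by rw [Finset.card_insert_of_notMem hyn, hNn], ?_, ?_⟩
      · intro x hx
        rcases Finset.mem_insert.1 hx with rfl | hx
        · rwa [dist_comm]
        · exact hN x hx
      · intro x hx z hz hxz
        rcases Finset.mem_insert.1 hx with hx' | hx' <;>
          rcases Finset.mem_insert.1 hz with hz' | hz'
        · exact absurd (hx'.trans hz'.symm) hxz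
        · exact hx' ▸ hyN z hz'
        · rw [dist_comm]; exact hz' ▸ hyN x hx'
        · exact hsep x hx' z hz' hxz
  have hb := h.ball_pos o (half_pos hε)
  obtain ⟨n, hn⟩ := ENNReal.exists_nat_mul_gt hb.ne' hfin.ne
  obtain ⟨N, rfl, hN, hsep⟩ := hall n
  exact absurd (hcard N hN hsep) (not_le.2 hn)

/-- The volume of balls is submultiplicative in the radius, up to the size `ε` of a net: the ball of
radius `R + s` is covered by the balls of radius `s + ε` around an `ε`-net of the `R`-ball. -/
theorem measure_ball_add_mul_le (h : HasHomogeneousBalls μ) (o : M) {R s ε : ℝ} (hR : 0 < R)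
    (hs : 0 < s) (hε : 0 < ε) (hfin : μ (Metric.ball o (R + ε / 2)) < ⊤) :
    μ (Metric.ball o (R + s)) * μ (Metric.ball o (ε / 2))
      ≤ μ (Metric.ball o (R + ε / 2)) * μ (Metric.ball o (s + ε)) := by
  obtain ⟨N, hN, hcard⟩ := h.exists_net o hε hfin
  have hsub : Metric.ball o (R + s) ⊆ ⋃ x ∈ N, Metric.ball x (s + ε) := by
    intro y hy
    rw [Metric.mem_ball, dist_comm] at hy
    obtain ⟨z, hz1, hz2⟩ := h.exists_between hR hs hy
    obtain ⟨x, hx, hzx⟩ := hN z (by rwa [Metric.mem_ball, dist_comm])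
    refine mem_biUnion hx ?_
    rw [Metric.mem_ball]
    linarith [dist_triangle y z x, dist_comm y z]
  calc μ (Metric.ball o (R + s)) * μ (Metric.ball o (ε / 2))
      ≤ (N.card * μ (Metric.ball o (s + ε))) * μ (Metric.ball o (ε / 2)) := by
        gcongr
        calc _ ≤ μ (⋃ x ∈ N, Metric.ball x (s + ε)) := measure_mono hsub
          _ ≤ ∑ x ∈ N, μ (Metric.ball x (s + ε)) := measure_biUnion_finset_le _ _
          _ = _ := by
            rw [Finset.sum_congr rfl fun x _ => h.ball_eq x o (s + ε), Finset.sum_const,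
              nsmul_eq_mul]
    _ = (N.card * μ (Metric.ball o (ε / 2))) * μ (Metric.ball o (s + ε)) := by ring
    _ ≤ _ := by gcongr

/-- All balls have finite measure, as small balls do and the radius can be increased in steps. -/
theorem measure_ball_lt_top (h : HasHomogeneousBalls μ) (o : M) (R : ℝ) :
    μ (Metric.ball o R) < ⊤ := by
  obtain ⟨r, hr, hfin⟩ := h.exists_ball_lt_top o
  set ε := r / 2 with hε
  have hε0 : 0 < ε := by positivity
  have hind : ∀ n : ℕ, μ (Metric.ball o (((n : ℝ) + 2) * (ε / 2))) < ⊤ := by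
    intro n
    induction n with
    | zero =>
      refine (measure_mono (Metric.ball_subset_ball ?_)).trans_lt hfin
      push_cast
      linarith
    | succ n ih =>
      have h1 := h.measure_ball_add_mul_le o (R := ((n : ℝ) + 1) * (ε / 2)) (s := ε) (ε := ε)
        (by positivity) hε0 hε0 (by convert ih using 3; ring)
      rw [show ((n : ℝ) + 1) * (ε / 2) + ε = ((n + 1 : ℕ) + 2 : ℝ) * (ε / 2) by push_cast; ring,
        show ((n : ℝ) + 1) * (ε / 2) + ε / 2 = ((n : ℝ) + 2) * (ε / 2) by ring,
        show ε + ε = r by rw [hε]; ring] at h1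
      by_contra hcon
      rw [not_lt, top_le_iff] at hcon
      rw [hcon, ENNReal.top_mul (h.ball_pos o (half_pos hε0)).ne', top_le_iff] at h1
      exact (ENNReal.mul_lt_top ih hfin).ne h1
  obtain ⟨n, hn⟩ := exists_nat_gt (R / (ε / 2))
  refine (measure_mono (Metric.ball_subset_ball ?_)).trans_lt (hind n)
  rw [div_lt_iff₀ (by positivity)] at hn
  nlinarith

theorem real_ball_pos (h : HasHomogeneousBalls μ) (o : M) {r : ℝ} (hr : 0 < r) :
    0 < μ.real (Metric.ball o r) :=
  ENNReal.toReal_pos (h.ball_pos o hr).ne' (h.measure_ball_lt_top o r).ne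

theorem real_ball_mono (h : HasHomogeneousBalls μ) (o : M) {r s : ℝ} (hrs : r ≤ s) :
    μ.real (Metric.ball o r) ≤ μ.real (Metric.ball o s) :=
  measureReal_mono (Metric.ball_subset_ball hrs) (h.measure_ball_lt_top o s).ne

theorem real_ball_add_mul_le (h : HasHomogeneousBalls μ) (o : M) {R s ε : ℝ} (hR : 0 < R)
    (hs : 0 < s) (hε : 0 < ε) :
    μ.real (Metric.ball o (R + s)) * μ.real (Metric.ball o (ε / 2))
      ≤ μ.real (Metric.ball o (R + ε / 2)) * μ.real (Metric.ball o (s + ε)) := by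
  have := h.measure_ball_add_mul_le o hR hs hε (h.measure_ball_lt_top _ _)
  simp only [Measure.real, ← ENNReal.toReal_mul]
  exact ENNReal.toReal_mono
    (ENNReal.mul_lt_top (h.measure_ball_lt_top _ _) (h.measure_ball_lt_top _ _)).ne this

/-- Enlarging the radius by a constant costs a constant factor, and doubling it at most squares the
volume, up to a constant factor. -/
theorem exists_growth_const (h : HasHomogeneousBalls μ) (o : M) :
    ∃ C : ℝ, 1 ≤ C ∧
      (∀ n : ℕ, 1 ≤ n →
        μ.real (Metric.ball o (2 * n + 1 / 2)) ≤ C * μ.real (Metric.ball o (2 * n))) ∧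
      (∀ n : ℕ, 2 ≤ n → μ.real (Metric.ball o (2 * n)) ≤ C * μ.real (Metric.ball o (2 * n - 2))) ∧
      ∀ n : ℕ, 1 ≤ n →
        1 + μ.real (Metric.ball o (4 * n + 4)) ≤ C * μ.real (Metric.ball o (2 * n)) ^ 2 := by
  set V : ℝ → ℝ := fun r => μ.real (Metric.ball o r) with hV
  have hmono : Monotone V := fun r s hrs => h.real_ball_mono o hrs
  have hpos : ∀ {r : ℝ}, 0 < r → 0 < V r := fun hr => h.real_ball_pos o hr
  -- nets of mesh `1`
  have hmul : ∀ {R s : ℝ}, 0 < R → 0 < s → V (R + s) * V (1 / 2) ≤ V (R + 1 / 2) * V (s + 1) :=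
    fun hR hs => h.real_ball_add_mul_le o hR hs one_pos
  set c := V 2 / V (1 / 2) with hc
  have hc1 : 1 ≤ c := (one_le_div (hpos (by norm_num))).2 (hmono (by norm_num))
  have hstep : ∀ {R : ℝ}, 1 / 2 < R → V (R + 1 / 2) ≤ c * V R := by
    intro R hR
    have := hmul (R := R - 1 / 2) (s := 1) (by linarith) one_pos
    rw [show R - 1 / 2 + 1 = R + 1 / 2 by ring, sub_add_cancel, one_add_one_eq_two] at this
    rw [hc, div_mul_eq_mul_div, le_div_iff₀ (hpos (by norm_num))]
    linarith
  have hiter : ∀ (j : ℕ) {R : ℝ}, 1 / 2 < R → V (R + j / 2) ≤ c ^ j * V R := by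
    intro j
    induction j with
    | zero => intro R _; simp
    | succ j ih =>
      intro R hR
      have hj : (0 : ℝ) ≤ j := j.cast_nonneg
      calc V (R + (j + 1 : ℕ) / 2) = V (R + j / 2 + 1 / 2) := by congr 1; push_cast; ring
        _ ≤ c * V (R + j / 2) := hstep (by linarith)
        _ ≤ c * (c ^ j * V R) := by gcongr; exact ih hR
        _ = _ := by ring
  set A := 1 / V 2 ^ 2 + c ^ 11 / V (1 / 2) with hA
  have hV2 := hpos (r := 2) (by norm_num)
  have hVh := hpos (r := 1 / 2) (by norm_num)
  refine ⟨max (c ^ 4) A, (one_le_pow₀ hc1).trans (le_max_left _ _), fun n hn => ?_, fun n hn => ?_,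
    fun n hn => ?_⟩
  · have hn' : (1 : ℝ) ≤ n := by exact_mod_cast hn
    refine (hstep (by linarith)).trans ?_
    have : c ≤ max (c ^ 4) A := (le_self_pow₀ hc1 (by norm_num)).trans (le_max_left _ _)
    exact mul_le_mul_of_nonneg_right this (hpos (by linarith)).le
  · have hn' : (2 : ℝ) ≤ n := by exact_mod_cast hn
    have := hiter 4 (R := 2 * n - 2) (by linarith)
    rw [show (2 * n - 2 + (4 : ℕ) / 2 : ℝ) = 2 * n by push_cast; ring] at this
    exact this.trans (mul_le_mul_of_nonneg_right (le_max_left _ _) (hpos (by linarith)).le)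
  · have hn' : (1 : ℝ) ≤ n := by exact_mod_cast hn
    have h1 := hmul (R := 2 * n) (s := 2 * n + 4) (by linarith) (by linarith)
    have h2 := hiter 10 (R := 2 * n) (by linarith)
    have h3 := hstep (R := 2 * n) (by linarith)
    rw [show (2 * n + (2 * n + 4) : ℝ) = 4 * n + 4 by ring] at h1
    rw [show (2 * n + (10 : ℕ) / 2 : ℝ) = 2 * n + 4 + 1 by push_cast; ring] at h2
    have hVn := hpos (r := 2 * n) (by linarith)
    have h4 : V (4 * n + 4) ≤ c ^ 11 / V (1 / 2) * V (2 * n) ^ 2 := by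
      rw [div_mul_eq_mul_div, le_div_iff₀ hVh]
      calc _ ≤ _ := h1
        _ ≤ (c * V (2 * n)) * (c ^ 10 * V (2 * n)) := by
          refine mul_le_mul h3 h2 (hpos (by linarith)).le (by positivity)
        _ = _ := by ring
    have h5 : 1 ≤ 1 / V 2 ^ 2 * V (2 * n) ^ 2 := by
      rw [div_mul_eq_mul_div, one_mul, one_le_div (by positivity)]
      have : V 2 ≤ V (2 * n) := hmono (by linarith)
      gcongr
    calc 1 + V (4 * n + 4) ≤ A * V (2 * n) ^ 2 := by rw [hA, add_mul]; exact add_le_add h5 h4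
      _ ≤ _ := mul_le_mul_of_nonneg_right (le_max_right _ _) (by positivity)

/-- In an unbounded space the volume grows at least linearly. -/
theorem natCast_mul_le_real_ball [PreconnectedSpace M] (h : HasHomogeneousBalls μ) (o : M)
    (hub : ∀ R : ℝ, ∃ y, R ≤ dist o y) (n : ℕ) :
    n * μ.real (Metric.ball o 1) ≤ μ.real (Metric.ball o (2 * n)) := by
  induction n with
  | zero => simp
  | succ n ih =>
    obtain ⟨y, hy⟩ := hub (2 * n + 1)
    obtain ⟨z, -, hz⟩ := isPreconnected_univ.intermediate_value (mem_univ o) (mem_univ y)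
      (f := fun z => dist o z) (by fun_prop)
      (show (2 * n + 1 : ℝ) ∈ Icc (dist o o) (dist o y) from
        ⟨by rw [dist_self]; positivity, hy⟩)
    have hd : Disjoint (Metric.ball o (2 * n)) (Metric.ball z 1) :=
      Metric.ball_disjoint_ball (le_of_eq hz.symm)
    have hsub : Metric.ball o (2 * n) ∪ Metric.ball z 1 ⊆ Metric.ball o (2 * (n + 1 : ℕ)) := by
      refine union_subset (Metric.ball_subset_ball (by push_cast; linarith))
        (Metric.ball_subset_ball' ?_)
      rw [dist_comm]
      rw [show dist o z = 2 * n + 1 from hz]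
      push_cast
      linarith
    have h1 : μ.real (Metric.ball z 1) = μ.real (Metric.ball o 1) := by
      simp only [Measure.real, h.ball_eq z o 1]
    calc ((n + 1 : ℕ) : ℝ) * μ.real (Metric.ball o 1)
        = n * μ.real (Metric.ball o 1) + μ.real (Metric.ball z 1) := by rw [h1]; push_cast; ring
      _ ≤ μ.real (Metric.ball o (2 * n)) + μ.real (Metric.ball z 1) := by gcongr
      _ = μ.real (Metric.ball o (2 * n) ∪ Metric.ball z 1) :=
        (measureReal_union hd measurableSet_ball (h.measure_ball_lt_top _ _).ne
          (h.measure_ball_lt_top _ _).ne).symm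
      _ ≤ _ := measureReal_mono hsub (h.measure_ball_lt_top _ _).ne

end HasHomogeneousBalls

/-! ### Moments of functionals of the Voronoi cell -/

/-- Half of the exponent absorbs the power, by `x ^ p ≤ p! exp x`; the other half gives a geometric
series. -/
theorem summable_pow_mul_exp_neg {a : ℕ → ℝ} {b q : ℝ} (hb : 0 < b) (hq : 0 < q)
    (ha : ∀ n : ℕ, b * n ≤ a n) (p : ℕ) : Summable fun n => a n ^ p * Real.exp (-(q * a n)) := by
  have ha0 : ∀ n, 0 ≤ a n := fun n => (by positivity : 0 ≤ b * n).trans (ha n)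
  have hgeo : Summable fun n : ℕ => p.factorial * (2 / q) ^ p * Real.exp (-(q * b / 2)) ^ n :=
    (summable_geometric_of_lt_one (Real.exp_nonneg _)
      (Real.exp_lt_one_iff.2 (by rw [neg_lt_zero]; positivity))).mul_left _
  refine Summable.of_nonneg_of_le
    (fun n => mul_nonneg (pow_nonneg (ha0 n) p) (Real.exp_nonneg _)) (fun n => ?_) hgeo
  have h1 := Real.pow_div_factorial_le_exp (q / 2 * a n)
    (mul_nonneg (by positivity) (ha0 n)) p
  rw [div_le_iff₀ (by positivity)] at h1
  have h2 : a n ^ p ≤ p.factorial * (2 / q) ^ p * Real.exp (q / 2 * a n) :=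
    calc a n ^ p = (2 / q) ^ p * (q / 2 * a n) ^ p := by
          rw [← mul_pow]; congr 1; field_simp
      _ ≤ (2 / q) ^ p * (Real.exp (q / 2 * a n) * p.factorial) := by gcongr
      _ = _ := by ring
  calc a n ^ p * Real.exp (-(q * a n))
      ≤ (p.factorial * (2 / q) ^ p * Real.exp (q / 2 * a n)) * Real.exp (-(q * a n)) := by gcongr
    _ = p.factorial * (2 / q) ^ p * Real.exp (-(q / 2 * a n)) := by
        rw [mul_assoc, ← Real.exp_add]; congr 2; ring
    _ ≤ p.factorial * (2 / q) ^ p * Real.exp (-(q / 2 * (b * n))) := by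
        gcongr
        exact ha n
    _ = _ := by rw [← Real.exp_nat_mul]; congr 2; ring

/-- A form of the inequality `z ≤ t + z ^ 2 / t`, integrated over a set. -/
theorem setLIntegral_le_mul_add_sq {Ω : Type*} [MeasurableSpace Ω] (P : Measure Ω) (F : Set Ω)
    {Z : Ω → ℝ≥0∞} (hZ : Measurable Z) {t : ℝ} (ht : 0 < t) :
    ∫⁻ a in F, Z a ∂P
      ≤ ENNReal.ofReal t * P F + ENNReal.ofReal t⁻¹ * ∫⁻ a, Z a ^ 2 ∂P := by
  have ht0 : ENNReal.ofReal t ≠ 0 := (ENNReal.ofReal_pos.2 ht).ne'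
  have hpt : ∀ z : ℝ≥0∞, z ≤ ENNReal.ofReal t + ENNReal.ofReal t⁻¹ * z ^ 2 := by
    intro z
    rcases le_or_gt z (ENNReal.ofReal t) with h | h
    · exact h.trans le_self_add
    · refine le_trans ?_ le_add_self
      calc z = (ENNReal.ofReal t)⁻¹ * (ENNReal.ofReal t * z) := by
            rw [← mul_assoc, ENNReal.inv_mul_cancel ht0 ENNReal.ofReal_ne_top, one_mul]
        _ ≤ (ENNReal.ofReal t)⁻¹ * (z * z) := by gcongr
        _ = _ := by rw [ENNReal.ofReal_inv_of_pos ht, sq]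
  calc ∫⁻ a in F, Z a ∂P ≤ ∫⁻ a in F, (ENNReal.ofReal t + ENNReal.ofReal t⁻¹ * Z a ^ 2) ∂P :=
        lintegral_mono fun a => hpt (Z a)
    _ = ENNReal.ofReal t * P F + ENNReal.ofReal t⁻¹ * ∫⁻ a in F, Z a ^ 2 ∂P := by
        rw [lintegral_add_left measurable_const, setLIntegral_const,
          lintegral_const_mul _ (hZ.pow_const 2)]
    _ ≤ _ := by gcongr; exact Measure.restrict_le_self

namespace IsPoissonProcess
open Config

variable {M : Type*} [MetricSpace M] [SecondCountableTopology M] [LocallyCompactSpace M]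
  [MeasurableSpace M] [BorelSpace M] {μ : Measure M} {P : Measure (Config M)}

/-- If the Voronoi cell of `o` reaches out to distance `2 n`, then one of the balls of radius
`2 n - 2` around the points of a `1`-net contains no point of the process. -/
theorem exists_voronoi_tail (hP : IsPoissonProcess μ P) (h : HasHomogeneousBalls μ) (o : M)
    (n : ℕ) (hn : 2 ≤ n) :
    ∃ F : Set (Config M), MeasurableSet F ∧
      (∀ Ξ : Config M, ∀ z, 2 * n ≤ dist o z → Ξ ∈ voidEvent (Metric.ball z (dist o z)) → Ξ ∈ F) ∧
      P F ≤ ENNReal.ofReal (μ.real (Metric.ball o (2 * n + 1 / 2)) / μ.real (Metric.ball o (1 / 2))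
        * Real.exp (-μ.real (Metric.ball o (2 * n - 2)))) := by
  have hn' : (2 : ℝ) ≤ n := by exact_mod_cast hn
  obtain ⟨N, hN, hcard⟩ := h.exists_net o (R := 2 * n) one_pos (h.measure_ball_lt_top _ _)
  refine ⟨⋃ x ∈ N, voidEvent (Metric.ball x (2 * n - 2)), ?_, fun Ξ z hz hΞ => ?_, ?_⟩
  · exact Finset.measurableSet_biUnion _ fun x _ => measurableSet_voidEvent measurableSet_ball
  · obtain ⟨z', h1, h2⟩ := h.exists_between (x := o) (y := z) (a := 2 * n)
      (b := dist o z - 2 * n + 1) (by linarith) (by linarith) (by linarith)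
    obtain ⟨x, hx, hx'⟩ := hN z' (by rwa [Metric.mem_ball, dist_comm])
    refine mem_biUnion hx ?_
    rw [mem_voidEvent_ball] at hΞ ⊢
    intro s hs
    have := hΞ s hs
    linarith [dist_triangle4 s x z' z, dist_comm x z']
  · have hcard' : (N.card : ℝ) ≤ μ.real (Metric.ball o (2 * n + 1 / 2))
        / μ.real (Metric.ball o (1 / 2)) := by
      rw [le_div_iff₀ (h.real_ball_pos o (by norm_num))]
      have := ENNReal.toReal_mono (h.measure_ball_lt_top _ _).ne hcard
      rwa [ENNReal.toReal_mul, ENNReal.toReal_natCast] at this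
    calc P (⋃ x ∈ N, voidEvent (Metric.ball x (2 * n - 2)))
        ≤ ∑ x ∈ N, P (voidEvent (Metric.ball x (2 * n - 2))) := measure_biUnion_finset_le _ _
      _ ≤ ∑ x ∈ N, ENNReal.ofReal (Real.exp (-μ.real (Metric.ball o (2 * n - 2)))) := by
          refine Finset.sum_le_sum fun x _ => ?_
          refine (hP.measure_voidEvent_le Metric.isOpen_ball).trans_eq ?_
          rw [h.ball_eq x o]
          rfl
      _ = ENNReal.ofReal (N.card * Real.exp (-μ.real (Metric.ball o (2 * n - 2)))) := by
          rw [Finset.sum_const, nsmul_eq_mul, ENNReal.ofReal_mul (by positivity),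
            ENNReal.ofReal_natCast]
      _ ≤ _ := by gcongr

/-- The number of points and the measure of a ball have all moments. -/
theorem lintegral_one_add_ball_pow_le [IsFiniteMeasureOnCompacts μ] (hP : IsPoissonProcess μ P)
    (o : M) (R : ℝ) (m : ℕ) :
    ∫⁻ Ξ, (1 + (Ξ.toMeasure (Metric.ball o R) + μ (Metric.ball o R))) ^ m ∂P
      ≤ ENNReal.ofReal (m.factorial * Real.exp 3) * (1 + μ (Metric.ball o R)) ^ (2 * m) := by
  have hm : Measurable fun Ξ : Config M => Ξ.toMeasure (Metric.ball o R) :=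
    (Measure.measurable_coe measurableSet_ball).comp measurable_toMeasure
  calc ∫⁻ Ξ, (1 + (Ξ.toMeasure (Metric.ball o R) + μ (Metric.ball o R))) ^ m ∂P
      ≤ ∫⁻ Ξ, (1 + μ (Metric.ball o R)) ^ m * (1 + Ξ.toMeasure (Metric.ball o R)) ^ m ∂P := by
        refine lintegral_mono fun Ξ => ?_
        rw [← mul_pow]
        gcongr
        calc 1 + (Ξ.toMeasure (Metric.ball o R) + μ (Metric.ball o R))
            ≤ 1 + (Ξ.toMeasure (Metric.ball o R) + μ (Metric.ball o R))
              + μ (Metric.ball o R) * Ξ.toMeasure (Metric.ball o R) := le_self_add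
          _ = _ := by ring
    _ = (1 + μ (Metric.ball o R)) ^ m * ∫⁻ Ξ, (1 + Ξ.toMeasure (Metric.ball o R)) ^ m ∂P :=
        lintegral_const_mul _ ((hm.const_add 1).pow_const m)
    _ ≤ (1 + μ (Metric.ball o R)) ^ m
        * (ENNReal.ofReal (m.factorial * Real.exp 3) * (1 + μ (Metric.ball o R)) ^ m) := by
        gcongr
        exact hP.lintegral_one_add_toMeasure_pow_le Metric.isOpen_ball m
    _ = _ := by ring

/-- A quantity has all moments if it is at most the number of points plus the volume of the ball of
radius `2 R` whenever the Voronoi cell of `o` lies in the ball of radius `R`. -/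
theorem lintegral_pow_lt_top [PreconnectedSpace M] [IsFiniteMeasureOnCompacts μ]
    (hP : IsPoissonProcess μ P) (h : HasHomogeneousBalls μ) (o : M) {X : Config M → ℝ≥0∞}
    (hX : ∀ (R : ℝ) (Ξ : Config M),
      (∀ z, Ξ ∈ voidEvent (Metric.ball z (dist o z)) → dist o z < R) →
        X Ξ ≤ Ξ.toMeasure (Metric.ball o (2 * R)) + μ (Metric.ball o (2 * R))) (m : ℕ) :
    ∫⁻ Ξ, X Ξ ^ m ∂P < ⊤ := by
  have hmom : ∀ (R : ℝ) (m : ℕ),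
      ∫⁻ Ξ, (1 + (Ξ.toMeasure (Metric.ball o R) + μ (Metric.ball o R))) ^ m ∂P < ⊤ := fun R m =>
    (hP.lintegral_one_add_ball_pow_le o R m).trans_lt (ENNReal.mul_lt_top ENNReal.ofReal_lt_top
      (ENNReal.pow_lt_top (ENNReal.add_lt_top.2 ⟨ENNReal.one_lt_top, h.measure_ball_lt_top o R⟩)))
  -- in a bounded space the cell always lies in a fixed ball
  by_cases hub : ∀ R : ℝ, ∃ y, R ≤ dist o y
  swap
  · push Not at hub
    obtain ⟨R, hR⟩ := hub
    refine (lintegral_mono fun Ξ => ?_).trans_lt (hmom (2 * R) m)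
    exact pow_le_pow_left' ((hX R Ξ fun z _ => hR z).trans le_add_self) m
  set V : ℝ → ℝ := fun r => μ.real (Metric.ball o r) with hV
  obtain ⟨C, hC1, hCa, hCb, hCc⟩ := h.exists_growth_const o
  have hC0 : 0 < C := by linarith
  have hVpos : ∀ {r : ℝ}, 0 < r → 0 < V r := fun hr => h.real_ball_pos o hr
  have hVh := hVpos (r := 1 / 2) (by norm_num)
  have hgrow := h.natCast_mul_le_real_ball o hub
  choose F hFm hF hFP using fun n : ℕ => hP.exists_voronoi_tail h o (n + 2) (by omega)
  let Y : ℕ → Config M → ℝ≥0∞ := fun n Ξ =>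
    Ξ.toMeasure (Metric.ball o (4 * n + 4)) + μ (Metric.ball o (4 * n + 4))
  have hYm : ∀ n, Measurable (Y n) := fun n =>
    ((Measure.measurable_coe measurableSet_ball).comp measurable_toMeasure).add_const _
  have hYX : ∀ (n : ℕ) (Ξ : Config M),
      (∀ z, Ξ ∈ voidEvent (Metric.ball z (dist o z)) → dist o z < 2 * ((n + 1 : ℕ) : ℝ)) →
        X Ξ ≤ 1 + Y n Ξ := by
    intro n Ξ hz
    have := hX _ Ξ hz
    rw [show (2 * (2 * ((n + 1 : ℕ) : ℝ))) = 4 * n + 4 by push_cast; ring] at this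
    exact this.trans le_add_self
  -- the size of the cell is measured by the least `n` for which it lies in the `2 n`-ball
  have hpt : ∀ Ξ, X Ξ ^ m ≤ (1 + Y 1 Ξ) ^ m
      + ∑' n, (F n).indicator (fun Ξ => (1 + Y (n + 2) Ξ) ^ m) Ξ := by
    intro Ξ
    by_cases hbd : ∃ n : ℕ, ∀ z, Ξ ∈ voidEvent (Metric.ball z (dist o z)) → dist o z < 2 * (n : ℝ)
    · classical
      rcases Nat.lt_or_ge (Nat.find hbd) 3 with hlt | hge
      · refine le_trans (pow_le_pow_left' (hYX 1 Ξ fun z hz => ?_) m) le_self_add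
        refine (Nat.find_spec hbd z hz).trans_le ?_
        have : (Nat.find hbd : ℝ) ≤ ((1 + 1 : ℕ) : ℝ) := by exact_mod_cast Nat.lt_succ_iff.1 hlt
        linarith
      · obtain ⟨n, hn⟩ := Nat.exists_eq_add_of_le hge
        have hspec := Nat.find_spec hbd
        have hmin := Nat.find_min hbd (m := n + 2) (by omega)
        push Not at hmin
        obtain ⟨z, hz, hzn⟩ := hmin
        refine le_trans ?_ (le_trans (ENNReal.le_tsum n) le_add_self)
        rw [indicator_of_mem (hF n Ξ z hzn hz)]
        refine pow_le_pow_left' (hYX (n + 2) Ξ ?_) m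
        rwa [show n + 2 + 1 = Nat.find hbd by omega]
    · push Not at hbd
      have hone : ∀ n, 1 ≤ (F n).indicator (fun Ξ => (1 + Y (n + 2) Ξ) ^ m) Ξ := by
        intro n
        obtain ⟨z, hz, hzn⟩ := hbd (n + 2)
        rw [indicator_of_mem (hF n Ξ z hzn hz)]
        exact one_le_pow₀ le_self_add
      -- if the cell is unbounded then all events `F n` occur, and the right side is infinite
      have htop : ∑' n, (F n).indicator (fun Ξ => (1 + Y (n + 2) Ξ) ^ m) Ξ = ⊤ := by
        rw [eq_top_iff, ← ENNReal.tsum_const_eq_top_of_ne_zero (α := ℕ) one_ne_zero]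
        exact ENNReal.tsum_le_tsum hone
      rw [htop, add_top]
      exact le_top
  -- each term decays exponentially in the volume `a n` of the ball: the probability of `F n` is
  -- at most a multiple of `a n * exp (- a n / C)`, and the threshold `t = exp (a n / (2 C))`
  -- balances the two terms
  set a : ℕ → ℝ := fun n => V (2 * (n + 2 : ℕ)) with ha
  set D := ((2 * m).factorial : ℝ) * Real.exp 3 with hD
  have hterm : ∀ n, ∫⁻ Ξ in F n, (1 + Y (n + 2) Ξ) ^ m ∂P
      ≤ ENNReal.ofReal (C / V (1 / 2) * (a n ^ 1 * Real.exp (-(1 / (2 * C) * a n)))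
        + D * C ^ (2 * (2 * m))
          * (a n ^ (2 * (2 * (2 * m))) * Real.exp (-(1 / (2 * C) * a n)))) := by
    intro n
    have han : 0 < a n := hVpos (by positivity)
    refine (setLIntegral_le_mul_add_sq P (F n) (((hYm (n + 2)).const_add 1).pow_const m)
      (Real.exp_pos (1 / (2 * C) * a n))).trans ?_
    rw [ENNReal.ofReal_add (by positivity) (by positivity), ← Real.exp_neg]
    refine add_le_add ?_ ?_
    · calc ENNReal.ofReal (Real.exp (1 / (2 * C) * a n)) * P (F n)
          ≤ ENNReal.ofReal (Real.exp (1 / (2 * C) * a n)) * ENNReal.ofReal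
            (V (2 * (n + 2 : ℕ) + 1 / 2) / V (1 / 2) * Real.exp (-V (2 * (n + 2 : ℕ) - 2))) := by
            gcongr
            exact hFP n
        _ = ENNReal.ofReal (Real.exp (1 / (2 * C) * a n)
            * (V (2 * (n + 2 : ℕ) + 1 / 2) / V (1 / 2) * Real.exp (-V (2 * (n + 2 : ℕ) - 2)))) :=
            (ENNReal.ofReal_mul (Real.exp_nonneg _)).symm
        _ ≤ _ := by
            refine ENNReal.ofReal_le_ofReal ?_
            have h1 : V (2 * (n + 2 : ℕ) + 1 / 2) ≤ C * a n := hCa (n + 2) (by omega)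
            have h2 : a n ≤ C * V (2 * (n + 2 : ℕ) - 2) := hCb (n + 2) (by omega)
            have h3 : -V (2 * (n + 2 : ℕ) - 2) ≤ -(1 / C * a n) := by
              rw [neg_le_neg_iff, one_div_mul_eq_div, div_le_iff₀ hC0]
              linarith
            calc Real.exp (1 / (2 * C) * a n)
                * (V (2 * (n + 2 : ℕ) + 1 / 2) / V (1 / 2)
                  * Real.exp (-V (2 * (n + 2 : ℕ) - 2)))
                ≤ Real.exp (1 / (2 * C) * a n)
                * (C * a n / V (1 / 2) * Real.exp (-(1 / C * a n))) := by gcongr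
              _ = C * a n / V (1 / 2)
                * Real.exp (1 / (2 * C) * a n + -(1 / C * a n)) := by rw [Real.exp_add]; ring
              _ = _ := by
                rw [show 1 / (2 * C) * a n + -(1 / C * a n) = -(1 / (2 * C) * a n) by
                  field_simp; ring]
                ring
    · have hsq : ∀ Ξ, ((1 + Y (n + 2) Ξ) ^ m) ^ 2 = (1 + Y (n + 2) Ξ) ^ (2 * m) := fun Ξ => by
        rw [← pow_mul, mul_comm]
      simp only [hsq]
      have hball : 1 + μ (Metric.ball o (4 * (n + 2 : ℕ) + 4)) ≤ ENNReal.ofReal (C * a n ^ 2) := by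
        rw [← ENNReal.ofReal_toReal (h.measure_ball_lt_top o (4 * (n + 2 : ℕ) + 4)).ne,
          ← ENNReal.ofReal_one, ← ENNReal.ofReal_add zero_le_one ENNReal.toReal_nonneg]
        exact ENNReal.ofReal_le_ofReal (hCc (n + 2) (by omega))
      calc ENNReal.ofReal (Real.exp (-(1 / (2 * C) * a n)))
          * ∫⁻ Ξ, (1 + Y (n + 2) Ξ) ^ (2 * m) ∂P
          ≤ ENNReal.ofReal (Real.exp (-(1 / (2 * C) * a n)))
            * (ENNReal.ofReal D * ENNReal.ofReal (C * a n ^ 2) ^ (2 * (2 * m))) := by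
            gcongr
            refine (hP.lintegral_one_add_ball_pow_le o _ (2 * m)).trans ?_
            gcongr
        _ = _ := by
            rw [← ENNReal.ofReal_pow (by positivity), ← ENNReal.ofReal_mul (by positivity),
              ← ENNReal.ofReal_mul (by positivity)]
            congr 1
            rw [mul_pow, ← pow_mul]
            ring
  have hsum : Summable fun n : ℕ =>
      C / V (1 / 2) * (a n ^ 1 * Real.exp (-(1 / (2 * C) * a n)))
        + D * C ^ (2 * (2 * m))
          * (a n ^ (2 * (2 * (2 * m))) * Real.exp (-(1 / (2 * C) * a n))) := by
    have hlin : ∀ n : ℕ, V 1 * n ≤ a n := by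
      intro n
      refine le_trans ?_ (hgrow (n + 2))
      push_cast
      nlinarith [hVpos (r := 1) one_pos]
    exact ((summable_pow_mul_exp_neg (hVpos one_pos) (by positivity) hlin 1).mul_left _).add
      ((summable_pow_mul_exp_neg (hVpos one_pos) (by positivity) hlin _).mul_left _)
  have hmeas : ∀ n, Measurable fun Ξ => (1 + Y n Ξ) ^ m := fun n =>
    ((hYm n).const_add 1).pow_const m
  calc ∫⁻ Ξ, X Ξ ^ m ∂P
      ≤ ∫⁻ Ξ, ((1 + Y 1 Ξ) ^ m + ∑' n, (F n).indicator (fun Ξ => (1 + Y (n + 2) Ξ) ^ m) Ξ) ∂P :=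
        lintegral_mono hpt
    _ = ∫⁻ Ξ, (1 + Y 1 Ξ) ^ m ∂P + ∑' n, ∫⁻ Ξ in F n, (1 + Y (n + 2) Ξ) ^ m ∂P := by
        rw [lintegral_add_left (hmeas 1), lintegral_tsum
          fun n => ((hmeas (n + 2)).indicator (hFm n)).aemeasurable]
        simp only [lintegral_indicator (hFm _)]
    _ < ⊤ := by
        refine ENNReal.add_lt_top.2 ⟨hmom _ m, ?_⟩
        refine (ENNReal.tsum_le_tsum hterm).trans_lt ?_
        exact hsum.tsum_ofReal_lt_top

end IsPoissonProcess

/-! ### The volume of the Voronoi cell and the Delaunay degree -/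

/-- Finite moments of integer order give finite moments of real order: `t ^ k ≤ 1 + t ^ ⌈k⌉`. -/
theorem hasFiniteMoment_of_forall_pow {Ω : Type*} [MeasurableSpace Ω] {Q : Measure Ω}
    [IsFiniteMeasure Q] {X : Ω → ℝ≥0∞} (hX : AEMeasurable X Q)
    (h : ∀ m : ℕ, ∫⁻ a, X a ^ m ∂Q < ⊤) {k : ℝ} (hk : 0 ≤ k) : HasFiniteMoment Q X k := by
  refine ⟨hX, ?_⟩
  have hpt : ∀ a, X a ^ k ≤ 1 + X a ^ ⌈k⌉₊ := by
    intro a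
    rcases le_total (X a) 1 with h1 | h1
    · exact (ENNReal.rpow_le_one h1 hk).trans le_self_add
    · rw [← ENNReal.rpow_natCast]
      exact (ENNReal.rpow_le_rpow_of_exponent_le h1 (Nat.le_ceil k)).trans le_add_self
  refine (lintegral_mono hpt).trans_lt ?_
  rw [lintegral_add_left measurable_const, lintegral_const, one_mul]
  exact ENNReal.add_lt_top.2 ⟨measure_lt_top _ _, h _⟩

namespace Config

variable {M : Type*} [MetricSpace M]

/-- The point `o` never lies in the open ball around `z` whose boundary contains it. -/
theorem addPoint_mem_voidEvent_ball {o z : M} {Ξ : Config M} :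
    addPoint o Ξ ∈ voidEvent (Metric.ball z (dist o z))
      ↔ Ξ ∈ voidEvent (Metric.ball z (dist o z)) := by
  simp only [mem_voidEvent_ball]
  exact ⟨fun h s hs => h s (mem_insert_of_mem _ hs), fun h s hs =>
    hs.elim (fun hs => hs ▸ le_rfl) (h s)⟩

theorem map_addPoint (g : M ≃ₜ M) (x : M) (Ξ : Config M) :
    Config.map g (addPoint x Ξ) = addPoint (g x) (Config.map g Ξ) :=
  Subtype.ext (image_insert_eq ..)

end Config

namespace IsPoissonProcess
open Config

variable {M : Type*} [MetricSpace M] [SecondCountableTopology M] [LocallyCompactSpace M]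
  [MeasurableSpace M] [BorelSpace M] {μ : Measure M} {P : Measure (Config M)}

theorem lintegral_measure_voronoi_pow_lt_top [PreconnectedSpace M] [IsFiniteMeasureOnCompacts μ]
    (hP : IsPoissonProcess μ P) (h : HasHomogeneousBalls μ) (o : M) (m : ℕ) :
    ∫⁻ Ξ, μ {y | Ξ ∈ voidEvent (Metric.ball y (dist o y))} ^ m ∂P < ⊤ := by
  refine hP.lintegral_pow_lt_top h o (fun R Ξ hR => le_trans (measure_mono fun y hy => ?_)
    le_add_self) m
  -- `R` is positive, since `o` belongs to its cell
  have h0 : dist o o < R := hR o (by simp [voidEvent])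
  have hy' := hR y hy
  rw [dist_self] at h0
  rw [Metric.mem_ball, dist_comm]
  linarith

theorem lintegral_delaunayNeighbors_pow_lt_top [PreconnectedSpace M] [IsFiniteMeasureOnCompacts μ]
    (hP : IsPoissonProcess μ P) (h : HasHomogeneousBalls μ) (o : M) (m : ℕ) :
    ∫⁻ Ξ, ((((addPoint o Ξ).1 ∩ {x | x ≠ o ∧ (x, addPoint o Ξ) ∈ delaunaySet o}).encard : ℕ∞) :
      ℝ≥0∞) ^ m ∂P < ⊤ := by
  refine hP.lintegral_pow_lt_top h o (fun R Ξ hR => le_trans ?_ le_self_add) m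
  rw [toMeasure_apply Ξ measurableSet_ball]
  refine ENat.toENNReal_le.2 (encard_le_encard ?_)
  rintro x ⟨hx, hxo, z, hz, hΞ⟩
  have hlt := hR z (addPoint_mem_voidEvent_ball.1 hΞ)
  refine ⟨hx.resolve_left hxo, ?_⟩
  rw [Metric.mem_ball]
  have hz' : dist o z = dist x z := hz
  linarith [dist_triangle x z o, dist_comm z o]

omit [LocallyCompactSpace M] in
/-- Under the law of `Ξ ∪ {o}`, a functional need only be evaluated at configurations that
contain `o`. -/
theorem hasFiniteMoment_map_addPoint (hP : IsPoissonProcess μ P) {o : M} {X Y : Config M → ℝ≥0∞}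
    (hY : Measurable Y) (hXY : ∀ Ξ : Config M, o ∈ Ξ.1 → X Ξ = Y Ξ)
    (h : ∀ m : ℕ, ∫⁻ Ξ, Y (addPoint o Ξ) ^ m ∂P < ⊤) {k : ℝ} (hk : 0 ≤ k) :
    HasFiniteMoment (P.map (addPoint o)) X k := by
  have := hP.isProbabilityMeasure
  have hm : Measurable (addPoint o) := measurable_addPoint o
  have := Measure.isProbabilityMeasure_map (μ := P) hm.aemeasurable
  have hmem : ∀ᵐ Ξ ∂P.map (addPoint o), Ξ ∈ (voidEvent {o})ᶜ := by
    refine (ae_map_iff hm.aemeasurable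
      (measurableSet_voidEvent (measurableSet_singleton o)).compl).2 (ae_of_all _ fun Ξ h => ?_)
    exact eq_empty_iff_forall_notMem.1 h o ⟨mem_insert _ _, rfl⟩
  have hae : X =ᵐ[P.map (addPoint o)] Y := by
    filter_upwards [hmem] with Ξ hΞ
    obtain ⟨x, hx, rfl⟩ := nonempty_iff_ne_empty.2 hΞ
    exact hXY Ξ hx
  refine hasFiniteMoment_of_forall_pow (hY.aemeasurable.congr hae.symm) (fun m => ?_) hk
  rw [lintegral_congr_ae (f := fun Ξ => X Ξ ^ m) (g := fun Ξ => Y Ξ ^ m) (hae.fun_comp (· ^ m)),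
    lintegral_map (hY.pow_const m) hm]
  exact h m

end IsPoissonProcess

/-! ### Poisson processes on symmetric spaces -/

section SymmetricSpace

variable {d : ℕ} {M : Type*} [MetricSpace M] [SecondCountableTopology M]
  [ChartedSpace (EuclideanSpace ℝ (Fin d)) M] [IsManifold (𝓡 d) ∞ M]
  [RiemannianBundle (fun x : M => TangentSpace (𝓡 d) x)] [MeasurableSpace M] [BorelSpace M]
  {lam : ℝ≥0} {P : Measure (Config M)}

theorem IsPoissonProcess.map_isometry_eq [LocallyCompactSpace M]
    (hP : IsPoissonProcess (lam • riemannianVolume d M) P) {g : M ≃ₘ^∞⟮𝓡 d, 𝓡 d⟯ M}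
    (hg : IsRiemannianIsometry d g) : P.map (Config.map g.toHomeomorph) = P := by
  refine hP.map_config_map_eq g.toHomeomorph fun K hK => ?_
  have h := riemannianVolume_image hg.symm hK.measurableSet
  have e : g.toHomeomorph ⁻¹' K = g.symm '' K := (g.toEquiv.image_symm_eq_preimage K).symm
  rw [e, Measure.smul_apply, Measure.smul_apply, h]

variable [IsContMDiffRiemannianBundle (𝓡 d) ∞ (EuclideanSpace ℝ (Fin d))
  (fun x : M => TangentSpace (𝓡 d) x)]

theorem IsPoissonProcess.isStationaryProcess [LocallyCompactSpace M]
    (hP : IsPoissonProcess (lam • riemannianVolume d M) P) : IsStationaryProcess d P where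
  isProbabilityMeasure := hP.isProbabilityMeasure
  map_eq _ hg := hP.map_isometry_eq hg
  intensity_lt_top K hK := by
    have := isLocallyFiniteMeasure_riemannianVolume (d := d) (M := M)
    rw [hP.intensity_eq]
    exact hK.measure_lt_top

/-- By Mecke's formula the Palm process of a Poisson process adds the typical point. -/
theorem IsPoissonProcess.isPalmProcess [LocallyCompactSpace M]
    (hP : IsPoissonProcess (lam • riemannianVolume d M) P) (hlam : 0 < lam) (o : M) :
    IsPalmProcess d P o (P.map (Config.addPoint o)) := by
  have := isLocallyFiniteMeasure_riemannianVolume (d := d) (M := M)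
  have := hP.isProbabilityMeasure
  refine ⟨fun h0 => ?_, addPointKernel P, ⟨fun x =>
    Measure.isProbabilityMeasure_map (Config.measurable_addPoint x).aemeasurable⟩,
    fun f hf => ?_, fun g hg x => ?_, rfl⟩
  · have hpos : 0 < (lam • riemannianVolume d M) univ :=
      ENNReal.mul_pos (ENNReal.coe_pos.2 hlam).ne'
        (riemannianVolume_pos isOpen_univ ⟨o, trivial⟩).ne'
    rw [← hP.intensity_eq, h0] at hpos
    exact lt_irrefl _ hpos
  · rw [hP.intensity_eq]
    exact hP.lintegral_lintegral_toMeasure hf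
  · change (P.map (Config.addPoint x)).map (Config.map g.toHomeomorph)
      = P.map (Config.addPoint (g x))
    have hmap := Config.measurable_map g.toHomeomorph
    nth_rw 2 [← hP.map_isometry_eq hg]
    rw [Measure.map_map hmap (Config.measurable_addPoint x),
      Measure.map_map (Config.measurable_addPoint _) hmap]
    exact congrArg P.map (funext fun Ξ => Config.map_addPoint g.toHomeomorph x Ξ)

variable [PreconnectedSpace M] [IsRiemannianManifold (𝓡 d) M]

/-- A symmetric space is a length space in which balls of equal radius have equal volume. -/
theorem hasHomogeneousBalls_smul_riemannianVolume (hM : IsRiemannianSymmetric d M)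
    (hlam : 0 < lam) : HasHomogeneousBalls (lam • riemannianVolume d M) := by
  have hloc := isLocallyFiniteMeasure_riemannianVolume (d := d) (M := M)
  refine ⟨fun ha hb h => exists_dist_lt_dist_lt d ha hb h, fun x y r => ?_, fun x r hr => ?_,
    fun x => ?_⟩
  · simp only [Measure.smul_apply, riemannianVolume_ball_eq hM x y r]
  · exact ENNReal.mul_pos (ENNReal.coe_pos.2 hlam).ne'
      (riemannianVolume_pos Metric.isOpen_ball ⟨x, Metric.mem_ball_self hr⟩).ne'
  · obtain ⟨s, hs, hfin⟩ := (lam • riemannianVolume d M).finiteAt_nhds x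
    obtain ⟨r, hr, hsub⟩ := Metric.mem_nhds_iff.1 hs
    exact ⟨r, hr, (measure_mono hsub).trans_lt hfin⟩

theorem IsPoissonProcess.hasFiniteMoment_cellVolume [LocallyCompactSpace M]
    (hM : IsRiemannianSymmetric d M) (hP : IsPoissonProcess (lam • riemannianVolume d M) P)
    (hlam : 0 < lam) (o : M) {k : ℝ} (hk : 0 ≤ k) :
    HasFiniteMoment (P.map (Config.addPoint o)) (cellVolume d o) k := by
  have := isLocallyFiniteMeasure_riemannianVolume (d := d) (M := M)
  refine hP.hasFiniteMoment_map_addPoint (Config.measurable_measure_voronoi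
    (riemannianVolume d M) o) (fun Ξ ho => by rw [cellVolume, Config.voronoiCell_eq ho])
    (fun m => ?_) hk
  have h := hP.lintegral_measure_voronoi_pow_lt_top
    (hasHomogeneousBalls_smul_riemannianVolume hM hlam) o m
  have hlam' : ((lam : ℝ≥0∞) ^ m) ≠ 0 := pow_ne_zero _ (ENNReal.coe_pos.2 hlam).ne'
  simp only [Measure.smul_apply, ENNReal.smul_def, smul_eq_mul, mul_pow] at h
  rw [lintegral_const_mul' _ _ (ENNReal.pow_ne_top ENNReal.coe_ne_top)] at h
  simp only [Config.addPoint_mem_voidEvent_ball]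
  exact ENNReal.lt_top_of_mul_ne_top_right h.ne hlam'

theorem IsPoissonProcess.hasFiniteMoment_delaunayDegree [LocallyCompactSpace M]
    (hM : IsRiemannianSymmetric d M) (hP : IsPoissonProcess (lam • riemannianVolume d M) P)
    (hlam : 0 < lam) (o : M) {k : ℝ} (hk : 0 ≤ k) :
    HasFiniteMoment (P.map (Config.addPoint o))
      (fun Ξ => (delaunayDegree Ξ.1 o : ℝ≥0∞)) k := by
  have := isLocallyFiniteMeasure_riemannianVolume (d := d) (M := M)
  exact hP.hasFiniteMoment_map_addPoint (Config.measurable_encard_delaunayNeighbors o)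
    (fun Ξ ho => by rw [Config.delaunayDegree_eq ho])
    (hP.lintegral_delaunayNeighbors_pow_lt_top
      (hasHomogeneousBalls_smul_riemannianVolume hM hlam) o) hk

end SymmetricSpace

end PoissonVoronoi

theorem theorem3p3 (d : ℕ) (M : Type*) [MetricSpace M] [ConnectedSpace M]
    [SecondCountableTopology M] [ChartedSpace (EuclideanSpace ℝ (Fin d)) M]
    [IsManifold (𝓡 d) ∞ M] [RiemannianBundle (fun x : M => TangentSpace (𝓡 d) x)]
    [IsContMDiffRiemannianBundle (𝓡 d) ∞ (EuclideanSpace ℝ (Fin d))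
      (fun x : M => TangentSpace (𝓡 d) x)]
    [IsRiemannianManifold (𝓡 d) M] [MeasurableSpace M] [BorelSpace M]
    (hM : PoissonVoronoi.IsRiemannianSymmetric d M) (o : M) (lam : ℝ≥0) (hlam : 0 < lam)
    (P : Measure (PoissonVoronoi.Config M))
    (hP : PoissonVoronoi.IsPoissonProcess (lam • PoissonVoronoi.riemannianVolume d M) P) :
    (∀ k : ℝ, 0 ≤ k →
      PoissonVoronoi.HasFiniteMoment (P.map (PoissonVoronoi.Config.addPoint o))
        (PoissonVoronoi.cellVolume d o) k ∧
      PoissonVoronoi.HasFiniteMoment (P.map (PoissonVoronoi.Config.addPoint o))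
        (fun Ξ => (PoissonVoronoi.delaunayDegree Ξ.1 o : ℝ≥0∞)) k) ∧
    PoissonVoronoi.IsStationaryProcess d P ∧
    PoissonVoronoi.IsPalmProcess d P o (P.map (PoissonVoronoi.Config.addPoint o)) ∧
    PoissonVoronoi.IsDistributionalLattice d o (P.map (PoissonVoronoi.Config.addPoint o)) := by
  have : LocallyCompactSpace M := Manifold.locallyCompact_of_finiteDimensional (𝓡 d)
  have hstat := hP.isStationaryProcess
  have hpalm := hP.isPalmProcess hlam o
  exact ⟨fun k hk => ⟨hP.hasFiniteMoment_cellVolume hM hlam o hk,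
      hP.hasFiniteMoment_delaunayDegree hM hlam o hk⟩, hstat, hpalm, ⟨P, hstat, hpalm⟩,
    hP.hasFiniteMoment_cellVolume hM hlam o zero_le_one,
    hP.hasFiniteMoment_delaunayDegree hM hlam o zero_le_one⟩
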